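/- A $(1,a,\epsilon)$-block encoding of an $n$-qubit operator $A$ is a unitary $U$ on $a+n$ qubits with $\|A-(\langle 0^a|\otimes I)\,U\,(|0^a\rangle\otimes I)\|\le\epsilon$ (operator norm). There are absolute constants $c\in\mathbb N$ and $C,K\in\mathbb R$ such that for all $n,a\in\mathbb N$ and all $\delta,\epsilon\in(0,1)$ there is a quantum circuit $Q$ that depends only on $n,a,\delta,\epsilon$ and has the following properties. It acts on $n$ system qubits, the $a$ ancillae of a queried unitary and $c+1$ additional ancillae, one of which is called the output ancilla. It consists of single-qubit gates, NOT gates controlled by any set of wires being $0$, and queries (plain, or controlled by one of the additional ancillae) to the queried unitary or its adjoint; it makes at most $C\,\frac1\delta\log\frac1\epsilon$ queries. For every Hermitian $n$-qubit operator $H$ with $\|H\|\le 1-\delta$ and every $(1,a,0)$-block encoding $V_H$ of $H$, let $W$ be the unitary that $Q$ implements with queries to $V_H$ and $V_H^\dagger$, and let $$U_H = Z\otimes H + X\otimes\sqrt{I-H^2},$$ where the first tensor factor is the output ancilla. Then: 1. $U_H$ is unitary and is a $(1,1,0)$-block encoding of $H$; 2. $W$ is a $(1,a+c,\epsilon)$-block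 encoding of $U_H$, i.e. the operator $\widetilde U_H=(\langle 0^{a+c}|\otimes I)\,W\,(|0^{a+c}\rangle\otimes I)$ on the output ancilla and the system satisfies $\|U_H-\widetilde U_H\|\le\epsilon$; 3. consequently $\|H-(\langle 0|\otimes I)\,\widetilde U_H\,(|0\rangle\otimes I)\|\le\epsilon$; 4. all other ancillae are returned to zero up to error $K\epsilon$: $\|W(|0^{a+c}\rangle\otimes|\psi\rangle)-|0^{a+c}\rangle\otimes U_H|\psi\rangle\|\le K\epsilon$ for every unit vector $|\psi\rangle$ of the output ancilla and the system. -/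

import Mathlib

open scoped Matrix Matrix.Norms.L2Operator

noncomputable section

namespace BlockEnc

/-- Labels of the computational basis of a register whose qubits are indexed by `ι`.
The state space of the register is `ℂ ^ (Reg ι)`; matrices carry the operator (spectral) norm. -/
abbrev Reg (ι : Type) : Type := ι → Fin 2

/-- Operators on a register, as matrices in the computational basis. -/
abbrev Op (ι : Type) : Type := Matrix (Reg ι) (Reg ι) ℂ

section Encoding

variable {κ ι : Type} [Fintype κ] [DecidableEq κ] [Fintype ι] [DecidableEq ι]

/-- The isometry `|0…0⟩ ⊗ I`, which adjoins a register `κ` of ancillae in the zero state. -/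
def zeroKet (κ ι : Type) [Fintype κ] [DecidableEq κ] [Fintype ι] [DecidableEq ι] :
    Matrix (Reg (κ ⊕ ι)) (Reg ι) ℂ :=
  Matrix.of fun x y => if (∀ k, x (Sum.inl k) = 0) ∧ (∀ i, x (Sum.inr i) = y i) then 1 else 0

/-- The block `(⟨0…0| ⊗ I) U (|0…0⟩ ⊗ I)`. -/
def corner (U : Op (κ ⊕ ι)) : Op ι :=
  (zeroKet κ ι)ᴴ * U * zeroKet κ ι

/-- `U` is an `(α, a, ε)`-block encoding of `A`, where `a` is the number of qubits in `κ`. -/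
def IsBlockEncoding (α ε : ℝ) (U : Op (κ ⊕ ι)) (A : Op ι) : Prop :=
  U ∈ Matrix.unitaryGroup (Reg (κ ⊕ ι)) ℂ ∧ ‖A - (α : ℂ) • corner U‖ ≤ ε

/-- For every unit vector `ψ`, the vector `W (|0…0⟩ ⊗ ψ)` is within `η` of `|0…0⟩ ⊗ U ψ`:
`W` performs `U` and gives the ancillae in `κ` back in the zero state, up to error `η`. -/
def ImplementsClean (η : ℝ) (W : Op (κ ⊕ ι)) (U : Op ι) : Prop :=
  ‖W * zeroKet κ ι - zeroKet κ ι * U‖ ≤ η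

/-- The tensor product of operators on two registers. -/
def tensor (A : Op κ) (B : Op ι) : Op (κ ⊕ ι) :=
  Matrix.of fun x y => A (x ∘ Sum.inl) (y ∘ Sum.inl) * B (x ∘ Sum.inr) (y ∘ Sum.inr)

end Encoding

/-- The Pauli matrix `X` on a one-qubit register. -/
def pauliX : Op (Fin 1) :=
  Matrix.of fun x y => !![0, 1; 1, 0] (x 0) (y 0)

/-- The Pauli matrix `Z` on a one-qubit register. -/
def pauliZ : Op (Fin 1) :=
  Matrix.of fun x y => !![1, 0; 0, -1] (x 0) (y 0)

/-- The operator `Z ⊗ H + X ⊗ √(I - H²)` for Hermitian `H` with `‖H‖ ≤ 1`. -/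
def hermitianDilation {ι : Type} [Fintype ι] [DecidableEq ι] (H : Op ι) : Op (Fin 1 ⊕ ι) :=
  tensor pauliZ H + tensor pauliX (cfc Real.sqrt (1 - H ^ 2))

/-- The wires of a circuit: `c` work ancillae, the `a` ancillae of the given block encoding, one
output ancilla, and `n` system qubits. The first two groups are to be returned to zero. -/
abbrev Wire (c a n : ℕ) : Type := (Fin c ⊕ Fin a) ⊕ (Fin 1 ⊕ Fin n)

/-- The gates of an oracle circuit. No gate depends on the operator that is queried. -/
inductive Gate (c a n : ℕ) : Type
  /-- A single-qubit gate. -/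
  | single (q : Wire c a n) (u : Matrix.unitaryGroup (Fin 2) ℂ) : Gate c a n
  /-- A NOT on `q`, controlled by all the wires in `S` being zero. -/
  | cnot (S : Finset (Wire c a n)) (q : Wire c a n) (hq : q ∉ S) : Gate c a n
  /-- A query, to the adjoint if `adj`, possibly controlled by a work or output wire being one. -/
  | query (ctrl : Option (Fin c ⊕ Fin 1)) (adj : Bool) : Gate c a n

namespace Gate

variable {c a n : ℕ}

/-- Whether a gate is a query. -/
def isQuery : Gate c a n → Bool
  | query _ _ => true
  | _ => false

/-- The basis state that the controlled NOT makes out of `x`. -/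
def flip (S : Finset (Wire c a n)) (q : Wire c a n) (x : Reg (Wire c a n)) :
    Reg (Wire c a n) :=
  if ∀ r ∈ S, x r = 0 then Function.update x q (x q + 1) else x

/-- The wires that the queried operator acts on: the encoding's ancillae and the system. -/
def acted : Fin a ⊕ Fin n → Wire c a n := Sum.map Sum.inr Sum.inr

/-- The other wires: the work ancillae and the output ancilla. -/
def other : Fin c ⊕ Fin 1 → Wire c a n := Sum.map Sum.inl Sum.inl

/-- The operator of a gate, when `V` is the operator that is queried. -/
def toOp (V : Op (Fin a ⊕ Fin n)) : Gate c a n → Op (Wire c a n)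
  | single q u => Matrix.of fun x y => if ∀ r, r ≠ q → x r = y r then u.1 (x q) (y q) else 0
  | cnot S q _ => Matrix.of fun x y => if x = flip S q y then 1 else 0
  | query ctrl adj => Matrix.of fun x y =>
      if x ∘ other = y ∘ other then
        if ∀ k ∈ ctrl, y (other k) = 1 then
          (if adj then Vᴴ else V) (x ∘ acted) (y ∘ acted)
        else (1 : Op (Fin a ⊕ Fin n)) (x ∘ acted) (y ∘ acted)
      else 0

end Gate

/-- A circuit is a list of gates, the first of which is applied first. -/
abbrev Circuit (c a n : ℕ) : Type := List (Gate c a n)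

/-- The number of queries, plain or controlled, to the queried operator and its adjoint. -/
def Circuit.queries {c a n : ℕ} (Q : Circuit c a n) : ℕ := Q.countP Gate.isQuery

/-- The operator of a circuit, when `V` is the operator that is queried. -/
def Circuit.toOp {c a n : ℕ} (V : Op (Fin a ⊕ Fin n)) (Q : Circuit c a n) :
    Op (Wire c a n) :=
  (Q.map (Gate.toOp V)).reverse.prod

end BlockEnc

end

/-!
The circuit combines `H` itself, of which one query is a block encoding, with a block encoding of
a polynomial approximation of `√(I - H²)`, and it then amplifies the result.

*The polynomial.* By the generating function of the Catalan numbers,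
`√(1 - y) = 1 - ∑ k, sqrtCoeff k * y ^ (k + 1)` with nonnegative coefficients of sum at most one.
The Taylor polynomial `sqrtPoly D` is therefore within `(1 - δ) ^ D` of the square root on
`[0, 1 - δ]`, and the Fourier coefficients of `sqrtPoly D (cos² (θ / 2))` have an `ℓ¹` norm of at
most `2`, whatever `D` is (`coeffNorm_sqrtFourier_le`).

*Signal processing.* Let `Π` project onto the zero state of the ancillae of the block encoding `V`.
The walk operator `w = (1 - 2Π) V† (1 - 2Π) V` is unitary, and `(2 + w + w†) / 4` agrees with `H²`
on the range of `Π`. Quantum signal processing with rotations of sines `s₀, s₁, …` on one further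
qubit turns `w` into a polynomial in `w`. A prescribed polynomial with small `ℓ¹` norm of the
coefficients is attained, since the map from the sines to the coefficients is a small Lipschitz
perturbation of the identity, so that the quantitative inverse function theorem applies
(`exists_qspPair_eq`). This yields a block encoding of `α * sqrtPoly D (H²)` with an absolute
constant `α`, from `O(D)` queries.

*Linear combination.* A control qubit forms the sum of `Z ⊗ H` and `X ⊗ sqrtPoly D (H²)`
(`corner_lcuCircuit`). The inner reflection of the walk is restricted to the state `0` of the
control. In the branch `1` the polynomial is thus evaluated at `0`, where it has the value `1`,
and both branches acquire the same factor `α`. With `α = 2 sin (π / (2 * 3 ^ 6))` the result is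
close to `sin (π / (2 * 3 ^ 6))` times the unitary `U = Z ⊗ H + X ⊗ √(I - H²)`, and six rounds of
oblivious amplitude amplification, each of which triples the angle, give `U` itself
(`exists_circuit`).

*Errors.* The degree `D = O(δ⁻¹ log (1 / ε))` makes the block of the circuit accurate to `ε²`.
As the circuit and `U` are unitary, the ancillae then return to zero up to `2 ε`
(`implementsClean_of_corner`). This covers `ε² < 1 / 2`. For larger `ε` the bound on the number
of queries tends to zero, and coarser circuits are needed: if `δ < 1 - ε`, the single query that
gives `(Z ⊗ H + X ⊗ I) / 2` is allowed and accurate enough, and if `1 - ε ≤ δ`, then `‖H‖ ≤ ε` and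
`√(1 - ε²) X ⊗ I` will do without any query.
-/

/-! ### Sines for a quantum signal processing product -/

namespace BlockEnc

open Polynomial

/-- The first column `(a, β)` of the quantum signal processing product
`∏ diag(1, X) · Rot(sᵢ)`, where `Rot(s)` is the rotation with sine `s` and cosine `√(1 - s²)`;
the factor with index `0` is applied first. -/
noncomputable def qspPair (s : ℕ → ℝ) : ℕ → ℝ[X] × ℝ[X]
  | 0 => (1, 0)
  | k + 1 =>
    (C √(1 - s k ^ 2) * (qspPair s k).1 - C (s k) * (qspPair s k).2,
      X * (C (s k) * (qspPair s k).1 + C √(1 - s k ^ 2) * (qspPair s k).2))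

/-- The `ℓ¹` norm of the coefficients of degree less than `N`. It is a seminorm that
multiplication by `X` does not increase. -/
noncomputable def coeffNorm (N : ℕ) (p : ℝ[X]) : ℝ := ∑ i ∈ Finset.range N, |p.coeff i|

section CoeffNorm

variable {N : ℕ} (p q : ℝ[X]) (r : ℝ)

lemma coeffNorm_nonneg : 0 ≤ coeffNorm N p := Finset.sum_nonneg fun _ _ => abs_nonneg _

lemma coeffNorm_add_le : coeffNorm N (p + q) ≤ coeffNorm N p + coeffNorm N q := by
  simp only [coeffNorm, coeff_add, ← Finset.sum_add_distrib]
  exact Finset.sum_le_sum fun _ _ => abs_add_le _ _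

lemma coeffNorm_neg : coeffNorm N (-p) = coeffNorm N p := by
  simp [coeffNorm]

lemma coeffNorm_sub_le : coeffNorm N (p - q) ≤ coeffNorm N p + coeffNorm N q := by
  rw [sub_eq_add_neg, ← coeffNorm_neg q]
  exact coeffNorm_add_le _ _

lemma coeffNorm_C_mul : coeffNorm N (C r * p) = |r| * coeffNorm N p := by
  simp [coeffNorm, coeff_C_mul, abs_mul, Finset.mul_sum]

lemma coeffNorm_X_mul_le : coeffNorm N (X * p) ≤ coeffNorm N p := by
  rcases N with _ | N
  · simp [coeffNorm]
  · simp only [coeffNorm, Finset.sum_range_succ', coeff_X_mul, coeff_X_mul_zero, abs_zero, add_zero]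
    rw [← Finset.sum_range_succ' (fun i => |p.coeff i|)]
    exact Finset.sum_le_sum_of_subset_of_nonneg (Finset.range_mono (Nat.le_succ N))
      fun _ _ _ => abs_nonneg _

lemma coeffNorm_one_le : coeffNorm N 1 ≤ 1 := by
  rcases N with _ | N
  · simp [coeffNorm]
  · simp [coeffNorm, Finset.sum_range_succ', coeff_one]

lemma coeffNorm_zero : coeffNorm N 0 = 0 := by simp [coeffNorm]

end CoeffNorm

lemma qspPair_natDegree_le (s : ℕ → ℝ) (k : ℕ) :
    (qspPair s k).1.natDegree ≤ k ∧ (qspPair s k).2.natDegree ≤ k := by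
  induction k with
  | zero => simp [qspPair]
  | succ k ih =>
    obtain ⟨h1, h2⟩ := ih
    refine ⟨?_, ?_⟩ <;> simp only [qspPair]
    · refine (natDegree_sub_le _ _).trans (max_le ?_ ?_)
      · exact (natDegree_C_mul_le _ _).trans (by omega)
      · exact (natDegree_C_mul_le _ _).trans (by omega)
    · refine natDegree_mul_le.trans ?_
      have : (C (s k) * (qspPair s k).1 + C √(1 - s k ^ 2) * (qspPair s k).2).natDegree ≤ k :=
        (natDegree_add_le _ _).trans (max_le ((natDegree_C_mul_le _ _).trans h1)
          ((natDegree_C_mul_le _ _).trans h2))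
      have h3 := natDegree_X_le (R := ℝ)
      omega

lemma qspPair_coeff_zero (s : ℕ → ℝ) (k : ℕ) : (qspPair s k).2.coeff 0 = 0 := by
  cases k <;> simp [qspPair]

lemma sqrt_one_sub_sq_le_one (x : ℝ) : √(1 - x ^ 2) ≤ 1 := by
  refine Real.sqrt_le_iff.2 ⟨zero_le_one, ?_⟩
  linarith [sq_nonneg x]

lemma abs_sqrt_one_sub_sq_le_one (x : ℝ) : |√(1 - x ^ 2)| ≤ 1 := by
  rw [abs_of_nonneg (Real.sqrt_nonneg _)]
  exact sqrt_one_sub_sq_le_one x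

lemma abs_sqrt_one_sub_sq_sub_one_le {x : ℝ} (hx : |x| ≤ 1) : |√(1 - x ^ 2) - 1| ≤ |x| := by
  rw [abs_sub_comm, abs_of_nonneg (sub_nonneg.2 (sqrt_one_sub_sq_le_one x))]
  have h : 1 - |x| ≤ √(1 - x ^ 2) := by
    apply Real.le_sqrt_of_sq_le
    nlinarith [abs_nonneg x, sq_abs x]
  linarith

lemma abs_sqrt_one_sub_sq_sub_le {x y : ℝ} (hx : |x| ≤ 1 / 2) (hy : |y| ≤ 1 / 2) :
    |√(1 - x ^ 2) - √(1 - y ^ 2)| ≤ |x - y| := by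
  have hx2 : x ^ 2 ≤ 1 / 4 := by rw [← sq_abs]; nlinarith [abs_nonneg x]
  have hy2 : y ^ 2 ≤ 1 / 4 := by rw [← sq_abs]; nlinarith [abs_nonneg y]
  have h1 := Real.sq_sqrt (show 0 ≤ 1 - x ^ 2 by linarith)
  have h2 := Real.sq_sqrt (show 0 ≤ 1 - y ^ 2 by linarith)
  have h3 : 1 / 2 ≤ √(1 - x ^ 2) := Real.le_sqrt_of_sq_le (by linarith)
  have h4 : 1 / 2 ≤ √(1 - y ^ 2) := Real.le_sqrt_of_sq_le (by linarith)
  set c := √(1 - x ^ 2)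
  set d := √(1 - y ^ 2)
  have h5 : (c - d) * (c + d) = (y - x) * (x + y) := by nlinarith
  have h6 : |c - d| * |c + d| = |x - y| * |x + y| := by
    rw [← abs_mul, h5, abs_mul, abs_sub_comm]
  have h7 : |x + y| ≤ 1 := (abs_add_le _ _).trans (by linarith)
  have h8 : 1 ≤ |c + d| := by rw [abs_of_nonneg (by linarith)]; linarith
  nlinarith [abs_nonneg (c - d), abs_nonneg (x - y)]

section Estimates

variable {N m : ℕ} {s t : ℕ → ℝ} {r : ℝ}

/-- Each factor `diag(1, X) · Rot(s)` multiplies the sum of the coefficient norms by at most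
`1 + |s| ≤ exp |s|`. -/
lemma qspPair_norm_le (s : ℕ → ℝ) (k : ℕ) :
    coeffNorm N (qspPair s k).1 + coeffNorm N (qspPair s k).2 ≤
      Real.exp (∑ j ∈ Finset.range k, |s j|) := by
  induction k with
  | zero =>
    simp only [qspPair, coeffNorm_zero, add_zero, Finset.range_zero, Finset.sum_empty,
      Real.exp_zero]
    exact coeffNorm_one_le
  | succ k ih =>
    set a := (qspPair s k).1
    set b := (qspPair s k).2
    have ha := coeffNorm_nonneg (N := N) a
    have hb := coeffNorm_nonneg (N := N) b
    have hc := abs_sqrt_one_sub_sq_le_one (s k)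
    have h1 : coeffNorm N (qspPair s (k + 1)).1 ≤ |√(1 - s k ^ 2)| * coeffNorm N a +
        |s k| * coeffNorm N b := by
      rw [← coeffNorm_C_mul, ← coeffNorm_C_mul]
      exact coeffNorm_sub_le _ _
    have h2 : coeffNorm N (qspPair s (k + 1)).2 ≤ |s k| * coeffNorm N a +
        |√(1 - s k ^ 2)| * coeffNorm N b := by
      rw [← coeffNorm_C_mul, ← coeffNorm_C_mul]
      exact (coeffNorm_X_mul_le _).trans (coeffNorm_add_le _ _)
    rw [Finset.sum_range_succ, Real.exp_add, mul_comm]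
    have h3 := Real.add_one_le_exp |s k|
    calc _ ≤ (|s k| + 1) * (coeffNorm N a + coeffNorm N b) := by
          nlinarith [abs_nonneg (s k)]
      _ ≤ _ := mul_le_mul h3 ih (by positivity) (by positivity)

/-- The difference of two signal processing products is bounded by the distance of the sines. -/
lemma qspPair_sub_norm_le (hr : Real.exp r ≤ 2) (hr2 : r ≤ 1 / 2)
    (hs : ∑ j ∈ Finset.range m, |s j| ≤ r) (ht : ∑ j ∈ Finset.range m, |t j| ≤ r)
    {k : ℕ} (hk : k ≤ m) :
    coeffNorm N ((qspPair s k).1 - (qspPair t k).1) +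
        coeffNorm N ((qspPair s k).2 - (qspPair t k).2) ≤
      Real.exp (∑ j ∈ Finset.range k, |s j|) * (4 * ∑ j ∈ Finset.range k, |s j - t j|) := by
  induction k with
  | zero => simp [qspPair, coeffNorm_zero]
  | succ k ih =>
    specialize ih (by omega)
    have hmono : ∀ u : ℕ → ℝ, ∑ j ∈ Finset.range m, |u j| ≤ r →
        |u k| ≤ r ∧ ∑ j ∈ Finset.range k, |u j| ≤ r := fun u hu =>
      ⟨(Finset.single_le_sum (f := fun j => |u j|) (fun _ _ => abs_nonneg _)
        (Finset.mem_range.2 (by omega))).trans hu,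
      (Finset.sum_le_sum_of_subset_of_nonneg (Finset.range_mono (by omega))
        fun _ _ _ => abs_nonneg _).trans hu⟩
    obtain ⟨hsk, -⟩ := hmono s hs
    obtain ⟨htk, htr⟩ := hmono t ht
    have hN := (qspPair_norm_le (N := N) t k).trans ((Real.exp_le_exp.2 htr).trans hr)
    have hcd := abs_sqrt_one_sub_sq_sub_le (hsk.trans hr2) (htk.trans hr2)
    have hc := abs_sqrt_one_sub_sq_le_one (s k)
    simp only [qspPair]
    set a := (qspPair s k).1
    set b := (qspPair s k).2
    set a' := (qspPair t k).1
    set b' := (qspPair t k).2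
    set c := √(1 - s k ^ 2)
    set c' := √(1 - t k ^ 2)
    have e1 : C c * a - C (s k) * b - (C c' * a' - C (t k) * b') =
        (C c * (a - a') + C (c - c') * a') - (C (s k) * (b - b') + C (s k - t k) * b') := by
      simp only [C_sub]; ring
    have e2 : X * (C (s k) * a + C c * b) - X * (C (t k) * a' + C c' * b') =
        X * ((C (s k) * (a - a') + C (s k - t k) * a') + (C c * (b - b') + C (c - c') * b')) := by
      simp only [C_sub]; ring
    have h1 : coeffNorm N (C c * a - C (s k) * b - (C c' * a' - C (t k) * b')) ≤
        (|c| * coeffNorm N (a - a') + |c - c'| * coeffNorm N a') +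
          (|s k| * coeffNorm N (b - b') + |s k - t k| * coeffNorm N b') := by
      rw [e1]
      simp only [← coeffNorm_C_mul]
      exact (coeffNorm_sub_le _ _).trans (add_le_add (coeffNorm_add_le _ _) (coeffNorm_add_le _ _))
    have h2 : coeffNorm N (X * (C (s k) * a + C c * b) - X * (C (t k) * a' + C c' * b')) ≤
        (|s k| * coeffNorm N (a - a') + |s k - t k| * coeffNorm N a') +
          (|c| * coeffNorm N (b - b') + |c - c'| * coeffNorm N b') := by
      rw [e2]
      simp only [← coeffNorm_C_mul]
      exact (coeffNorm_X_mul_le _).trans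
        ((coeffNorm_add_le _ _).trans (add_le_add (coeffNorm_add_le _ _) (coeffNorm_add_le _ _)))
    have p1 := coeffNorm_nonneg (N := N) (a - a')
    have p2 := coeffNorm_nonneg (N := N) (b - b')
    have p3 := coeffNorm_nonneg (N := N) a'
    have p4 := coeffNorm_nonneg (N := N) b'
    have p5 := abs_nonneg (s k - t k)
    have p6 := abs_nonneg (s k)
    have p7 : 0 ≤ ∑ j ∈ Finset.range k, |s j - t j| := Finset.sum_nonneg fun _ _ => abs_nonneg _
    have h3 : (|s k| + 1) * (coeffNorm N (a - a') + coeffNorm N (b - b')) ≤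
        Real.exp |s k| * (Real.exp (∑ j ∈ Finset.range k, |s j|) *
          (4 * ∑ j ∈ Finset.range k, |s j - t j|)) :=
      mul_le_mul (Real.add_one_le_exp _) ih (by positivity) (by positivity)
    have h4 : |s k - t k| * (coeffNorm N a' + coeffNorm N b') ≤ |s k - t k| * 2 :=
      mul_le_mul_of_nonneg_left hN p5
    have h5 : |c - c'| * (coeffNorm N a' + coeffNorm N b') ≤ |s k - t k| * 2 :=
      (mul_le_mul_of_nonneg_right hcd (by positivity)).trans h4
    have h6 : |c| * (coeffNorm N (a - a') + coeffNorm N (b - b')) ≤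
        coeffNorm N (a - a') + coeffNorm N (b - b') :=
      mul_le_of_le_one_left (by positivity) hc
    have h7 : 4 * |s k - t k| ≤ Real.exp (∑ j ∈ Finset.range (k + 1), |s j|) * (4 * |s k - t k|) :=
      le_mul_of_one_le_left (by positivity)
        (Real.one_le_exp (Finset.sum_nonneg fun _ _ => abs_nonneg _))
    have h8 : Real.exp (∑ j ∈ Finset.range (k + 1), |s j|) =
        Real.exp |s k| * Real.exp (∑ j ∈ Finset.range k, |s j|) := by
      rw [Finset.sum_range_succ, Real.exp_add, mul_comm]
    rw [h8] at h7
    calc _ ≤ (|s k| + 1) * (coeffNorm N (a - a') + coeffNorm N (b - b')) + 4 * |s k - t k| := by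
          linarith
      _ ≤ _ := by
          rw [Finset.sum_range_succ (fun j => |s j - t j|), h8]
          linarith

/-- The part of `(qspPair s k).2` that is linear in the sines. -/
noncomputable def qspLinear (s : ℕ → ℝ) : ℕ → ℝ[X]
  | 0 => 0
  | k + 1 => X * (qspLinear s k + C (s k))

lemma qspPair_snd_le (s : ℕ → ℝ) (hr : Real.exp r ≤ 2) {k : ℕ}
    (hs : ∑ j ∈ Finset.range k, |s j| ≤ r) :
    coeffNorm N (qspPair s k).2 ≤ 2 * ∑ j ∈ Finset.range k, |s j| := by
  induction k with
  | zero => simp [qspPair, coeffNorm_zero]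
  | succ k ih =>
    have hsum := Finset.sum_range_succ (fun j => |s j|) k
    have hk : ∑ j ∈ Finset.range k, |s j| ≤ r := by linarith [abs_nonneg (s k)]
    specialize ih hk
    have hN := (qspPair_norm_le (N := N) s k).trans ((Real.exp_le_exp.2 hk).trans hr)
    have h0 := coeffNorm_nonneg (N := N) (qspPair s k).2
    have h2 : coeffNorm N (qspPair s (k + 1)).2 ≤ |s k| * coeffNorm N (qspPair s k).1 +
        |√(1 - s k ^ 2)| * coeffNorm N (qspPair s k).2 := by
      rw [← coeffNorm_C_mul, ← coeffNorm_C_mul]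
      exact (coeffNorm_X_mul_le _).trans (coeffNorm_add_le _ _)
    have hc := abs_sqrt_one_sub_sq_le_one (s k)
    rw [hsum]
    nlinarith [abs_nonneg (s k)]

lemma qspPair_fst_sub_one_le (s : ℕ → ℝ) (hr : Real.exp r ≤ 2) (hr2 : r ≤ 1 / 2) {k : ℕ}
    (hs : ∑ j ∈ Finset.range k, |s j| ≤ r) :
    coeffNorm N ((qspPair s k).1 - 1) ≤ 3 * ∑ j ∈ Finset.range k, |s j| := by
  induction k with
  | zero => simp [qspPair, coeffNorm_zero]
  | succ k ih =>
    have hsum := Finset.sum_range_succ (fun j => |s j|) k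
    have h00 : 0 ≤ ∑ j ∈ Finset.range k, |s j| := Finset.sum_nonneg fun _ _ => abs_nonneg _
    have hk : ∑ j ∈ Finset.range k, |s j| ≤ r := by linarith [abs_nonneg (s k)]
    have hsk : |s k| ≤ 1 := by linarith
    specialize ih hk
    have hN := (qspPair_norm_le (N := N) s k).trans ((Real.exp_le_exp.2 hk).trans hr)
    have hc := abs_sqrt_one_sub_sq_sub_one_le hsk
    have e : (qspPair s (k + 1)).1 - 1 = (C (√(1 - s k ^ 2) - 1) * (qspPair s k).1 +
        ((qspPair s k).1 - 1)) - C (s k) * (qspPair s k).2 := by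
      simp only [qspPair, C_sub, C_1]; ring
    have h2 : coeffNorm N ((qspPair s (k + 1)).1 - 1) ≤
        (|√(1 - s k ^ 2) - 1| * coeffNorm N (qspPair s k).1 + coeffNorm N ((qspPair s k).1 - 1)) +
          |s k| * coeffNorm N (qspPair s k).2 := by
      rw [e, ← coeffNorm_C_mul, ← coeffNorm_C_mul]
      exact (coeffNorm_sub_le _ _).trans (add_le_add_left (coeffNorm_add_le _ _) _)
    rw [hsum]
    nlinarith [abs_nonneg (s k), coeffNorm_nonneg (N := N) (qspPair s k).1]

/-- The nonlinear part of `s ↦ (qspPair s k).2` has a small Lipschitz constant on small balls,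
as it has no terms of degree less than three. -/
lemma qspPair_sub_linear_le (hr : Real.exp r ≤ 2) (hr2 : r ≤ 1 / 2)
    (hs : ∑ j ∈ Finset.range m, |s j| ≤ r) (ht : ∑ j ∈ Finset.range m, |t j| ≤ r)
    {k : ℕ} (hk : k ≤ m) :
    coeffNorm N (((qspPair s k).2 - qspLinear s k) - ((qspPair t k).2 - qspLinear t k)) ≤
      8 * (∑ j ∈ Finset.range m, |s j - t j|) * (∑ j ∈ Finset.range k, |s j|) +
        5 * r * ∑ j ∈ Finset.range k, |s j - t j| := by
  induction k with
  | zero => simp [qspPair, qspLinear, coeffNorm_zero]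
  | succ k ih =>
    specialize ih (by omega)
    have hmono : ∀ u : ℕ → ℝ, ∑ j ∈ Finset.range m, |u j| ≤ r →
        |u k| ≤ r ∧ ∑ j ∈ Finset.range k, |u j| ≤ r := fun u hu =>
      ⟨(Finset.single_le_sum (f := fun j => |u j|) (fun _ _ => abs_nonneg _)
        (Finset.mem_range.2 (by omega))).trans hu,
      (Finset.sum_le_sum_of_subset_of_nonneg (Finset.range_mono (by omega))
        fun _ _ _ => abs_nonneg _).trans hu⟩
    obtain ⟨hsk, hsr⟩ := hmono s hs
    obtain ⟨htk, htr⟩ := hmono t ht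
    have hcd := abs_sqrt_one_sub_sq_sub_le (hsk.trans hr2) (htk.trans hr2)
    have hc1 := abs_sqrt_one_sub_sq_sub_one_le (x := s k) (by linarith)
    have hD : ∑ j ∈ Finset.range k, |s j - t j| ≤ ∑ j ∈ Finset.range m, |s j - t j| :=
      Finset.sum_le_sum_of_subset_of_nonneg (Finset.range_mono (by omega))
        fun _ _ _ => abs_nonneg _
    have hD0 : 0 ≤ ∑ j ∈ Finset.range k, |s j - t j| := Finset.sum_nonneg fun _ _ => abs_nonneg _
    have hdiff : coeffNorm N ((qspPair s k).1 - (qspPair t k).1) +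
        coeffNorm N ((qspPair s k).2 - (qspPair t k).2) ≤
          2 * (4 * ∑ j ∈ Finset.range m, |s j - t j|) :=
      (qspPair_sub_norm_le hr hr2 hs ht (by omega : k ≤ m)).trans
        (mul_le_mul ((Real.exp_le_exp.2 hsr).trans hr) (by linarith) (by positivity) (by norm_num))
    have hb := qspPair_snd_le (N := N) t hr htr
    have ha := qspPair_fst_sub_one_le (N := N) t hr hr2 htr
    simp only [qspPair, qspLinear]
    set a := (qspPair s k).1
    set b := (qspPair s k).2
    set a' := (qspPair t k).1
    set b' := (qspPair t k).2
    set c := √(1 - s k ^ 2)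
    set c' := √(1 - t k ^ 2)
    set l := qspLinear s k
    set l' := qspLinear t k
    have e : X * (C (s k) * a + C c * b) - X * (l + C (s k)) -
        (X * (C (t k) * a' + C c' * b') - X * (l' + C (t k))) =
        X * (((b - l) - (b' - l')) + ((C (c - 1) * (b - b') + C (c - c') * b') +
          (C (s k) * (a - a') + C (s k - t k) * (a' - 1)))) := by
      simp only [C_sub, C_1]; ring
    have h1 : coeffNorm N (X * (((b - l) - (b' - l')) + ((C (c - 1) * (b - b') + C (c - c') * b') +
          (C (s k) * (a - a') + C (s k - t k) * (a' - 1))))) ≤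
        coeffNorm N ((b - l) - (b' - l')) + ((|c - 1| * coeffNorm N (b - b') +
          |c - c'| * coeffNorm N b') + (|s k| * coeffNorm N (a - a') +
            |s k - t k| * coeffNorm N (a' - 1))) := by
      simp only [← coeffNorm_C_mul]
      refine (coeffNorm_X_mul_le _).trans ((coeffNorm_add_le _ _).trans
        (add_le_add_right ((coeffNorm_add_le _ _).trans (add_le_add ?_ ?_)) _))
      exacts [coeffNorm_add_le _ _, coeffNorm_add_le _ _]
    rw [e, Finset.sum_range_succ (fun j => |s j|), Finset.sum_range_succ (fun j => |s j - t j|)]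
    refine h1.trans ?_
    have p1 := coeffNorm_nonneg (N := N) (a - a')
    have p2 := coeffNorm_nonneg (N := N) (b - b')
    have p3 := coeffNorm_nonneg (N := N) (a' - 1)
    have p4 := coeffNorm_nonneg (N := N) b'
    have q1 : |c - 1| * coeffNorm N (b - b') ≤ |s k| * coeffNorm N (b - b') :=
      mul_le_mul_of_nonneg_right hc1 p2
    have q2 : |c - c'| * coeffNorm N b' ≤ |s k - t k| * (2 * r) :=
      mul_le_mul hcd (by linarith) p4 (abs_nonneg _)
    have q3 : |s k - t k| * coeffNorm N (a' - 1) ≤ |s k - t k| * (3 * r) :=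
      mul_le_mul_of_nonneg_left (by linarith) (abs_nonneg _)
    have q4 := mul_le_mul_of_nonneg_left hdiff (abs_nonneg (s k))
    linarith

lemma qspLinear_eq (s : ℕ → ℝ) (k : ℕ) :
    qspLinear s k = ∑ j ∈ Finset.range k, C (s j) * X ^ (k - j) := by
  induction k with
  | zero => simp [qspLinear]
  | succ k ih =>
    rw [qspLinear, ih, Finset.sum_range_succ, mul_add, Finset.mul_sum]
    congr 1
    · refine Finset.sum_congr rfl fun j hj => ?_
      rw [Nat.succ_sub (Finset.mem_range.1 hj).le, pow_succ]
      ring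
    · rw [Nat.add_sub_cancel_left, pow_one, mul_comm]

end Estimates

/-- Extension by zero of a finite sequence. -/
def extendZero {m : ℕ} (s : Fin m → ℝ) (k : ℕ) : ℝ := if h : k < m then s ⟨k, h⟩ else 0

lemma sum_extendZero {m : ℕ} (s : Fin m → ℝ) :
    ∑ j ∈ Finset.range m, |extendZero s j| = ∑ i, |s i| := by
  rw [Finset.sum_range]
  simp [extendZero]

lemma sum_extendZero_sub {m : ℕ} (s t : Fin m → ℝ) :
    ∑ j ∈ Finset.range m, |extendZero s j - extendZero t j| = ∑ i, |s i - t i| := by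
  rw [Finset.sum_range]
  simp [extendZero]

/-- The linear part permutes the sines into coefficients: `s i` is the coefficient of degree
`m - i`, as it is followed by `m - i` factors `diag(1, X)`. -/
lemma qspLinear_coeff {m : ℕ} (s : Fin m → ℝ) (i : Fin m) :
    (qspLinear (extendZero s) m).coeff (m - i) = s i := by
  rw [qspLinear_eq, finsetSum_coeff, Finset.sum_range]
  simp only [coeff_C_mul_X_pow]
  rw [Finset.sum_eq_single i]
  · simp [extendZero]
  · intro j _ hj
    rw [if_neg]
    have := Fin.val_ne_of_ne hj
    omega
  · simp

/-- A small real polynomial without constant term occurs as the off-diagonal entry of a quantum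
signal processing product: the map from sines to coefficients is close to the identity in the
`ℓ¹` norm, so the quantitative inverse function theorem applies. -/
theorem exists_qspPair_eq {m : ℕ} (p : ℝ[X]) (hp : p.natDegree < m)
    (hn : coeffNorm m p ≤ 1 / 96) :
    ∃ s : ℕ → ℝ, (∀ k, |s k| ≤ 1) ∧ (qspPair s m).2 = X * p := by
  -- On the ball of radius `1 / 48` the nonlinear part has the Lipschitz constant `13 / 48 ≤ 1 / 2`,
  -- so the image of that ball contains the ball of radius `(1 - 1 / 2) / 48 = 1 / 96`.
  let E := PiLp 1 (fun _ : Fin m => ℝ)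
  let F : E → E := fun x => WithLp.toLp 1 fun i => (qspPair (extendZero x.ofLp) m).2.coeff (m - i)
  have hexp : Real.exp (1 / 48) ≤ 2 := by
    have h := Real.exp_bound_div_one_sub_of_interval (x := 1 / 48) (by norm_num) (by norm_num)
    refine h.trans (by norm_num)
  have hF : ApproximatesLinearOn F (ContinuousLinearEquiv.refl ℝ E : E →L[ℝ] E)
      (Metric.closedBall 0 (1 / 48)) (1 / 2) := by
    intro x hx y hy
    rw [mem_closedBall_zero_iff, PiLp.norm_eq_of_L1] at hx hy
    simp only [Real.norm_eq_abs] at hx hy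
    have hx' := hx
    rw [← sum_extendZero] at hx hy
    have key := qspPair_sub_linear_le (N := m + 1) hexp (by norm_num) hx hy le_rfl
    rw [PiLp.norm_eq_of_L1, PiLp.norm_eq_of_L1]
    simp only [Real.norm_eq_abs]
    set Q := ((qspPair (extendZero x.ofLp) m).2 - qspLinear (extendZero x.ofLp) m) -
      ((qspPair (extendZero y.ofLp) m).2 - qspLinear (extendZero y.ofLp) m) with hQ
    have h1 : ∑ i, |(F x - F y - (ContinuousLinearEquiv.refl ℝ E : E →L[ℝ] E) (x - y)).ofLp i| =
        ∑ i : Fin m, |Q.coeff (m - i)| := by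
      refine Finset.sum_congr rfl fun i _ => ?_
      congr 1
      simp only [hQ, coeff_sub, qspLinear_coeff]
      change (qspPair (extendZero x.ofLp) m).2.coeff (m - i) -
        (qspPair (extendZero y.ofLp) m).2.coeff (m - i) - (x.ofLp i - y.ofLp i) = _
      ring
    have h2 : ∑ i : Fin m, |Q.coeff (m - i)| ≤ coeffNorm (m + 1) Q := by
      rw [← Finset.sum_range (fun i => |Q.coeff (m - i)|), coeffNorm, Finset.sum_range_succ',
        ← Finset.sum_range_reflect (fun i => |Q.coeff (i + 1)|)]
      refine (Finset.sum_le_sum fun i hi => le_of_eq ?_).trans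
        (le_add_of_nonneg_right (abs_nonneg _))
      rw [show m - 1 - i + 1 = m - i by have := Finset.mem_range.1 hi; omega]
    rw [h1]
    refine h2.trans (key.trans ?_)
    rw [sum_extendZero_sub]
    have h3 : ∑ i, |x.ofLp i - y.ofLp i| = ∑ i, |(x - y).ofLp i| := rfl
    rw [← h3]
    have h4 : 0 ≤ ∑ i, |x.ofLp i - y.ofLp i| := Finset.sum_nonneg fun _ _ => abs_nonneg _
    have h5 := mul_le_mul_of_nonneg_left hx h4
    push_cast
    linarith
  have hsurj := hF.surjOn_closedBall_of_nonlinearRightInverse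
    (ContinuousLinearEquiv.toNonlinearRightInverse (ContinuousLinearEquiv.refl ℝ E))
    (ε := 1 / 48) (b := 0) (by norm_num) le_rfl
  have hF0 : F 0 = 0 := by
    have : ∀ k, (qspPair (fun _ => 0) k).2 = 0 := by
      intro k
      induction k with
      | zero => rfl
      | succ k ih => simp [qspPair, ih]
    have h0 : extendZero (0 : E).ofLp = fun _ => 0 := by
      funext k
      unfold extendZero
      split_ifs <;> rfl
    ext i
    change (qspPair (extendZero (0 : E).ofLp) m).2.coeff (m - i) = 0
    rw [h0, this, coeff_zero]
  let y : E := WithLp.toLp 1 fun i => p.coeff (m - 1 - i)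
  have hy : y ∈ Metric.closedBall (F 0) (1 / 96) := by
    rw [hF0, mem_closedBall_zero_iff, PiLp.norm_eq_of_L1]
    refine le_trans (le_of_eq ?_) hn
    rw [coeffNorm, ← Finset.sum_range_reflect, Finset.sum_range]
    rfl
  have hinv : (1 / 96 : ℝ) ≤ ((((ContinuousLinearEquiv.toNonlinearRightInverse
      (ContinuousLinearEquiv.refl ℝ E)).nnnorm : ℝ))⁻¹ - ((1 / 2 : NNReal) : ℝ)) * (1 / 48) := by
    have h1 : ((ContinuousLinearEquiv.toNonlinearRightInverse
      (ContinuousLinearEquiv.refl ℝ E)).nnnorm : ℝ) = 1 := by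
      have : Nonempty (Fin m) := ⟨⟨0, by omega⟩⟩
      have : Nontrivial E := (WithLp.equiv 1 (Fin m → ℝ)).nontrivial
      exact ContinuousLinearMap.norm_id
    rw [h1]
    norm_num
  obtain ⟨x, hx, hxy⟩ := hsurj (Metric.closedBall_subset_closedBall hinv hy)
  rw [mem_closedBall_zero_iff, PiLp.norm_eq_of_L1] at hx
  refine ⟨extendZero x.ofLp, fun k => ?_, ?_⟩
  · unfold extendZero
    split_ifs with h
    · have := (Finset.single_le_sum (f := fun i => |x.ofLp i|) (fun _ _ => abs_nonneg _)
        (Finset.mem_univ ⟨k, h⟩)).trans hx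
      exact this.trans (by norm_num)
    · simp
  · ext i
    rcases i with _ | i
    · simp [qspPair_coeff_zero]
    · rw [coeff_X_mul]
      by_cases hi : i < m
      · have h1 := congrArg (fun z : E => z.ofLp ⟨m - 1 - i, by omega⟩) hxy
        simp only [F, y] at h1
        rwa [show m - (m - 1 - i) = i + 1 by omega, show m - 1 - (m - 1 - i) = i by omega] at h1
      · rw [coeff_eq_zero_of_natDegree_lt, coeff_eq_zero_of_natDegree_lt (by omega)]
        exact lt_of_le_of_lt (qspPair_natDegree_le _ _).2 (by omega)

end BlockEnc

/-! ### The Taylor polynomials of the square root and their Fourier coefficients -/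

namespace BlockEnc

open Polynomial

/-- The coefficients in `√(1 - y) = 1 - ∑ k, sqrtCoeff k * y ^ (k + 1)`, by way of the generating
function of the Catalan numbers. -/
noncomputable def sqrtCoeff (k : ℕ) : ℝ := catalan k / (2 * 4 ^ k)

lemma sqrtCoeff_nonneg (k : ℕ) : 0 ≤ sqrtCoeff k := by unfold sqrtCoeff; positivity

/-- The partial sums telescope; they are the values of the Taylor polynomials of `1 - √(1 - y)` at
`y = 1`, and in particular bounded by `1`. -/
lemma sum_sqrtCoeff (n : ℕ) :
    ∑ k ∈ Finset.range n, sqrtCoeff k = 1 - n.centralBinom / 4 ^ n := by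
  induction n with
  | zero => simp
  | succ n ih =>
    rw [Finset.sum_range_succ, ih, sqrtCoeff]
    have h1 : ((n : ℝ) + 1) * (n + 1).centralBinom = 2 * (2 * n + 1) * n.centralBinom := by
      exact_mod_cast Nat.succ_mul_centralBinom_succ n
    have h2 : ((n : ℝ) + 1) * catalan n = n.centralBinom := by
      exact_mod_cast succ_mul_catalan_eq_centralBinom n
    have h3 : ((n + 1).centralBinom : ℝ) = 2 * (2 * n + 1) * catalan n := by
      have h0 : (n : ℝ) + 1 ≠ 0 := by positivity
      apply mul_left_cancel₀ h0
      rw [h1, ← h2]; ring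
    rw [h3, ← h2]
    field_simp
    ring

lemma sum_sqrtCoeff_le_one (n : ℕ) : ∑ k ∈ Finset.range n, sqrtCoeff k ≤ 1 := by
  rw [sum_sqrtCoeff]
  have : (0 : ℝ) ≤ n.centralBinom / 4 ^ n := by positivity
  linarith

lemma summable_sqrtCoeff : Summable sqrtCoeff :=
  summable_of_sum_range_le sqrtCoeff_nonneg sum_sqrtCoeff_le_one

lemma tsum_sqrtCoeff_le_one : ∑' k, sqrtCoeff k ≤ 1 :=
  Real.tsum_le_of_sum_range_le sqrtCoeff_nonneg sum_sqrtCoeff_le_one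

lemma summable_sqrtCoeff_mul_pow {y : ℝ} (h0 : 0 ≤ y) (h1 : y ≤ 1) (m : ℕ) :
    Summable fun k => sqrtCoeff k * y ^ (k + m) :=
  Summable.of_nonneg_of_le (fun k => mul_nonneg (sqrtCoeff_nonneg k) (pow_nonneg h0 _))
    (fun k => mul_le_of_le_one_right (sqrtCoeff_nonneg k) (pow_le_one₀ h0 h1)) summable_sqrtCoeff

lemma sqrt_one_sub_eq_tsum {y : ℝ} (h0 : 0 ≤ y) (h1 : y ≤ 1) :
    √(1 - y) = 1 - ∑' k, sqrtCoeff k * y ^ (k + 1) := by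
  set f : ℕ → ℝ := fun k => sqrtCoeff k * y ^ k with hf
  have hs : Summable f := summable_sqrtCoeff_mul_pow h0 h1 0
  have hsn : Summable fun k => ‖f k‖ := hs.norm
  set S := ∑' k, f k with hS
  have hS1 : ∑' k, sqrtCoeff k * y ^ (k + 1) = y * S := by
    rw [hS, ← tsum_mul_left]
    exact tsum_congr fun k => by simp only [hf]; ring
  have hle : S ≤ 1 := (hs.tsum_le_tsum (fun k => mul_le_of_le_one_right (sqrtCoeff_nonneg k)
    (pow_le_one₀ h0 h1)) summable_sqrtCoeff).trans tsum_sqrtCoeff_le_one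
  have hS0 : 0 ≤ S := tsum_nonneg fun k => mul_nonneg (sqrtCoeff_nonneg k) (pow_nonneg h0 _)
  -- The recursion of the Catalan numbers gives the quadratic equation of the square root.
  have hrec : S = 1 / 2 + y / 2 * (S * S) := by
    have hc : ∀ n, f (n + 1) =
        y / 2 * ∑ kl ∈ Finset.HasAntidiagonal.antidiagonal n, f kl.1 * f kl.2 := by
      intro n
      simp only [hf, sqrtCoeff]
      rw [catalan_succ', Nat.cast_sum, Finset.sum_div, Finset.sum_mul, Finset.mul_sum]
      refine Finset.sum_congr rfl fun kl hkl => ?_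
      rw [← Finset.HasAntidiagonal.mem_antidiagonal.1 hkl, Nat.cast_mul]
      field_simp
      ring
    rw [hS, tsum_mul_tsum_eq_tsum_sum_antidiagonal_of_summable_norm hsn hsn, hs.tsum_eq_zero_add,
      ← tsum_mul_left]
    congr 1
    · simp [hf, sqrtCoeff]
    · exact tsum_congr hc
  rw [hS1, Real.sqrt_eq_iff_mul_self_eq (by linarith) (by nlinarith)]
  linear_combination (2 * y) * hrec

/-- The Taylor polynomial of `√(1 - y)` of degree `D`. -/
noncomputable def sqrtPoly (D : ℕ) : ℝ[X] :=
  1 - ∑ k ∈ Finset.range D, C (sqrtCoeff k) * X ^ (k + 1)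

lemma sqrtPoly_eval (D : ℕ) (y : ℝ) :
    (sqrtPoly D).eval y = 1 - ∑ k ∈ Finset.range D, sqrtCoeff k * y ^ (k + 1) := by
  simp [sqrtPoly, eval_finsetSum]

lemma abs_sqrtPoly_eval_sub_le (D : ℕ) {y : ℝ} (h0 : 0 ≤ y) (h1 : y ≤ 1) :
    |(sqrtPoly D).eval y - √(1 - y)| ≤ y ^ (D + 1) := by
  have hs := summable_sqrtCoeff_mul_pow h0 h1 1
  rw [sqrtPoly_eval, sqrt_one_sub_eq_tsum h0 h1, ← hs.sum_add_tsum_nat_add D]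
  have hterm : ∀ k, 0 ≤ sqrtCoeff (k + D) * y ^ (k + D + 1) := fun k =>
    mul_nonneg (sqrtCoeff_nonneg _) (pow_nonneg h0 _)
  have hs2 : Summable fun k => sqrtCoeff (k + D) := (summable_nat_add_iff D).2 summable_sqrtCoeff
  have h2 : ∑' k, sqrtCoeff (k + D) * y ^ (k + D + 1) ≤ y ^ (D + 1) := by
    calc ∑' k, sqrtCoeff (k + D) * y ^ (k + D + 1) ≤ ∑' k, sqrtCoeff (k + D) * y ^ (D + 1) := by
          refine Summable.tsum_le_tsum (fun k => ?_) ((summable_nat_add_iff D).2 hs)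
            (hs2.mul_right _)
          exact mul_le_mul_of_nonneg_left (pow_le_pow_of_le_one h0 h1 (by omega))
            (sqrtCoeff_nonneg _)
      _ = (∑' k, sqrtCoeff (k + D)) * y ^ (D + 1) := tsum_mul_right
      _ ≤ 1 * y ^ (D + 1) := by
          refine mul_le_mul_of_nonneg_right ?_ (pow_nonneg h0 _)
          have h3 := summable_sqrtCoeff.sum_add_tsum_nat_add D
          have h4 : 0 ≤ ∑ k ∈ Finset.range D, sqrtCoeff k :=
            Finset.sum_nonneg fun _ _ => sqrtCoeff_nonneg _
          linarith [tsum_sqrtCoeff_le_one]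
      _ = _ := one_mul _
  have h5 : 0 ≤ ∑' k, sqrtCoeff (k + D) * y ^ (k + D + 1) := tsum_nonneg hterm
  rw [abs_le]
  constructor <;> linarith

/-- The polynomial `z ^ D * sqrtPoly D ((1 + z) ^ 2 / (4 * z))`, that is, the Fourier series of
`sqrtPoly D (cos² (θ / 2))` in `z = e ^ {iθ}`, made a polynomial. -/
noncomputable def sqrtFourier (D : ℕ) : ℝ[X] :=
  X ^ D - ∑ k ∈ Finset.range D, C (sqrtCoeff k * (1 / 4) ^ (k + 1)) *
    (X ^ (D - (k + 1)) * (1 + X) ^ (2 * (k + 1)))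

lemma sqrtFourier_natDegree_le (D : ℕ) : (sqrtFourier D).natDegree ≤ 2 * D := by
  refine (natDegree_sub_le _ _).trans (max_le ?_ ?_)
  · exact (natDegree_X_pow_le D).trans (by omega)
  · refine natDegree_sum_le_of_forall_le _ _ fun k hk => ?_
    have hk := Finset.mem_range.1 hk
    refine (natDegree_C_mul_le _ _).trans (natDegree_mul_le.trans ?_)
    have h1 : (1 + X : ℝ[X]).natDegree ≤ 1 :=
      (natDegree_add_le _ _).trans (by simp)
    have h2 : ((1 + X : ℝ[X]) ^ (2 * (k + 1))).natDegree ≤ 2 * (k + 1) * 1 :=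
      natDegree_pow_le_of_le _ h1
    have h3 := natDegree_X_pow_le (R := ℝ) (D - (k + 1))
    omega

lemma coeffNorm_X_pow_mul_le {N : ℕ} (k : ℕ) (p : ℝ[X]) :
    coeffNorm N (X ^ k * p) ≤ coeffNorm N p := by
  induction k with
  | zero => simp
  | succ k ih =>
    rw [pow_succ', mul_assoc]
    exact (coeffNorm_X_mul_le _).trans ih

lemma coeffNorm_one_add_X_pow_le {N : ℕ} (n : ℕ) : coeffNorm N ((1 + X) ^ n) ≤ 2 ^ n := by
  induction n with
  | zero => simpa using coeffNorm_one_le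
  | succ n ih =>
    rw [pow_succ', add_mul, one_mul, pow_succ']
    have := coeffNorm_add_le (N := N) ((1 + X) ^ n) (X * (1 + X) ^ n)
    have h2 := coeffNorm_X_mul_le (N := N) ((1 + X) ^ n)
    linarith

lemma coeffNorm_sum_le {N : ℕ} {ι : Type*} (t : Finset ι) (f : ι → ℝ[X]) :
    coeffNorm N (∑ i ∈ t, f i) ≤ ∑ i ∈ t, coeffNorm N (f i) :=
  Finset.le_sum_of_subadditive _ coeffNorm_zero.le (fun _ _ => coeffNorm_add_le _ _) _ _

/-- The Fourier coefficients are bounded in `ℓ¹` uniformly in `D`, since those of `cos²ᵏ (θ / 2)`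
are nonnegative with sum `1`. -/
lemma coeffNorm_sqrtFourier_le (N D : ℕ) : coeffNorm N (sqrtFourier D) ≤ 2 := by
  have h1 : coeffNorm N (X ^ D : ℝ[X]) ≤ 1 := by
    have := coeffNorm_X_pow_mul_le (N := N) D 1
    rw [mul_one] at this
    exact this.trans coeffNorm_one_le
  refine (coeffNorm_sub_le _ _).trans ?_
  have h2 : coeffNorm N (∑ k ∈ Finset.range D, C (sqrtCoeff k * (1 / 4) ^ (k + 1)) *
      (X ^ (D - (k + 1)) * (1 + X) ^ (2 * (k + 1)))) ≤ ∑ k ∈ Finset.range D, sqrtCoeff k := by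
    refine (coeffNorm_sum_le _ _).trans (Finset.sum_le_sum fun k _ => ?_)
    have h0 := sqrtCoeff_nonneg k
    rw [coeffNorm_C_mul, abs_of_nonneg (by positivity)]
    have h3 : coeffNorm N (X ^ (D - (k + 1)) * (1 + X : ℝ[X]) ^ (2 * (k + 1))) ≤ 4 ^ (k + 1) := by
      refine (coeffNorm_X_pow_mul_le _ _).trans ((coeffNorm_one_add_X_pow_le _).trans ?_)
      rw [pow_mul]; norm_num
    calc _ ≤ sqrtCoeff k * (1 / 4) ^ (k + 1) * 4 ^ (k + 1) :=
          mul_le_mul_of_nonneg_left h3 (by positivity)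
      _ = sqrtCoeff k := by rw [mul_assoc, ← mul_pow]; norm_num
  linarith [sum_sqrtCoeff_le_one D]

/-- `sqrtFourier D` at a unit `w` with inverse `v`, recentred by `v ^ D`, is `sqrtPoly D` at
`(2 + w + v) / 4 = v (1 + w) ^ 2 / 4`. -/
lemma pow_mul_aeval_sqrtFourier {A : Type*} [Ring A] [Algebra ℝ A] {w v : A} (hwv : w * v = 1)
    (hvw : v * w = 1) (D : ℕ) :
    v ^ D * aeval w (sqrtFourier D) = aeval ((1 / 4 : ℝ) • (2 + w + v)) (sqrtPoly D) := by
  have hc : Commute v (1 + w) :=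
    (Commute.one_right v).add_right (by rw [Commute, SemiconjBy, hwv, hvw])
  have hy : (2 + w + v : A) = v * (1 + w) ^ 2 := by
    have : v * (1 + w) ^ 2 = v + 2 * (v * w) + v * w * w := by noncomm_ring
    rw [this, hvw, mul_one, one_mul]
    abel
  have hp : ∀ k, v ^ k * w ^ k = 1 := by
    intro k
    rw [← Commute.mul_pow (by rw [Commute, SemiconjBy, hwv, hvw]), hvw, one_pow]
  simp only [sqrtFourier, sqrtPoly, map_sub, map_sum, map_mul, map_pow (aeval w),
    map_pow (aeval ((1 / 4 : ℝ) • (2 + w + v))), map_add, map_one, aeval_X, aeval_C, mul_sub, hp,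
    Finset.mul_sum]
  congr 1
  refine Finset.sum_congr rfl fun k hk => ?_
  have hk : D = (k + 1) + (D - (k + 1)) := by have := Finset.mem_range.1 hk; omega
  have hv : v ^ D = v ^ (k + 1) * v ^ (D - (k + 1)) := by rw [← pow_add, ← hk]
  rw [← map_mul, ← Algebra.smul_def, ← Algebra.smul_def, mul_smul_comm, _root_.smul_pow,
    smul_smul, hy, (hc.pow_right 2).mul_pow, ← pow_mul (1 + w), ← mul_assoc, hv,
    mul_assoc (v ^ (k + 1)), hp, mul_one]

end BlockEnc

/-! ### Operators on some of the wires -/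

namespace BlockEnc

section Embed

set_option linter.unusedSectionVars false

open Classical in
/-- The matrix that acts as `M` on the wires in the range of `e` and trivially on the others; the
function underlying `embed`. -/
noncomputable def embedFun {ι ω : Type} (e : ι ↪ ω) (M : Op ι) : Op ω :=
  Matrix.of fun x y => if ∀ r ∉ Set.range e, x r = y r then M (x ∘ e) (y ∘ e) else 0

open Classical in
lemma embedFun_apply {ι ω : Type} (e : ι ↪ ω) (M : Op ι) (x y : Reg ω) :
    embedFun e M x y = if ∀ r ∉ Set.range e, x r = y r then M (x ∘ e) (y ∘ e) else 0 := rfl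

variable {ι κ ω : Type} [Fintype ι] [DecidableEq ι] [Fintype κ] [DecidableEq κ]
  [Fintype ω] [DecidableEq ω]

lemma embedFun_one (e : ι ↪ ω) : embedFun e 1 = 1 := by
  ext x y
  rw [embedFun_apply, Matrix.one_apply, Matrix.one_apply]
  by_cases h : x = y
  · simp [h]
  · rw [if_neg h]
    split_ifs with h1 h2
    · refine absurd (funext fun r => ?_) h
      by_cases hr : r ∈ Set.range e
      · obtain ⟨i, rfl⟩ := hr
        exact congrFun h2 i
      · exact h1 r hr
    · rfl
    · rfl

lemma embedFun_mul (e : ι ↪ ω) (M N : Op ι) :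
    embedFun e (M * N) = embedFun e M * embedFun e N := by
  classical
  ext x y
  rw [Matrix.mul_apply, embedFun_apply]
  split_ifs with h
  · rw [Matrix.mul_apply]
    refine Fintype.sum_of_injective (fun u => Function.extend e u y) ?_ _ _ ?_ ?_
    · intro u v huv
      funext i
      simpa [e.injective.extend_apply] using congrFun huv (e i)
    · intro z hz
      rw [embedFun_apply e N, if_neg, mul_zero]
      intro hzy
      refine hz ⟨z ∘ e, funext fun r => ?_⟩
      by_cases hr : r ∈ Set.range e
      · obtain ⟨i, rfl⟩ := hr
        simp [e.injective.extend_apply]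
      · simp only [Function.extend_apply' _ _ _ hr, hzy r hr]
    · intro u
      have hu : Function.extend e u y ∘ e = u := funext fun i => e.injective.extend_apply _ _ _
      have hy : ∀ r ∉ Set.range e, Function.extend e u y r = y r := fun r hr =>
        Function.extend_apply' _ _ _ hr
      rw [embedFun_apply, embedFun_apply, if_pos, if_pos hy, hu]
      intro r hr
      rw [h r hr, hy r hr]
  · refine (Finset.sum_eq_zero fun z _ => ?_).symm
    by_cases h1 : ∀ r ∉ Set.range e, x r = z r
    · rw [embedFun_apply e N, if_neg, mul_zero]
      exact fun h2 => h fun r hr => (h1 r hr).trans (h2 r hr)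
    · rw [embedFun_apply, if_neg h1, zero_mul]

lemma embedFun_star (e : ι ↪ ω) (M : Op ι) : embedFun e (star M) = star (embedFun e M) := by
  ext x y
  rw [Matrix.star_apply, embedFun_apply, embedFun_apply]
  simp only [@eq_comm _ (x _) (y _), apply_ite star, star_zero, Matrix.star_apply]

/-- The tensor product with the identity on the wires outside the range of `e`. -/
noncomputable def embed (e : ι ↪ ω) : Op ι →⋆ₐ[ℂ] Op ω where
  toFun := embedFun e
  map_one' := embedFun_one e
  map_mul' := embedFun_mul e
  map_zero' := by ext x y; simp [embedFun_apply]
  map_add' M N := by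
    ext x y
    simp only [embedFun_apply, Matrix.add_apply]
    split_ifs <;> simp
  commutes' r := by
    rw [Algebra.algebraMap_eq_smul_one, Algebra.algebraMap_eq_smul_one, ← embedFun_one e]
    ext x y
    simp [embedFun_apply]
  map_star' := embedFun_star e

open Classical in
lemma embed_apply (e : ι ↪ ω) (M : Op ι) (x y : Reg ω) :
    embed e M x y = if ∀ r ∉ Set.range e, x r = y r then M (x ∘ e) (y ∘ e) else 0 := by
  rw [show embed e M = embedFun e M from rfl, embedFun_apply]
  congr

lemma embed_embed (f : κ ↪ ω) (e : ι ↪ κ) (M : Op ι) :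
    embed f (embed e M) = embed (e.trans f) M := by
  ext x y
  simp only [embed_apply]
  split_ifs with h1 h2 h3 h3 h3
  · rfl
  · refine absurd (fun r hr => ?_) h3
    by_cases h : r ∈ Set.range f
    · obtain ⟨i, rfl⟩ := h
      exact h2 i fun ⟨j, hj⟩ => hr ⟨j, by simp [hj]⟩
    · exact h1 r h
  · refine absurd (fun i hi => h3 (f i) ?_) h2
    rintro ⟨j, hj⟩
    exact hi ⟨j, f.injective hj⟩
  · rfl
  · refine absurd (fun r hr => h3 r ?_) h1
    rintro ⟨j, rfl⟩
    exact hr ⟨e j, rfl⟩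
  · rfl

open Classical in
lemma embed_mul_embed_apply {e : ι ↪ ω} {f : κ ↪ ω} (h : Disjoint (Set.range e) (Set.range f))
    (A : Op ι) (B : Op κ) (x y : Reg ω) :
    (embed e A * embed f B) x y =
      if ∀ r, r ∉ Set.range e → r ∉ Set.range f → x r = y r then
        A (x ∘ e) (y ∘ e) * B (x ∘ f) (y ∘ f) else 0 := by
  rw [Matrix.mul_apply, Finset.sum_eq_single (fun r => if r ∈ Set.range e then y r else x r)]
  · have h1 : (fun r => if r ∈ Set.range e then y r else x r) ∘ e = y ∘ e :=
      funext fun i => if_pos ⟨i, rfl⟩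
    have h2 : (fun r => if r ∈ Set.range e then y r else x r) ∘ f = x ∘ f :=
      funext fun i => if_neg fun hi => Set.disjoint_left.1 h hi ⟨i, rfl⟩
    rw [embed_apply, embed_apply, h1, h2, if_pos fun r hr => (if_neg hr).symm]
    have h3 : (∀ r ∉ Set.range f, (if r ∈ Set.range e then y r else x r) = y r) ↔
        ∀ r, r ∉ Set.range e → r ∉ Set.range f → x r = y r := by
      refine forall_congr' fun r => ?_
      by_cases hr : r ∈ Set.range e
      · simp [hr]
      · simp [hr]
    by_cases h4 : ∀ r, r ∉ Set.range e → r ∉ Set.range f → x r = y r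
    · rw [if_pos h4, if_pos (h3.2 h4)]
    · rw [if_neg h4, if_neg (mt h3.1 h4), mul_zero]
  · intro z _ hz
    rw [embed_apply, embed_apply]
    split_ifs with h1 h2
    · refine absurd (funext fun r => ?_) hz
      split_ifs with hr
      · exact h2 r (Set.disjoint_left.1 h hr)
      · exact (h1 r hr).symm
    all_goals simp
  · simp

lemma embed_commute {e : ι ↪ ω} {f : κ ↪ ω} (h : Disjoint (Set.range e) (Set.range f))
    (A : Op ι) (B : Op κ) : Commute (embed e A) (embed f B) := by
  ext x y
  rw [embed_mul_embed_apply h, embed_mul_embed_apply h.symm, mul_comm]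
  simp only [forall_comm (α := _ ∉ Set.range f)]

lemma tensor_eq (A : Op κ) (B : Op ι) :
    tensor A B = embed Function.Embedding.inl A * embed Function.Embedding.inr B := by
  classical
  ext x y
  rw [embed_mul_embed_apply]
  · rw [if_pos]
    · rfl
    · rintro (r | r) h1 h2
      · exact absurd ⟨r, rfl⟩ h1
      · exact absurd ⟨r, rfl⟩ h2
  · rw [Set.disjoint_left]
    rintro _ ⟨i, rfl⟩ ⟨j, hj⟩
    cases hj

/-- A one-qubit matrix as an operator on a register with one qubit. -/
noncomputable def oneQubit : Matrix (Fin 2) (Fin 2) ℂ →⋆ₐ[ℂ] Op (Fin 1) where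
  toFun M := M.submatrix (Equiv.funUnique (Fin 1) (Fin 2)) (Equiv.funUnique (Fin 1) (Fin 2))
  map_one' := Matrix.submatrix_one_equiv _
  map_mul' M N := (Matrix.submatrix_mul_equiv M N _ _ _).symm
  map_zero' := rfl
  map_add' _ _ := rfl
  commutes' r := by
    rw [Algebra.algebraMap_eq_smul_one, Algebra.algebraMap_eq_smul_one, Matrix.submatrix_smul]
    exact congrArg (fun M : Op (Fin 1) => r • M) (Matrix.submatrix_one_equiv _)
  map_star' _ := rfl

lemma oneQubit_apply (M : Matrix (Fin 2) (Fin 2) ℂ) (x y : Reg (Fin 1)) :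
    oneQubit M x y = M (x 0) (y 0) := rfl

/-- A one-qubit matrix acting on the wire `q`. -/
noncomputable def onWire (q : ω) : Matrix (Fin 2) (Fin 2) ℂ →⋆ₐ[ℂ] Op ω :=
  (embed ⟨fun _ : Fin 1 => q, Function.injective_of_subsingleton _⟩).comp oneQubit

lemma onWire_apply (q : ω) (M : Matrix (Fin 2) (Fin 2) ℂ) (x y : Reg ω) :
    onWire q M x y = if ∀ r, r ≠ q → x r = y r then M (x q) (y q) else 0 := by
  classical
  change embed _ (oneQubit M) x y = _
  rw [embed_apply, oneQubit_apply]
  congr 1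
  simp [eq_comm]

lemma embed_onWire (e : ι ↪ ω) (q : ι) (M : Matrix (Fin 2) (Fin 2) ℂ) :
    embed e (onWire q M) = onWire (e q) M :=
  embed_embed _ _ _

lemma onWire_commute {p q : ω} (h : p ≠ q) (M N : Matrix (Fin 2) (Fin 2) ℂ) :
    Commute (onWire p M) (onWire q N) := by
  refine embed_commute ?_ _ _
  rw [Set.disjoint_left]
  rintro _ ⟨i, rfl⟩ ⟨j, hj⟩
  exact h hj.symm

lemma onWire_commute_embed {q : ω} {e : ι ↪ ω} (h : q ∉ Set.range e)
    (M : Matrix (Fin 2) (Fin 2) ℂ) (A : Op ι) : Commute (onWire q M) (embed e A) := by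
  refine embed_commute ?_ _ _
  rw [Set.disjoint_left]
  rintro _ ⟨i, rfl⟩ hj
  exact h hj

/-- The projection onto the states in which the wires in `S` are zero. -/
noncomputable def zeroProj (S : Finset ω) : Op ω :=
  Matrix.diagonal fun x => if ∀ r ∈ S, x r = 0 then 1 else 0

lemma zeroProj_mul (S T : Finset ω) : zeroProj S * zeroProj T = zeroProj (S ∪ T) := by
  rw [zeroProj, zeroProj, zeroProj, Matrix.diagonal_mul_diagonal]
  congr 1
  funext x
  simp only [Finset.mem_union, or_imp, forall_and, ite_and, mul_ite, mul_one, mul_zero]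
  split_ifs <;> rfl

lemma zeroProj_sq (S : Finset ω) : zeroProj S * zeroProj S = zeroProj S := by
  rw [zeroProj_mul, Finset.union_self]

lemma zeroProj_star (S : Finset ω) : star (zeroProj S) = zeroProj S := by
  rw [zeroProj, Matrix.star_eq_conjTranspose, Matrix.diagonal_conjTranspose]
  congr 1
  funext x
  simp [apply_ite]

lemma zeroProj_commute (S T : Finset ω) : Commute (zeroProj S) (zeroProj T) := by
  rw [Commute, SemiconjBy, zeroProj_mul, zeroProj_mul, Finset.union_comm]

lemma embed_zeroProj (e : ι ↪ ω) (S : Finset ι) : embed e (zeroProj S) = zeroProj (S.map e) := by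
  ext x y
  simp only [embed_apply, zeroProj, Matrix.diagonal_apply, Finset.forall_mem_map]
  by_cases h : x = y
  · simp [h]
  · rw [if_neg h]
    split_ifs with h1 h2
    · refine absurd (funext fun r => ?_) h
      by_cases hr : r ∈ Set.range e
      · obtain ⟨i, rfl⟩ := hr
        exact congrFun h2 i
      · exact h1 r hr
    all_goals rfl

lemma zeroProj_singleton (q : ω) : zeroProj {q} = onWire q (Matrix.single 0 0 1) := by
  ext x y
  rw [onWire_apply, zeroProj, Matrix.diagonal_apply]
  by_cases h : x = y
  · subst h
    simp [Matrix.single_apply, eq_comm]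
  · rw [if_neg h]
    split_ifs with h1
    · rw [Matrix.single_apply, if_neg]
      rintro ⟨h2, h3⟩
      refine h (funext fun r => ?_)
      by_cases hr : r = q
      · rw [hr, ← h2, ← h3]
      · exact h1 r hr
    · rfl

lemma zeroProj_commute_embed {S : Finset ω} {e : ι ↪ ω} (h : ∀ i, e i ∉ S) (A : Op ι) :
    Commute (zeroProj S) (embed e A) := by
  have hS : zeroProj S = embed (Function.Embedding.subtype (· ∈ S)) (zeroProj Finset.univ) := by
    rw [embed_zeroProj]
    congr 1
    ext r
    simp
  rw [hS]
  refine embed_commute ?_ _ _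
  rw [Set.disjoint_left]
  rintro _ ⟨i, rfl⟩ ⟨j, hj⟩
  exact h j (by rw [hj]; exact i.2)

lemma zeroProj_commute_onWire {S : Finset ω} {q : ω} (h : q ∉ S) (M : Matrix (Fin 2) (Fin 2) ℂ) :
    Commute (zeroProj S) (onWire q M) :=
  zeroProj_commute_embed (fun _ => h) _

end Embed

section ZeroKet

variable {κ ι : Type} [Fintype κ] [DecidableEq κ] [Fintype ι] [DecidableEq ι]

lemma zeroKet_apply (x : Reg (κ ⊕ ι)) (y : Reg ι) :
    zeroKet κ ι x y = if (∀ k, x (Sum.inl k) = 0) ∧ x ∘ Sum.inr = y then 1 else 0 := by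
  rw [zeroKet, Matrix.of_apply]
  congr 1
  simp [funext_iff]

lemma zeroKet_adjoint_mul : (zeroKet κ ι)ᴴ * zeroKet κ ι = 1 := by
  ext x y
  rw [Matrix.mul_apply, Matrix.one_apply, Finset.sum_eq_single (Sum.elim (fun _ => 0) x)]
  · simp only [Matrix.conjTranspose_apply, zeroKet_apply]
    simp only [Sum.elim_inl, implies_true, true_and, Sum.elim_comp_inr]
    by_cases h : x = y <;> simp [h]
  · intro z _ hz
    rw [Matrix.conjTranspose_apply, zeroKet_apply, if_neg, star_zero, zero_mul]
    rintro ⟨h1, h2⟩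
    refine hz (funext fun r => ?_)
    rcases r with r | r
    · exact h1 r
    · exact congrFun h2 r
  · simp

lemma zeroKet_mul_adjoint : zeroKet κ ι * (zeroKet κ ι)ᴴ =
    zeroProj (Finset.univ.map Function.Embedding.inl) := by
  ext x y
  rw [Matrix.mul_apply, zeroProj, Matrix.diagonal_apply, Finset.sum_eq_single (x ∘ Sum.inr)]
  · simp only [Matrix.conjTranspose_apply, zeroKet_apply, and_true, Finset.forall_mem_map]
    by_cases h : x = y
    · subst h
      by_cases h1 : ∀ k, x (Sum.inl k) = 0
      · simp [h1]
      · simp only [Function.Embedding.inl_apply]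
        simp [h1]
    · rw [if_neg h]
      by_cases h1 : ∀ k, x (Sum.inl k) = 0
      · rw [if_pos h1, if_neg, star_zero, mul_zero]
        rintro ⟨h2, h3⟩
        refine h (funext fun r => ?_)
        rcases r with r | r
        · rw [h1, h2]
        · exact (congrFun h3 r).symm
      · rw [if_neg h1, zero_mul]
  · intro z _ hz
    rw [zeroKet_apply, if_neg, zero_mul]
    exact fun h => hz h.2.symm
  · simp

lemma embed_inr_mul_zeroKet (B : Op ι) :
    (embed Function.Embedding.inr B : Op (κ ⊕ ι)) * zeroKet κ ι = zeroKet κ ι * B := by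
  classical
  ext x y
  rw [Matrix.mul_apply, Matrix.mul_apply, Finset.sum_eq_single (Sum.elim (x ∘ Sum.inl) y),
    Finset.sum_eq_single (x ∘ Sum.inr)]
  · simp only [embed_apply, zeroKet_apply]
    rw [if_pos]
    · simp [Function.Embedding.inr, Function.comp_def]
      rfl
    · rintro (r | r) hr
      · rfl
      · exact absurd ⟨r, rfl⟩ hr
  · intro z _ hz
    rw [zeroKet_apply, if_neg, zero_mul]
    exact fun h => hz h.2.symm
  · simp
  · intro z _ hz
    rw [zeroKet_apply, embed_apply]
    split_ifs with h1 h2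
    · refine absurd (funext fun r => ?_) hz
      rcases r with r | r
      · exact (h1 _ (by rintro ⟨j, hj⟩; cases hj)).symm
      · exact congrFun h2.2 r
    all_goals simp
  · simp

end ZeroKet

end BlockEnc

/-! ### The operators of gates and circuits -/

namespace BlockEnc

section Controlled

variable {A : Type*} [Ring A] [StarRing A] {p u : A}

lemma star_controlled (hp : star p = p) (h : Commute p u) :
    star (p * u + (1 - p)) = p * star u + (1 - p) := by
  have h2 : p * star u = star u * p := by
    have := congrArg star h.eq
    rw [star_mul, star_mul, hp] at this
    exact this.symm
  rw [star_add, star_mul, star_sub, star_one, hp, h2]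

lemma controlled_mem_unitary (hp : star p = p) (hp2 : p * p = p) (h : Commute p u)
    (hu : u ∈ unitary A) : p * u + (1 - p) ∈ unitary A := by
  have h2 : p * star u = star u * p := by
    have := congrArg star h.eq
    rw [star_mul, star_mul, hp] at this
    exact this.symm
  have hpu : p * u = u * p := h
  have key : ∀ v w : A, v * w = 1 → p * v = v * p →
      (p * v + (1 - p)) * (p * w + (1 - p)) = 1 := by
    intro v w hvw hv
    calc (p * v + (1 - p)) * (p * w + (1 - p))
        = p * v * p * w + p * v - p * v * p + p * w - p * p * w + 1 - p - p + p * p := by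
          noncomm_ring
      _ = 1 := by rw [mul_assoc p v p, ← hv, ← mul_assoc, hp2, mul_assoc p v w, hvw]; noncomm_ring
  rw [Unitary.mem_iff, star_controlled hp h]
  exact ⟨key _ _ (Unitary.star_mul_self_of_mem hu) h2,
    key _ _ (Unitary.mul_star_self_of_mem hu) hpu⟩

end Controlled

/-- The Pauli matrix `X`. -/
def matX : Matrix (Fin 2) (Fin 2) ℂ := !![0, 1; 1, 0]

lemma matX_mul_self : matX * matX = 1 := by
  ext i j
  fin_cases i <;> fin_cases j <;> simp [matX]

lemma star_matX : star matX = matX := by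
  ext i j
  fin_cases i <;> fin_cases j <;> simp [matX]

lemma matX_mem_unitary : matX ∈ unitary (Matrix (Fin 2) (Fin 2) ℂ) := by
  rw [Unitary.mem_iff, star_matX]
  exact ⟨matX_mul_self, matX_mul_self⟩

namespace Gate

variable {c a n : ℕ} (V : Op (Fin a ⊕ Fin n))

/-- The inclusion of the wires on which the queried operator acts. -/
def actedEmb : Fin a ⊕ Fin n ↪ Wire c a n :=
  ⟨acted, Function.Injective.sumMap Sum.inr_injective Sum.inr_injective⟩

lemma other_notMem_range_acted (k : Fin c ⊕ Fin 1) :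
    (other k : Wire c a n) ∉ Set.range (actedEmb : Fin a ⊕ Fin n ↪ Wire c a n) := by
  rintro ⟨i, hi⟩
  rcases k with k | k <;> rcases i with i | i <;> simp [actedEmb, acted, other] at hi

lemma notMem_range_acted_iff (r : Wire c a n) :
    r ∉ Set.range (actedEmb : Fin a ⊕ Fin n ↪ Wire c a n) ↔ ∃ k, other k = r := by
  constructor
  · intro h
    rcases r with (r | r) | (r | r)
    · exact ⟨Sum.inl r, rfl⟩
    · exact absurd ⟨Sum.inl r, rfl⟩ h
    · exact ⟨Sum.inr r, rfl⟩
    · exact absurd ⟨Sum.inr r, rfl⟩ h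
  · rintro ⟨k, rfl⟩
    exact other_notMem_range_acted k

/-- The queried operator on the wires that it acts on. -/
noncomputable def oracle : Op (Wire c a n) := embed actedEmb V

lemma oracle_apply (x y : Reg (Wire c a n)) :
    oracle V x y = if x ∘ other = y ∘ other then V (x ∘ acted) (y ∘ acted) else 0 := by
  classical
  rw [oracle, embed_apply]
  have : (∀ r ∉ Set.range (actedEmb : Fin a ⊕ Fin n ↪ Wire c a n), x r = y r) ↔
      x ∘ other = y ∘ other := by
    simp only [notMem_range_acted_iff, funext_iff]
    constructor
    · intro h k
      exact h _ ⟨k, rfl⟩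
    · rintro h _ ⟨k, rfl⟩
      exact h k
  simp only [this]
  rfl

lemma toOp_single (q : Wire c a n) (u : Matrix.unitaryGroup (Fin 2) ℂ) :
    (single q u).toOp V = onWire q u.1 := by
  ext x y
  rw [onWire_apply]
  rfl

lemma toOp_cnot (S : Finset (Wire c a n)) (q : Wire c a n) (hq : q ∉ S) :
    (cnot S q hq).toOp V = zeroProj S * onWire q matX + (1 - zeroProj S) := by
  ext x y
  rw [(zeroProj_commute_onWire hq _).eq]
  simp only [Matrix.add_apply, Matrix.sub_apply, zeroProj, Matrix.mul_diagonal, Gate.toOp,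
    Matrix.of_apply, Matrix.diagonal_apply, Matrix.one_apply]
  by_cases h : ∀ r ∈ S, y r = 0
  · have hf : flip S q y = Function.update y q (y q + 1) := if_pos h
    simp only [hf]
    rw [if_pos h, mul_one, onWire_apply]
    have h3 : (x = y ∧ ∀ r ∈ S, x r = 0) ↔ x = y := ⟨fun h => h.1, fun e => ⟨e, e ▸ h⟩⟩
    have h2 : (if x = y then (if ∀ r ∈ S, x r = 0 then (1 : ℂ) else 0) else 0) =
        if x = y then 1 else 0 := by rw [← ite_and]; simp only [h3]
    rw [h2, sub_self, add_zero]
    have hX : ∀ i j : Fin 2, matX i j = if i = j + 1 then 1 else 0 := by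
      intro i j
      fin_cases i <;> fin_cases j <;> simp [matX]
    rw [hX, ← ite_and]
    congr 1
    rw [Function.eq_update_iff]
    exact propext ⟨fun h => ⟨h.2, h.1⟩, fun h => ⟨h.2, h.1⟩⟩
  · have hf : flip S q y = y := if_neg h
    simp only [hf]
    rw [if_neg h, mul_zero, zero_add]
    by_cases h1 : x = y
    · subst h1
      rw [if_pos rfl, if_pos rfl, if_neg h, sub_zero]
    · simp [h1]

lemma toOp_query_none (adj : Bool) :
    (query none adj : Gate c a n).toOp V = oracle (if adj then Vᴴ else V) := by
  ext x y
  rw [oracle_apply]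
  simp [Gate.toOp]

lemma toOp_query_some (k : Fin c ⊕ Fin 1) (adj : Bool) :
    (query (some k) adj : Gate c a n).toOp V =
      onWire (other k) (Matrix.single 1 1 1) * oracle (if adj then Vᴴ else V) +
        (1 - onWire (other k) (Matrix.single 1 1 1)) := by
  have hP : onWire (other k : Wire c a n) (Matrix.single 1 1 1) =
      Matrix.diagonal fun x => if x (other k) = 1 then 1 else 0 := by
    ext x y
    rw [onWire_apply, Matrix.diagonal_apply]
    by_cases h : x = y
    · subst h
      simp [Matrix.single_apply, eq_comm]
    · rw [if_neg h]
      split_ifs with h1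
      · rw [Matrix.single_apply, if_neg]
        rintro ⟨h2, h3⟩
        refine h (funext fun r => ?_)
        by_cases hr : r = other k
        · rw [hr, ← h2, ← h3]
        · exact h1 r hr
      · rfl
  have hc : Commute (onWire (other k : Wire c a n) (Matrix.single 1 1 1))
      (oracle (if adj then Vᴴ else V)) :=
    onWire_commute_embed (other_notMem_range_acted k) _ _
  rw [hc.eq, hP]
  have h1 : (1 : Op (Wire c a n)) = oracle 1 := (map_one (embed actedEmb)).symm
  ext x y
  rw [Matrix.add_apply, Matrix.sub_apply, Matrix.mul_diagonal, oracle_apply, h1, oracle_apply,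
    Matrix.diagonal_apply]
  simp only [Gate.toOp, Matrix.of_apply, Option.mem_def, Option.some.injEq, forall_eq']
  by_cases ho : x ∘ other = y ∘ other
  · rw [if_pos ho, if_pos ho, if_pos ho]
    by_cases hk : y (other k) = 1
    · rw [if_pos hk, if_pos hk, mul_one]
      by_cases hxy : x = y
      · subst hxy
        simp [hk]
      · rw [if_neg hxy, Matrix.one_apply, if_neg (c := x ∘ acted = y ∘ acted)]
        · simp
        · intro ha
          refine hxy (funext fun r => ?_)
          by_cases hr : r ∈ Set.range (actedEmb : Fin a ⊕ Fin n ↪ Wire c a n)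
          · obtain ⟨i, rfl⟩ := hr
            exact congrFun ha i
          · obtain ⟨j, rfl⟩ := (notMem_range_acted_iff r).1 hr
            exact congrFun ho j
    · rw [if_neg hk, if_neg hk, mul_zero, zero_add]
      by_cases hxy : x = y
      · subst hxy
        simp [hk]
      · simp [hxy]
  · rw [if_neg ho, if_neg ho, if_neg ho, if_neg (c := x = y)]
    · simp
    · rintro rfl
      exact ho rfl

lemma oracle_mem_unitary {V : Op (Fin a ⊕ Fin n)} (hV : V ∈ unitary (Op (Fin a ⊕ Fin n))) :
    (oracle V : Op (Wire c a n)) ∈ unitary (Op (Wire c a n)) :=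
  Unitary.map_mem (embed actedEmb) hV

lemma toOp_mem_unitary {V : Op (Fin a ⊕ Fin n)} (hV : V ∈ unitary (Op (Fin a ⊕ Fin n)))
    (g : Gate c a n) : g.toOp V ∈ unitary (Op (Wire c a n)) := by
  have hV' : ∀ adj : Bool, (if adj then Vᴴ else V) ∈ unitary (Op (Fin a ⊕ Fin n)) := by
    rintro (_ | _)
    · exact hV
    · exact Unitary.star_mem hV
  rcases g with ⟨q, u⟩ | ⟨S, q, hq⟩ | ⟨_ | k, adj⟩
  · rw [toOp_single]
    exact Unitary.map_mem (onWire q) u.2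
  · rw [toOp_cnot]
    exact controlled_mem_unitary (zeroProj_star S) (zeroProj_sq S) (zeroProj_commute_onWire hq _)
      (Unitary.map_mem (onWire q) matX_mem_unitary)
  · rw [toOp_query_none]
    exact oracle_mem_unitary (hV' adj)
  · rw [toOp_query_some]
    refine controlled_mem_unitary ?_ ?_ ?_ (oracle_mem_unitary (hV' adj))
    · rw [← map_star]; simp [Matrix.star_eq_conjTranspose]
    · rw [← map_mul]; simp
    · exact onWire_commute_embed (other_notMem_range_acted k) _ _

/-- The gate that implements the adjoint. -/
def adjoint : Gate c a n → Gate c a n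
  | single q u => single q (star u)
  | cnot S q hq => cnot S q hq
  | query ctrl adj => query ctrl (!adj)

lemma isQuery_adjoint (g : Gate c a n) : g.adjoint.isQuery = g.isQuery := by
  cases g <;> rfl

lemma toOp_adjoint (g : Gate c a n) : g.adjoint.toOp V = star (g.toOp V) := by
  have hV : ∀ adj : Bool, (oracle (if !adj then Vᴴ else V) : Op (Wire c a n)) =
      star (oracle (if adj then Vᴴ else V)) := by
    rintro (_ | _)
    · exact map_star (embed actedEmb) V
    · rw [oracle, oracle, ← map_star]
      simp [Matrix.star_eq_conjTranspose]
  rcases g with ⟨q, u⟩ | ⟨S, q, hq⟩ | ⟨_ | k, adj⟩ <;> simp only [adjoint]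
  · rw [toOp_single, toOp_single, ← map_star]
    rfl
  · rw [toOp_cnot, star_controlled (zeroProj_star S) (zeroProj_commute_onWire hq _), ← map_star,
      star_matX]
  · rw [toOp_query_none, toOp_query_none, hV]
  · rw [toOp_query_some, toOp_query_some, star_controlled, hV]
    · rw [← map_star]; simp [Matrix.star_eq_conjTranspose]
    · exact onWire_commute_embed (other_notMem_range_acted k) _ _

end Gate

namespace Circuit

variable {c a n : ℕ} (V : Op (Fin a ⊕ Fin n)) (P Q : Circuit c a n)

lemma toOp_append : Circuit.toOp V (P ++ Q) = Circuit.toOp V Q * Circuit.toOp V P := by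
  simp [Circuit.toOp]

lemma toOp_nil : Circuit.toOp V ([] : Circuit c a n) = 1 := rfl

lemma toOp_cons (g : Gate c a n) :
    Circuit.toOp V (g :: Q : Circuit c a n) = Circuit.toOp V Q * g.toOp V := by
  simp [Circuit.toOp]

lemma queries_append : Circuit.queries (P ++ Q) = P.queries + Q.queries :=
  List.countP_append

/-- The circuit that implements the adjoint. -/
def adjoint : Circuit c a n := (Q.map Gate.adjoint).reverse

lemma queries_adjoint : Q.adjoint.queries = Q.queries := by
  simp only [Circuit.adjoint, Circuit.queries, List.countP_reverse, List.countP_map]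
  congr 1
  funext g
  exact Gate.isQuery_adjoint g

lemma toOp_adjoint : Circuit.toOp V Q.adjoint = star (Circuit.toOp V Q) := by
  induction Q with
  | nil => simp [Circuit.adjoint, Circuit.toOp]
  | cons g Q ih =>
    have h : Circuit.adjoint (g :: Q) = Circuit.adjoint Q ++ [g.adjoint] := by
      simp [Circuit.adjoint]
    rw [h, toOp_append, ih, toOp_cons, toOp_nil, one_mul, toOp_cons, star_mul, Gate.toOp_adjoint]

lemma toOp_mem_unitary {V : Op (Fin a ⊕ Fin n)} (hV : V ∈ unitary (Op (Fin a ⊕ Fin n))) :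
    Circuit.toOp V Q ∈ unitary (Op (Wire c a n)) := by
  induction Q with
  | nil => exact one_mem _
  | cons g Q ih =>
    rw [toOp_cons]
    exact mul_mem ih (Gate.toOp_mem_unitary hV g)

end Circuit

end BlockEnc

/-! ### Walks, signal processing and amplitude amplification -/

namespace BlockEnc

section Walk

variable {A : Type*} [Ring A] [Algebra ℝ A]

/-- On the range of a projection `P`, the real part of the walk operator
`w = (1 - 2P) V† (1 - 2P') V` acts as the compression of `V† P' V`. -/
lemma walk_mul_proj {P P' V V' : A} (hP : P * P = P) (hV : V' * V = 1) :
    ((1 / 4 : ℝ) • (2 + (1 - 2 * P) * V' * (1 - 2 * P') * V +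
      V' * (1 - 2 * P') * V * (1 - 2 * P))) * P = P * (V' * P' * V) * P := by
  have h1 : (2 + (1 - 2 * P) * V' * (1 - 2 * P') * V + V' * (1 - 2 * P') * V * (1 - 2 * P)) * P =
      4 * (P * (V' * P' * V) * P) := by
    have e : V' * (1 - 2 * P') * V = 1 - 2 * (V' * P' * V) := by
      rw [mul_sub, sub_mul, mul_one, hV]
      noncomm_ring
    have e2 : (1 - 2 * P) * V' * (1 - 2 * P') * V = (1 - 2 * P) * (V' * (1 - 2 * P') * V) := by
      noncomm_ring
    rw [e2, e]
    generalize V' * P' * V = T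
    have e3 : (1 - 2 * P) * P = -P := by
      rw [sub_mul, mul_assoc, hP]; noncomm_ring
    have e4 : P * (1 - 2 * T) * P = P - 2 * (P * T * P) := by
      rw [mul_sub, sub_mul, mul_one, hP]
      noncomm_ring
    calc (2 + (1 - 2 * P) * (1 - 2 * T) + (1 - 2 * T) * (1 - 2 * P)) * P
        = 2 * P + (1 - 2 * T) * P - 2 * (P * (1 - 2 * T) * P) +
          (1 - 2 * T) * ((1 - 2 * P) * P) := by noncomm_ring
      _ = _ := by rw [e3, e4]; noncomm_ring
  rw [smul_mul_assoc, h1, show (4 : A) = algebraMap ℝ A 4 from (map_ofNat _ 4).symm,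
    ← Algebra.smul_def, smul_smul]
  norm_num

/-- If `x` agrees on the range of `P` with some `y` that preserves this range, then so do all
polynomials in them. -/
lemma aeval_mul_proj {P x y : A} (h : x * P = y * P) (hy : Commute y P) (p : Polynomial ℝ) :
    Polynomial.aeval x p * P = Polynomial.aeval y p * P := by
  have hpow : ∀ k : ℕ, x ^ k * P = y ^ k * P := by
    intro k
    induction k with
    | zero => simp
    | succ k ih =>
      rw [pow_succ, mul_assoc, h, hy.eq, ← mul_assoc, ih, mul_assoc, ← hy.eq, ← mul_assoc,
        ← pow_succ]
  induction p using Polynomial.induction_on' with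
  | add p q hp hq => rw [map_add, map_add, add_mul, add_mul, hp, hq]
  | monomial k r => rw [Polynomial.aeval_monomial, Polynomial.aeval_monomial, mul_assoc, hpow,
      mul_assoc]

/-- The polynomial `sqrtPoly D` has the value `1` at `0`, so it maps `y p`, which vanishes outside
the projection `p`, to the identity there. -/
lemma aeval_mul_proj_sqrtPoly {p y : A} (hp : p * p = p) (h : Commute y p) (D : ℕ) :
    Polynomial.aeval (y * p) (sqrtPoly D) = p * Polynomial.aeval y (sqrtPoly D) + (1 - p) := by
  have hpow : ∀ k : ℕ, (y * p) ^ (k + 1) = p * y ^ (k + 1) := by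
    intro k
    have : p ^ (k + 1) = p := IsIdempotentElem.pow_succ_eq k hp
    rw [h.mul_pow, this, (h.pow_left _).eq]
  simp only [sqrtPoly, map_sub, map_one, map_sum, map_mul, map_pow, Polynomial.aeval_X,
    Polynomial.aeval_C, mul_sub, mul_one, Finset.mul_sum, hpow]
  simp only [← mul_assoc, ← Algebra.commutes _ p]
  abel

end Walk

section Signal

variable {ω : Type} [Fintype ω] [DecidableEq ω] (q : ω)

/-- The matrix unit `|i⟩⟨j|` on the wire `q`. -/
noncomputable def matUnit (i j : Fin 2) : Op ω := onWire q (Matrix.single i j 1)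

lemma matUnit_mul (i j k l : Fin 2) :
    matUnit q i j * matUnit q k l = if j = k then matUnit q i l else 0 := by
  rw [matUnit, matUnit, ← map_mul]
  split_ifs with h
  · subst h
    rw [Matrix.single_mul_single_same, mul_one, matUnit]
  · rw [Matrix.single_mul_single_of_ne _ _ _ _ h, map_zero]

lemma onWire_eq (M : Matrix (Fin 2) (Fin 2) ℂ) :
    onWire q M = M 0 0 • matUnit q 0 0 + M 0 1 • matUnit q 0 1 + M 1 0 • matUnit q 1 0 +
      M 1 1 • matUnit q 1 1 := by
  have : M = M 0 0 • Matrix.single 0 0 1 + M 0 1 • Matrix.single 0 1 1 +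
      M 1 0 • Matrix.single 1 0 1 + M 1 1 • Matrix.single 1 1 1 := by
    ext i j
    fin_cases i <;> fin_cases j <;> simp
  conv_lhs => rw [this]
  simp only [map_add, map_smul, matUnit]

lemma matUnit_mul_mul (i j k l : Fin 2) (x : Op ω) :
    matUnit q i j * (matUnit q k l * x) = if j = k then matUnit q i l * x else 0 := by
  rw [← mul_assoc, matUnit_mul, ite_mul, zero_mul]

lemma matUnit_add : matUnit q 0 0 + matUnit q 1 1 = 1 := by
  rw [← map_one (onWire q), onWire_eq]
  simp

/-- The rotation with sine `s`. -/
noncomputable def rotation (s : ℝ) : Matrix (Fin 2) (Fin 2) ℂ :=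
  !![(√(1 - s ^ 2) : ℝ), -(s : ℂ); (s : ℂ), (√(1 - s ^ 2) : ℝ)]

lemma rotation_mem_unitary {s : ℝ} (hs : |s| ≤ 1) :
    rotation s ∈ Matrix.unitaryGroup (Fin 2) ℂ := by
  have h : √(1 - s ^ 2) * √(1 - s ^ 2) = 1 - s ^ 2 :=
    Real.mul_self_sqrt (by rw [← sq_abs]; nlinarith [abs_nonneg s])
  have h' : ((√(1 - s ^ 2) : ℝ) : ℂ) * ((√(1 - s ^ 2) : ℝ) : ℂ) = 1 - (s : ℂ) ^ 2 := by
    rw [← Complex.ofReal_mul, h]; push_cast; ring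
  rw [Matrix.mem_unitaryGroup_iff]
  ext i j
  fin_cases i <;> fin_cases j <;>
    simp [rotation, Matrix.mul_apply, Fin.sum_univ_two, h', -Complex.ofReal_pow] <;> ring

variable {q}

/-- The quantum signal processing product of a unitary `w`, with signal wire `q`. -/
noncomputable def qspOp (q : ω) (w : Op ω) (s : ℕ → ℝ) : ℕ → Op ω
  | 0 => 1
  | k + 1 => (matUnit q 0 0 + matUnit q 1 1 * w) * (onWire q (rotation (s k)) * qspOp q w s k)

/-- The first column of the signal processing product of `w` is `qspPair`, evaluated at `w`. -/
lemma qspOp_mul_matUnit {w : Op ω} (hw : ∀ M, Commute (onWire q M) w) (s : ℕ → ℝ) (k : ℕ) :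
    qspOp q w s k * matUnit q 0 0 =
      matUnit q 0 0 * Polynomial.aeval w (qspPair s k).1 +
        matUnit q 1 0 * Polynomial.aeval w (qspPair s k).2 := by
  induction k with
  | zero => simp [qspOp, qspPair]
  | succ k ih =>
    rw [qspOp, mul_assoc, mul_assoc, ih, onWire_eq]
    simp only [qspPair, rotation, map_sub, map_add, map_mul, Polynomial.aeval_C,
      Polynomial.aeval_X, ← Algebra.smul_def]
    generalize Polynomial.aeval w (qspPair s k).1 = a
    generalize Polynomial.aeval w (qspPair s k).2 = b
    have hr : ∀ (r : ℝ) (x : Op ω), (r : ℂ) • x = r • x := fun r x => rfl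
    have h1 : w * matUnit q 1 0 = matUnit q 1 0 * w := (hw _).eq.symm
    have h2 : w * matUnit q 0 0 = matUnit q 0 0 * w := (hw _).eq.symm
    simp only [Matrix.of_apply, Matrix.cons_val', Matrix.cons_val_zero, Matrix.cons_val_one,
      Matrix.cons_val_fin_one, ← Complex.ofReal_neg, hr]
    have h1' : ∀ x, w * (matUnit q 1 0 * x) = matUnit q 1 0 * (w * x) := fun x => by
      rw [← mul_assoc, h1, mul_assoc]
    have h2' : ∀ x, w * (matUnit q 0 0 * x) = matUnit q 0 0 * (w * x) := fun x => by
      rw [← mul_assoc, h2, mul_assoc]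
    simp only [add_mul, mul_add, smul_mul_assoc, mul_smul_comm, mul_assoc, mul_sub]
    simp [matUnit_mul_mul, h1', h2']
    abel

/-- Controlled powers of `w` act on the second component only. -/
lemma walkPow_mul {w : Op ω} (hw : ∀ M, Commute (onWire q M) w) (x y : Op ω) (k : ℕ) :
    (matUnit q 0 0 + matUnit q 1 1 * w) ^ k * (matUnit q 0 0 * x + matUnit q 1 0 * y) =
      matUnit q 0 0 * x + matUnit q 1 0 * (w ^ k * y) := by
  induction k generalizing y with
  | zero => simp
  | succ k ih =>
    have h1 : w * matUnit q 1 0 = matUnit q 1 0 * w := (hw _).eq.symm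
    have h2 : w * matUnit q 0 0 = matUnit q 0 0 * w := (hw _).eq.symm
    have h3 : (matUnit q 0 0 + matUnit q 1 1 * w) * (matUnit q 0 0 * x + matUnit q 1 0 * y) =
        matUnit q 0 0 * x + matUnit q 1 0 * (w * y) := by
      rw [add_mul, mul_add, mul_add, mul_assoc (matUnit q 1 1), ← mul_assoc w, h2,
        mul_assoc (matUnit q 1 1), ← mul_assoc w, h1]
      simp only [← mul_assoc, matUnit_mul]
      simp
    rw [pow_succ, mul_assoc, h3, ih, pow_succ, mul_assoc]

/-- Quantum signal processing with sines that produce the multiple `α` of `sqrtFourier`: the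
off-diagonal block of the product, made diagonal by `X` and recentred by powers of `v = w⁻¹`, is
`sqrtPoly` at the real part of `w`, rescaled to `[0, 1]`. -/
lemma matUnit_mul_signal {w v : Op ω} (hw : ∀ M, Commute (onWire q M) w)
    (hv : ∀ M, Commute (onWire q M) v) (hwv : w * v = 1) (hvw : v * w = 1) {D : ℕ} {α : ℝ}
    {s : ℕ → ℝ}
    (hs : (qspPair s (2 * D + 1)).2 = Polynomial.X * (Polynomial.C α * sqrtFourier D)) :
    matUnit q 0 0 * (onWire q matX * ((matUnit q 0 0 + matUnit q 1 1 * v) ^ (D + 1) *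
      qspOp q w s (2 * D + 1))) * matUnit q 0 0 =
      α • (matUnit q 0 0 * Polynomial.aeval ((1 / 4 : ℝ) • (2 + w + v)) (sqrtPoly D)) := by
  have h1 : onWire q matX = matUnit q 0 1 + matUnit q 1 0 := by
    rw [onWire_eq]; simp [matX]
  have h2 : v ^ (D + 1) * Polynomial.aeval w (qspPair s (2 * D + 1)).2 =
      α • Polynomial.aeval ((1 / 4 : ℝ) • (2 + w + v)) (sqrtPoly D) := by
    rw [hs, map_mul, map_mul, Polynomial.aeval_X, Polynomial.aeval_C, ← Algebra.smul_def, pow_succ,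
      mul_assoc, ← mul_assoc v, hvw, one_mul, mul_smul_comm, pow_mul_aeval_sqrtFourier hwv hvw]
  simp only [mul_assoc]
  rw [qspOp_mul_matUnit hw, walkPow_mul hv, h2, h1]
  simp only [mul_add, add_mul, mul_smul_comm]
  simp [matUnit_mul_mul]

end Signal

section Amplify

variable {κ ι : Type} [Fintype κ] [DecidableEq κ] [Fintype ι] [DecidableEq ι]

lemma norm_zeroKet_le : ‖zeroKet κ ι‖ ≤ 1 := by
  have h := Matrix.l2_opNorm_conjTranspose_mul_self (zeroKet κ ι)
  rw [zeroKet_adjoint_mul] at h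
  have h1 : ‖(1 : Op ι)‖ ≤ 1 := by
    rcases subsingleton_or_nontrivial (Op ι) with h | h
    · rw [Subsingleton.elim (1 : Op ι) 0]; simp
    · exact CStarRing.norm_one.le
  nlinarith [norm_nonneg (zeroKet κ ι)]

lemma norm_zeroKet_adjoint_le : ‖(zeroKet κ ι)ᴴ‖ ≤ 1 := by
  rw [Matrix.l2_opNorm_conjTranspose]
  exact norm_zeroKet_le

lemma norm_corner_le (W : Op (κ ⊕ ι)) : ‖corner W‖ ≤ ‖W‖ := by
  calc ‖corner W‖ ≤ ‖(zeroKet κ ι)ᴴ‖ * ‖W‖ * ‖zeroKet κ ι‖ :=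
        (Matrix.l2_opNorm_mul _ _).trans
          (mul_le_mul_of_nonneg_right (Matrix.l2_opNorm_mul _ _) (norm_nonneg _))
    _ ≤ 1 * ‖W‖ * 1 := by
        gcongr
        · exact norm_zeroKet_adjoint_le
        · exact norm_zeroKet_le
    _ = ‖W‖ := by ring

lemma corner_sub (V W : Op (κ ⊕ ι)) : corner (V - W) = corner V - corner W := by
  simp only [corner, Matrix.mul_sub, Matrix.sub_mul]

lemma norm_unitary_le_one {U : Op ι} (hU : U ∈ unitary (Op ι)) : ‖U‖ ≤ 1 := by
  have h := CStarRing.norm_star_mul_self (x := U)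
  rw [Unitary.star_mul_self_of_mem hU] at h
  have h1 : ‖(1 : Op ι)‖ ≤ 1 := by
    rcases subsingleton_or_nontrivial (Op ι) with h | h
    · rw [Subsingleton.elim (1 : Op ι) 0]; simp
    · exact CStarRing.norm_one.le
  nlinarith [norm_nonneg U]

/-- The projection onto the zero state of all the ancillae. -/
noncomputable def ancProj (κ ι : Type) [Fintype κ] [DecidableEq κ] [Fintype ι] [DecidableEq ι] :
    Op (κ ⊕ ι) := zeroProj (Finset.univ.map Function.Embedding.inl)

lemma corner_eq_of_ancProj {W : Op (κ ⊕ ι)} {B : Op ι}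
    (h : ancProj κ ι * W * ancProj κ ι = ancProj κ ι * embed Function.Embedding.inr B) :
    corner W = B := by
  have h1 : (zeroKet κ ι)ᴴ * ancProj κ ι = (zeroKet κ ι)ᴴ := by
    rw [ancProj, ← zeroKet_mul_adjoint, ← Matrix.mul_assoc, zeroKet_adjoint_mul, Matrix.one_mul]
  have h2 : ancProj κ ι * zeroKet κ ι = zeroKet κ ι := by
    rw [ancProj, ← zeroKet_mul_adjoint, Matrix.mul_assoc, zeroKet_adjoint_mul, Matrix.mul_one]
  calc corner W = (zeroKet κ ι)ᴴ * (ancProj κ ι * W * ancProj κ ι) * zeroKet κ ι := by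
        rw [corner, Matrix.mul_assoc (ancProj κ ι), ← Matrix.mul_assoc _ (ancProj κ ι), h1,
          Matrix.mul_assoc _ (W * _), Matrix.mul_assoc W, h2, Matrix.mul_assoc]
    _ = B := by
        rw [h, ← Matrix.mul_assoc, h1, Matrix.mul_assoc, embed_inr_mul_zeroKet, ← Matrix.mul_assoc,
          zeroKet_adjoint_mul, Matrix.one_mul]

/-- One round of oblivious amplitude amplification realises the cubic Chebyshev polynomial. -/
lemma corner_amplify {W : Op (κ ⊕ ι)} (hW : W ∈ unitary (Op (κ ⊕ ι))) :
    corner (-(W * (1 - 2 * ancProj κ ι) * star W * (1 - 2 * ancProj κ ι) * W)) =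
      3 • corner W - 4 • (corner W * star (corner W) * corner W) := by
  set J := zeroKet κ ι with hJ
  have hZ : ancProj κ ι = J * Jᴴ := zeroKet_mul_adjoint.symm
  have e1 : W * (1 - 2 * ancProj κ ι) * star W * (1 - 2 * ancProj κ ι) * W =
      W - 2 • (ancProj κ ι * W) - 2 • (W * ancProj κ ι) +
        4 • (W * ancProj κ ι * star W * ancProj κ ι * W) := by
    have h1 := Unitary.mul_star_self_of_mem hW
    have h2 := Unitary.star_mul_self_of_mem hW
    generalize ancProj κ ι = Z
    calc W * (1 - 2 * Z) * star W * (1 - 2 * Z) * W =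
        (W * star W) * W - 2 • ((W * star W) * Z * W) - 2 • (W * Z * (star W * W)) +
          4 • (W * Z * star W * Z * W) := by noncomm_ring
      _ = _ := by rw [h1, h2, one_mul, one_mul, mul_one]
  rw [e1, hZ]
  simp only [corner, ← hJ, Matrix.star_eq_conjTranspose, Matrix.conjTranspose_mul,
    Matrix.conjTranspose_conjTranspose]
  have hJJ : Jᴴ * J = 1 := zeroKet_adjoint_mul
  have hJJ2 : ∀ X : Matrix (Reg ι) (Reg (κ ⊕ ι)) ℂ, Jᴴ * (J * X) = X := fun X => by
    rw [← Matrix.mul_assoc, hJJ, Matrix.one_mul]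
  simp only [Matrix.mul_neg, Matrix.neg_mul, Matrix.mul_add, Matrix.add_mul, Matrix.mul_sub,
    Matrix.sub_mul, Matrix.mul_smul, Matrix.smul_mul, Matrix.mul_assoc, hJJ2, hJJ,
    Matrix.mul_one]
  abel

/-- The cubic map of amplitude amplification takes `s U` to `(3 s - 4 s ^ 3) U` for unitary `U`, and
it has the Lipschitz constant `3 + 4 * 3 = 15` on the unit ball. -/
lemma norm_amplify_sub_le {A U : Op ι} (hA : ‖A‖ ≤ 1) (hU : U ∈ unitary (Op ι)) {s η : ℝ}
    (hs : |s| ≤ 1) (h : ‖A - s • U‖ ≤ η) :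
    ‖(3 • A - 4 • (A * star A * A)) - (3 * s - 4 * s ^ 3) • U‖ ≤ 15 * η := by
  set E := A - s • U with hE
  have hUn := norm_unitary_le_one hU
  have hsU : ‖s • U‖ ≤ 1 := by
    rw [norm_smul, Real.norm_eq_abs]
    exact mul_le_one₀ hs (norm_nonneg _) hUn
  have hUUU : s ^ 3 • U = s • U * star (s • U) * (s • U) := by
    rw [star_smul, star_trivial]
    simp only [smul_mul_assoc, mul_smul_comm, smul_smul, Unitary.mul_star_self_of_mem hU, one_mul]
    congr 1
    ring
  have e : (3 • A - 4 • (A * star A * A)) - (3 * s - 4 * s ^ 3) • U =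
      (3 : ℝ) • E - (4 : ℝ) • (E * star A * A + s • U * star E * A + s • U * star (s • U) * E) := by
    have e1 : (3 * s - 4 * s ^ 3) • U = (3 : ℝ) • (s • U) - (4 : ℝ) • (s ^ 3 • U) := by
      rw [sub_smul, smul_smul, smul_smul]
    rw [e1, hUUU, hE, star_sub]
    generalize s • U = u
    have h3 : (3 : ℕ) • A = (3 : ℝ) • A := (ofNat_smul_eq_nsmul ℝ 3 A).symm
    have h4 : (4 : ℕ) • (A * star A * A) = (4 : ℝ) • (A * star A * A) :=
      (ofNat_smul_eq_nsmul ℝ 4 _).symm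
    rw [h3, h4, sub_sub_sub_comm, ← smul_sub, ← smul_sub]
    congr 2
    noncomm_ring
  have hη : ‖E‖ ≤ η := h
  have h3 : ∀ x y z : Op ι, ‖x * y * z‖ ≤ ‖x‖ * ‖y‖ * ‖z‖ := fun x y z =>
    (norm_mul_le _ _).trans (mul_le_mul_of_nonneg_right (norm_mul_le _ _) (norm_nonneg _))
  have hE0 := norm_nonneg E
  have b1 : ‖E * star A * A‖ ≤ ‖E‖ := by
    refine (h3 _ _ _).trans ?_
    rw [norm_star, mul_assoc]
    exact mul_le_of_le_one_right hE0 (mul_le_one₀ hA (norm_nonneg _) hA)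
  have b2 : ‖s • U * star E * A‖ ≤ ‖E‖ := by
    refine (h3 _ _ _).trans ?_
    rw [norm_star, mul_right_comm]
    exact mul_le_of_le_one_left hE0 (mul_le_one₀ hsU (norm_nonneg _) hA)
  have b3 : ‖s • U * star (s • U) * E‖ ≤ ‖E‖ := by
    refine (h3 _ _ _).trans ?_
    rw [norm_star]
    exact mul_le_of_le_one_left hE0 (mul_le_one₀ hsU (norm_nonneg _) hsU)
  rw [e]
  generalize E * star A * A = X1 at b1 ⊢
  generalize s • U * star E * A = X2 at b2 ⊢
  generalize s • U * star (s • U) * E = X3 at b3 ⊢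
  have n1 : ‖(3 : ℝ) • E‖ = 3 * ‖E‖ := by rw [norm_smul, Real.norm_ofNat]
  have n2 : ‖(4 : ℝ) • (X1 + X2 + X3)‖ = 4 * ‖X1 + X2 + X3‖ := by rw [norm_smul, Real.norm_ofNat]
  have n3 := norm_sub_le ((3 : ℝ) • E) ((4 : ℝ) • (X1 + X2 + X3))
  have n4 := norm_add₃_le (a := X1) (b := X2) (c := X3)
  linarith

/-- A unitary whose corner is within `ε²` of a unitary `U` moves at most `O(ε)` of the state out
of the zero space of the ancillae. -/
lemma implementsClean_of_corner {W : Op (κ ⊕ ι)} (hW : W ∈ unitary (Op (κ ⊕ ι))) {U : Op ι}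
    (hU : U ∈ unitary (Op ι)) {ε : ℝ} (hε : 0 ≤ ε) (h : ‖corner W - U‖ ≤ ε ^ 2) :
    ImplementsClean (2 * ε) W U := by
  set J := zeroKet κ ι with hJ
  have hJJ : Jᴴ * J = 1 := zeroKet_adjoint_mul
  have hUs : Uᴴ * U = 1 := Unitary.star_mul_self_of_mem hU
  have hWs : Wᴴ * W = 1 := Unitary.star_mul_self_of_mem hW
  have hc : Jᴴ * (W * J) = corner W := by rw [corner, ← hJ, Matrix.mul_assoc]
  have hc' : Jᴴ * (Wᴴ * J) = (corner W)ᴴ := by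
    rw [← hc, Matrix.conjTranspose_mul, Matrix.conjTranspose_mul,
      Matrix.conjTranspose_conjTranspose, Matrix.mul_assoc]
  have hJJ' : ∀ X : Op ι, Jᴴ * (J * X) = X := fun X => by
    rw [← Matrix.mul_assoc, hJJ, Matrix.one_mul]
  -- `(WJ - JU)†(WJ - JU) = 2 - A†U - U†A = (U - A)†U + U†(U - A)` for the corner `A`.
  have e : (W * J - J * U)ᴴ * (W * J - J * U) = (U - corner W)ᴴ * U + Uᴴ * (U - corner W) := by
    have t1 : Jᴴ * Wᴴ * (W * J) = 1 := by
      rw [Matrix.mul_assoc, ← Matrix.mul_assoc Wᴴ, hWs, Matrix.one_mul, hJJ]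
    have t2 : Jᴴ * Wᴴ * (J * U) = (corner W)ᴴ * U := by
      rw [← hc', Matrix.mul_assoc, Matrix.mul_assoc, Matrix.mul_assoc]
    have t3 : Uᴴ * Jᴴ * (W * J) = Uᴴ * corner W := by
      rw [Matrix.mul_assoc, hc]
    have t4 : Uᴴ * Jᴴ * (J * U) = 1 := by
      rw [Matrix.mul_assoc, hJJ', hUs]
    rw [Matrix.conjTranspose_sub, Matrix.conjTranspose_mul, Matrix.conjTranspose_mul,
      Matrix.sub_mul, Matrix.mul_sub, Matrix.mul_sub, t1, t2, t3, t4, Matrix.conjTranspose_sub,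
      Matrix.sub_mul, Matrix.mul_sub, hUs]
    abel
  have hn := Matrix.l2_opNorm_conjTranspose_mul_self (W * J - J * U)
  have hUn := norm_unitary_le_one hU
  have h' : ‖U - corner W‖ ≤ ε ^ 2 := by rwa [norm_sub_rev]
  have b : ‖(W * J - J * U)ᴴ * (W * J - J * U)‖ ≤ 2 * ε ^ 2 := by
    rw [e]
    have n1 : ‖(U - corner W)ᴴ * U‖ ≤ ε ^ 2 := by
      refine (Matrix.l2_opNorm_mul _ _).trans ?_
      rw [Matrix.l2_opNorm_conjTranspose]
      exact (mul_le_of_le_one_right (norm_nonneg _) hUn).trans h'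
    have n2 : ‖Uᴴ * (U - corner W)‖ ≤ ε ^ 2 := by
      refine (Matrix.l2_opNorm_mul _ _).trans ?_
      rw [Matrix.l2_opNorm_conjTranspose]
      exact (mul_le_of_le_one_left (norm_nonneg _) hUn).trans h'
    linarith [norm_add_le ((U - corner W)ᴴ * U) (Uᴴ * (U - corner W))]
  rw [hn] at b
  refine abs_le_of_sq_le_sq' (a := ‖W * J - J * U‖) ?_ (by positivity) |>.2
  nlinarith [sq_nonneg ε]

end Amplify

end BlockEnc

/-! ### The Hermitian dilation -/

namespace BlockEnc

/-- The Pauli matrix `Z`. -/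
def matZ : Matrix (Fin 2) (Fin 2) ℂ := !![1, 0; 0, -1]

lemma matZ_mul_self : matZ * matZ = 1 := by
  ext i j
  fin_cases i <;> fin_cases j <;> simp [matZ]

lemma star_matZ : star matZ = matZ := by
  ext i j
  fin_cases i <;> fin_cases j <;> simp [matZ]

lemma matZ_mem_unitary : matZ ∈ Matrix.unitaryGroup (Fin 2) ℂ := by
  rw [Matrix.mem_unitaryGroup_iff, star_matZ, matZ_mul_self]

lemma matX_mul_matZ : matX * matZ = -(matZ * matX) := by
  ext i j
  fin_cases i <;> fin_cases j <;> simp [matX, matZ]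

section Dilation

variable {ι : Type} [Fintype ι] [DecidableEq ι]

/-- The output qubit, in a register that consists of it and the system. -/
abbrev out (ι : Type) : Fin 1 ⊕ ι := Sum.inl 0

/-- `Z ⊗ F + X ⊗ G`. -/
noncomputable def pauliComb (F G : Op ι) : Op (Fin 1 ⊕ ι) :=
  onWire (out ι) matZ * embed Function.Embedding.inr F +
    onWire (out ι) matX * embed Function.Embedding.inr G

lemma tensor_add_tensor_eq (F G : Op ι) :
    tensor pauliZ F + tensor pauliX G = pauliComb F G := by
  have h : ∀ M, embed Function.Embedding.inl (oneQubit M) = onWire (out ι) M := by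
    intro M
    rw [onWire, StarAlgHom.comp_apply]
    congr 2
    ext i
    rw [Subsingleton.elim i 0]
    rfl
  rw [tensor_eq, tensor_eq, pauliComb, ← h, ← h]
  rfl

lemma out_commute (M : Matrix (Fin 2) (Fin 2) ℂ) (F : Op ι) :
    Commute (onWire (out ι) M) (embed Function.Embedding.inr F) :=
  onWire_commute_embed (by rintro ⟨i, hi⟩; cases hi) _ _

lemma pauliComb_sub (F G F' G' : Op ι) :
    pauliComb F G - pauliComb F' G' = pauliComb (F - F') (G - G') := by
  simp only [pauliComb, map_sub, mul_sub]
  abel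

lemma pauliComb_smul (r : ℝ) (F G : Op ι) : r • pauliComb F G = pauliComb (r • F) (r • G) := by
  have h : ∀ (e : Op ι →⋆ₐ[ℂ] Op (Fin 1 ⊕ ι)) (x : Op ι), e (r • x) = r • e x := fun e x =>
    map_smul e (r : ℂ) x
  simp only [pauliComb, h, smul_add, mul_smul_comm]

lemma star_pauliComb {F G : Op ι} (hF : star F = F) (hG : star G = G) :
    star (pauliComb F G) = pauliComb F G := by
  rw [pauliComb, star_add, star_mul, star_mul, ← map_star, ← map_star, ← map_star, ← map_star, hF,
    hG, star_matX, star_matZ, (out_commute _ _).eq, (out_commute _ _).eq]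

/-- The mixed terms cancel because `X` and `Z` anticommute. -/
lemma pauliComb_mul_self {F G : Op ι} (h : Commute F G) :
    pauliComb F G * pauliComb F G = embed Function.Embedding.inr (F * F + G * G) := by
  have hz : onWire (out ι) matZ * onWire (out ι) matZ = 1 := by
    rw [← map_mul, matZ_mul_self, map_one]
  have hx : onWire (out ι) matX * onWire (out ι) matX = 1 := by
    rw [← map_mul, matX_mul_self, map_one]
  have hxz : onWire (out ι) matX * onWire (out ι) matZ =
      -(onWire (out ι) matZ * onWire (out ι) matX) := by
    rw [← map_mul, matX_mul_matZ, map_neg, map_mul]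
  have c1 := out_commute matZ F
  have c2 := out_commute matZ G
  have c3 := out_commute matX F
  have c4 := out_commute matX G
  have c5 : embed Function.Embedding.inr F * embed Function.Embedding.inr G =
      (embed Function.Embedding.inr G * embed Function.Embedding.inr F : Op (Fin 1 ⊕ ι)) := by
    rw [← map_mul, h.eq, map_mul]
  rw [pauliComb, map_add, map_mul, map_mul]
  generalize onWire (out ι) matZ = z at *
  generalize onWire (out ι) matX = x at *
  generalize (embed Function.Embedding.inr F : Op (Fin 1 ⊕ ι)) = f at *
  generalize (embed Function.Embedding.inr G : Op (Fin 1 ⊕ ι)) = g at *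
  have key : ∀ a b : Op (Fin 1 ⊕ ι), ∀ u v, Commute b u → a * u * (b * v) = a * b * (u * v) := by
    intro a b u v hb
    rw [mul_assoc, ← mul_assoc u, ← hb.eq, mul_assoc b, mul_assoc]
  rw [add_mul, mul_add, mul_add, key _ _ _ _ c1, key _ _ _ _ c3, key _ _ _ _ c2, key _ _ _ _ c4,
    hz, hx, hxz, c5]
  noncomm_ring

/-- The norm of `Z ⊗ f(H) + X ⊗ g(H)` is bounded pointwise on the spectrum of `H`, as this matrix is
Hermitian with square `I ⊗ (f ^ 2 + g ^ 2)(H)`. -/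
lemma norm_pauliComb_cfc_le {H : Op ι} (hH : IsSelfAdjoint H) {f g : ℝ → ℝ} (hf : Continuous f)
    (hg : Continuous g) {B : ℝ} (hB : 0 ≤ B)
    (h : ∀ x, |x| ≤ ‖H‖ → f x ^ 2 + g x ^ 2 ≤ B ^ 2) :
    ‖pauliComb (cfc f H) (cfc g H)‖ ≤ B := by
  have hsf : star (cfc f H) = cfc f H := cfc_predicate f H
  have hsg : star (cfc g H) = cfc g H := cfc_predicate g H
  have h1 : ‖pauliComb (cfc f H) (cfc g H)‖ * ‖pauliComb (cfc f H) (cfc g H)‖ ≤ B ^ 2 := by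
    rw [← CStarRing.norm_star_mul_self, star_pauliComb hsf hsg,
      pauliComb_mul_self (cfc_commute_cfc f g H)]
    refine (NonUnitalStarAlgHom.norm_apply_le _ _).trans ?_
    rw [← cfc_mul f f H, ← cfc_mul g g H, ← cfc_add H (fun x => f x * f x) (fun x => g x * g x)]
    refine norm_cfc_le (by positivity) fun x hx => ?_
    have hx' : |x| ≤ ‖H‖ := by
      have := norm_apply_le_norm_cfc id H hx
      rwa [cfc_id ℝ H] at this
    have := h x hx'
    rw [Real.norm_eq_abs, abs_of_nonneg (add_nonneg (mul_self_nonneg _) (mul_self_nonneg _))]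
    linarith
  nlinarith [norm_nonneg (pauliComb (cfc f H) (cfc g H))]

lemma continuous_sqrt_one_sub_sq : Continuous fun x : ℝ => √(1 - x ^ 2) := by fun_prop

lemma hermitianDilation_eq {H : Op ι} (hH : IsSelfAdjoint H) :
    hermitianDilation H = pauliComb (cfc (id : ℝ → ℝ) H) (cfc (fun x : ℝ => √(1 - x ^ 2)) H) := by
  rw [hermitianDilation, tensor_add_tensor_eq, cfc_id ℝ H]
  congr 1
  have h1 : 1 - H ^ 2 = cfc (fun x : ℝ => 1 - x ^ 2) H := by
    rw [cfc_sub (fun _ => (1 : ℝ)) (fun x => x ^ 2) H, cfc_pow_id H 2, cfc_const_one ℝ H]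
  rw [h1, ← cfc_comp' Real.sqrt (fun x => 1 - x ^ 2) H]

lemma hermitianDilation_mem_unitary {H : Op ι} (hH : IsSelfAdjoint H) (hn : ‖H‖ ≤ 1) :
    hermitianDilation H ∈ unitary (Op (Fin 1 ⊕ ι)) := by
  rw [hermitianDilation_eq hH]
  set g : ℝ → ℝ := fun x => √(1 - x ^ 2)
  have hg : Continuous g := continuous_sqrt_one_sub_sq
  have hsf : star (cfc (id : ℝ → ℝ) H) = cfc (id : ℝ → ℝ) H := cfc_predicate (id : ℝ → ℝ) H
  have hsg : star (cfc g H) = cfc g H := cfc_predicate g H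
  have h1 : cfc (id : ℝ → ℝ) H * cfc (id : ℝ → ℝ) H + cfc g H * cfc g H = 1 := by
    rw [← cfc_mul (id : ℝ → ℝ) id H, ← cfc_mul g g H,
      ← cfc_add H (fun x : ℝ => id x * id x) (fun x => g x * g x), ← cfc_const_one ℝ H]
    refine cfc_congr fun x hx => ?_
    have hx' : |x| ≤ ‖H‖ := by
      have := norm_apply_le_norm_cfc id H hx
      rwa [cfc_id ℝ H] at this
    have hx1 : x ^ 2 ≤ 1 := by
      rw [← sq_abs]
      exact pow_le_one₀ (abs_nonneg x) (hx'.trans hn)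
    simp only [g, id]
    rw [Real.mul_self_sqrt (by linarith)]
    ring
  have h2 : pauliComb (cfc (id : ℝ → ℝ) H) (cfc g H) *
      pauliComb (cfc (id : ℝ → ℝ) H) (cfc g H) = 1 := by
    rw [pauliComb_mul_self (cfc_commute_cfc (id : ℝ → ℝ) g H), h1, map_one]
  rw [Unitary.mem_iff, star_pauliComb hsf hsg]
  exact ⟨h2, h2⟩

lemma corner_pauliComb (F G : Op ι) : corner (pauliComb F G) = F := by
  refine corner_eq_of_ancProj ?_
  have h1 : ancProj (Fin 1) ι = matUnit (out ι) 0 0 := by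
    rw [ancProj, matUnit, ← zeroProj_singleton]
    congr 1
  have hz : onWire (out ι) matZ = matUnit (out ι) 0 0 - matUnit (out ι) 1 1 := by
    rw [onWire_eq]; simp [matZ, sub_eq_add_neg]
  have hx : onWire (out ι) matX = matUnit (out ι) 0 1 + matUnit (out ι) 1 0 := by
    rw [onWire_eq]; simp [matX]
  have c : ∀ B : Op ι, embed Function.Embedding.inr B * matUnit (out ι) 0 0 =
      matUnit (out ι) 0 0 * (embed Function.Embedding.inr B : Op (Fin 1 ⊕ ι)) := fun B =>
    (out_commute _ B).eq.symm
  rw [h1, pauliComb, hz, hx]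
  simp only [mul_add, add_mul, mul_sub, sub_mul, mul_assoc, c]
  simp [matUnit_mul_mul]

end Dilation

end BlockEnc

/-! ### Linear combinations of unitaries by one control qubit -/

namespace BlockEnc

/-- The linear combination of `x T` and `z v` by one control qubit, where `p` is the projection onto
its state `0`, `h` is the Hadamard matrix on it, and `e`, `P` project onto the zero states of the
other ancillae. The compression of `S` is `α T` if the control is `0` and `α` if it is `1`: both
branches carry the same factor `α`, so that the sum has equal weights. -/
lemma linearCombination_corner {A : Type*} [Ring A] [Algebra ℝ A] {p h x z v S e P T F : A}
    {α : ℝ} (hp : p * p = p) (h0 : p * h * p * h * p = (1 / 2 : ℝ) • p)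
    (h1 : p * h * (1 - p) * h * p = (1 / 2 : ℝ) • p) (hP : P * P = P)
    (hS : e * S * (e * P) = α • (e * P * (p * T + (1 - p)))) (hv : P * v * P = F * P)
    (cpx : Commute p x) (cpz : Commute p z) (cpv : Commute p v) (cpT : Commute p T)
    (cpF : Commute p F) (chx : Commute h x) (chz : Commute h z) (chT : Commute h T)
    (chF : Commute h F)
    (cep : Commute e p) (ceh : Commute e h) (cex : Commute e x) (cez : Commute e z)
    (cev : Commute e v) (ceP : Commute e P) (ceT : Commute e T) (ceF : Commute e F)
    (cPp : Commute P p) (cPh : Commute P h) (cPx : Commute P x) (cPz : Commute P z)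
    (cPT : Commute P T) (cPF : Commute P F) :
    p * (e * P) * (h * ((p * x + (1 - p) * (z * v)) * (S * h))) * (p * (e * P)) =
      (α / 2) • (p * (e * P) * (x * T + z * F)) := by
  set E := e * P with hE
  set p' := 1 - p with hp'
  have cEp : Commute E p := cep.mul_left cPp
  have cEh : Commute E h := ceh.mul_left cPh
  have cEx : Commute E x := cex.mul_left cPx
  have cEz : Commute E z := cez.mul_left cPz
  have cET : Commute E T := ceT.mul_left cPT
  have cEF : Commute E F := ceF.mul_left cPF
  have cPE : P * E = E := by rw [hE, ← mul_assoc, ← ceP.eq, mul_assoc, hP]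
  have cEp' : Commute E p' := (Commute.one_right E).sub_right cEp
  have cpp' : Commute p' v := (Commute.one_left v).sub_left cpv
  have cpz' : Commute p' z := (Commute.one_left z).sub_left cpz
  have cpF' : Commute p' F := (Commute.one_left F).sub_left cpF
  have cPp' : Commute P p' := (Commute.one_right P).sub_right cPp
  have hpp' : p * p' = 0 := by rw [hp', mul_sub, mul_one, hp, sub_self]
  have hp'p : p' * p = 0 := by rw [hp', sub_mul, one_mul, hp, sub_self]
  have hp'2 : p' * p' = p' := by
    rw [hp', mul_sub, sub_mul, sub_mul, hp]; noncomm_ring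
  set L := p * x + p' * (z * v) with hL
  have ceL : Commute e L := by
    refine Commute.add_right (cep.mul_right cex) (Commute.mul_right ?_ (cez.mul_right cev))
    exact (Commute.one_right e).sub_right cep
  have s1 : L * (p * T + p') = x * p * T + z * v * p' := by
    have t1 : p * x * (p * T) = x * p * T := by
      rw [cpx.eq, mul_assoc, ← mul_assoc p, hp, mul_assoc]
    have t2 : p * x * p' = 0 := by rw [cpx.eq, mul_assoc, hpp', mul_zero]
    have t3 : p' * (z * v) * (p * T) = 0 := by
      rw [(cpz'.mul_right cpp').eq, mul_assoc, ← mul_assoc p', hp'p, zero_mul, mul_zero]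
    have t4 : p' * (z * v) * p' = z * v * p' := by
      rw [(cpz'.mul_right cpp').eq, mul_assoc, hp'2]
    rw [hL, add_mul, mul_add, mul_add, t1, t2, t3, t4]
    abel
  have s2 : P * h * (x * p * T + z * v * p') * E = (h * x * p * T + h * z * F * p') * E := by
    have t1 : P * (h * (x * p * T)) * E = h * x * p * T * E := by
      have : Commute P (h * (x * p * T)) := cPh.mul_right ((cPx.mul_right cPp).mul_right cPT)
      rw [this.eq, mul_assoc, cPE]
      simp only [mul_assoc]
    have t2 : P * (h * (z * v * p')) * E = h * z * F * p' * E := by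
      calc P * (h * (z * v * p')) * E = P * (h * z) * v * (p' * E) := by simp only [mul_assoc]
        _ = h * z * P * v * (P * E * p') := by
            rw [(cPh.mul_right cPz).eq, ← cEp'.eq, cPE]
        _ = h * z * (P * v * P) * E * p' := by simp only [mul_assoc]
        _ = h * z * F * (P * E * p') := by rw [hv]; simp only [mul_assoc]
        _ = h * z * F * p' * E := by rw [cPE, cEp'.eq]; simp only [mul_assoc]
    rw [mul_assoc P, mul_add h, mul_add P, add_mul, add_mul, t1, t2]
  have s3 : E * h * L * S * E = α • ((h * x * p * T + h * z * F * p') * E) := by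
    calc E * h * L * S * E = P * h * L * (e * S * E) := by
          have : E * h * L = P * h * L * e := by
            rw [mul_assoc (P * h), ← ceL.eq, ← mul_assoc, mul_assoc P, ← ceh.eq, ← mul_assoc P,
              ← ceP.eq]
          rw [this]; simp only [mul_assoc]
      _ = α • (P * h * (L * (p * T + p')) * E) := by
          have : Commute E (p * T + p') := (cEp.mul_right cET).add_right cEp'
          rw [hS, this.eq, mul_smul_comm]
          simp only [mul_assoc]
      _ = _ := by rw [s1, s2]
  have s4 : p * E * (h * (L * (S * h))) * (p * E) = p * (E * h * L * S * E) * h * p := by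
    rw [← cEp.eq]
    have : h * (E * p) = E * h * p := by rw [← mul_assoc, ← cEh.eq]
    calc E * p * (h * (L * (S * h))) * (E * p) = E * p * (h * (L * (S * (h * (E * p))))) := by
          simp only [mul_assoc]
      _ = _ := by rw [this, cEp.eq]; simp only [mul_assoc]
  have s5 : p * ((h * x * p * T + h * z * F * p') * E) * h * p =
      (1 / 2 : ℝ) • (p * E * (x * T + z * F)) := by
    have chp : ∀ {u : A}, Commute h u → Commute p u → Commute u (h * p) := fun a b =>
      a.symm.mul_right b.symm
    have t1 : p * (h * x * p * T * E) * h * p = p * h * p * h * p * (x * T * E) := by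
      have c : Commute (x * T * E) (h * p) :=
        ((chp chx cpx).mul_left (chp chT cpT)).mul_left (cEh.mul_right cEp)
      have c2 : x * p * T = p * (x * T) := by rw [← cpx.eq, mul_assoc]
      calc p * (h * x * p * T * E) * h * p = p * h * ((x * p * T) * E) * (h * p) := by
            simp only [mul_assoc]
        _ = p * h * p * ((x * T * E) * (h * p)) := by rw [c2]; simp only [mul_assoc]
        _ = _ := by rw [c.eq]; simp only [mul_assoc]
    have t2 : p * (h * z * F * p' * E) * h * p = p * h * p' * h * p * (z * F * E) := by
      have c : Commute (z * F * E) (h * p) :=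
        ((chp chz cpz).mul_left (chp chF cpF)).mul_left (cEh.mul_right cEp)
      have c2 : z * F * p' = p' * (z * F) := ((cpz'.mul_right cpF').eq).symm
      calc p * (h * z * F * p' * E) * h * p = p * h * ((z * F * p') * E) * (h * p) := by
            simp only [mul_assoc]
        _ = p * h * p' * ((z * F * E) * (h * p)) := by rw [c2]; simp only [mul_assoc]
        _ = _ := by rw [c.eq]; simp only [mul_assoc]
    have c3 : Commute E (x * T + z * F) := (cEx.mul_right cET).add_right (cEz.mul_right cEF)
    rw [add_mul, mul_add, add_mul, add_mul, t1, t2, h0, h1, smul_mul_assoc, smul_mul_assoc,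
      ← smul_add, ← mul_add, ← add_mul, ← c3.eq, mul_assoc p E]
  rw [s4, s3, mul_smul_comm, smul_mul_assoc, smul_mul_assoc, s5, smul_smul]
  congr 1
  ring

/-- The Hadamard matrix. -/
noncomputable def matH : Matrix (Fin 2) (Fin 2) ℂ := ((√2)⁻¹ : ℝ) • !![1, 1; 1, -1]

lemma matH_entries_mul_self : ((√2)⁻¹ : ℝ) * (√2)⁻¹ = 1 / 2 := by
  rw [← mul_inv, Real.mul_self_sqrt (by norm_num)]
  norm_num

lemma matH_mul_mul (M : Matrix (Fin 2) (Fin 2) ℂ) :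
    matH * M * matH = (1 / 2 : ℝ) • (!![1, 1; 1, -1] * M * !![1, 1; 1, -1]) := by
  rw [matH, smul_mul_assoc, smul_mul_assoc, mul_smul_comm, smul_smul, matH_entries_mul_self]

lemma matH_mul_self : matH * matH = 1 := by
  have h := matH_mul_mul 1
  rw [mul_one, mul_one] at h
  rw [h]
  ext i j
  fin_cases i <;> fin_cases j <;> simp <;> norm_num

lemma matH_matX_matH : matH * matX * matH = matZ := by
  rw [matH_mul_mul]
  ext i j
  fin_cases i <;> fin_cases j <;> simp [matX, matZ] <;> norm_num

lemma matH_mem_unitary : matH ∈ Matrix.unitaryGroup (Fin 2) ℂ := by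
  have : star matH = matH := by
    ext i j
    fin_cases i <;> fin_cases j <;> simp [matH]
  rw [Matrix.mem_unitaryGroup_iff, this, matH_mul_self]

lemma single_matH_single (i : Fin 2) :
    Matrix.single 0 0 1 * matH * Matrix.single i i 1 * matH * Matrix.single 0 0 1 =
      (1 / 2 : ℝ) • (Matrix.single 0 0 1 : Matrix (Fin 2) (Fin 2) ℂ) := by
  have : Matrix.single 0 0 1 * matH * Matrix.single i i 1 * matH * Matrix.single 0 0 1 =
    Matrix.single 0 0 1 * (matH * Matrix.single i i 1 * matH) * Matrix.single 0 0 1 := by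
    simp only [Matrix.mul_assoc]
  rw [this, matH_mul_mul, mul_smul_comm, smul_mul_assoc]
  congr 1
  ext j k
  fin_cases i <;> fin_cases j <;> fin_cases k <;>
    simp [Matrix.mul_apply, Fin.sum_univ_two, Matrix.single_apply, Matrix.vecMul, dotProduct]

namespace Circuit

variable {c a n : ℕ} (V : Op (Fin a ⊕ Fin n))

/-- The sign change of the states in which the wires in `S` are zero and `q` is one. -/
noncomputable def sign (S : Finset (Wire c a n)) (q : Wire c a n) (hq : q ∉ S) : Circuit c a n :=
  [.single q ⟨matH, matH_mem_unitary⟩, .cnot S q hq, .single q ⟨matH, matH_mem_unitary⟩]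

lemma onWire_matZ (q : Wire c a n) : onWire q matZ = 1 - 2 * matUnit q 1 1 := by
  rw [onWire_eq, ← matUnit_add q]
  simp [matZ]
  noncomm_ring

lemma toOp_sign (S : Finset (Wire c a n)) (q : Wire c a n) (hq : q ∉ S) :
    (sign S q hq).toOp V = 1 - 2 * (zeroProj S * matUnit q 1 1) := by
  have hc := (zeroProj_commute_onWire hq matH).eq
  have h1 : onWire q matH * onWire q matH = 1 := by rw [← map_mul, matH_mul_self, map_one]
  have h2 : onWire q matH * onWire q matX * onWire q matH = 1 - 2 * matUnit q 1 1 := by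
    rw [← map_mul, ← map_mul, matH_matX_matH, onWire_matZ]
  rw [sign, toOp_cons, toOp_cons, toOp_cons, toOp_nil, one_mul, Gate.toOp_single, Gate.toOp_cnot]
  calc onWire q matH * (zeroProj S * onWire q matX + (1 - zeroProj S)) * onWire q matH
      = (onWire q matH * zeroProj S) * onWire q matX * onWire q matH +
          (onWire q matH * onWire q matH) - (onWire q matH * zeroProj S) * onWire q matH := by
        noncomm_ring
    _ = zeroProj S * (onWire q matH * onWire q matX * onWire q matH) + 1 -
        zeroProj S * (onWire q matH * onWire q matH) := by
        rw [← hc, h1]; simp only [mul_assoc, h1]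
    _ = _ := by rw [h1, h2]; noncomm_ring

end Circuit

end BlockEnc

/-! ### The signal processing circuit -/

namespace BlockEnc

/-- If `P V P = F P`, then on the range of `P` the real part `(w + w†) / 2` of the walk operator is
`2 F ^ 2 p - 1`, so polynomials in `(2 + w + w†) / 4` are polynomials in `F ^ 2 p`. -/
lemma sqrtPoly_walk_mul_proj {A : Type*} [Ring A] [Algebra ℝ A] {P p F V V' : A} (hP : P * P = P)
    (hp : p * p = p) (hV : V' * V = 1) (cPp : Commute P p) (cpV : Commute p V)
    (cPF : Commute P F) (cpF : Commute p F) (hv : P * V * P = F * P) (hv' : P * V' * P = F * P)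
    (D : ℕ) :
    Polynomial.aeval ((1 / 4 : ℝ) • (2 + (1 - 2 * P) * V' * (1 - 2 * (P * p)) * V +
      V' * (1 - 2 * (P * p)) * V * (1 - 2 * P))) (sqrtPoly D) * P =
      (p * Polynomial.aeval (F ^ 2) (sqrtPoly D) + (1 - p)) * P := by
  have cF : Commute (F ^ 2) p := cpF.symm.pow_left 2
  have cFP : Commute (F ^ 2 * p) P := (cPF.symm.pow_left 2).mul_left cPp.symm
  rw [← aeval_mul_proj_sqrtPoly hp cF]
  refine aeval_mul_proj ?_ cFP _
  rw [walk_mul_proj hP hV]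
  calc P * (V' * (P * p) * V) * P = P * V' * P * (p * V) * P := by simp only [mul_assoc]
    _ = P * V' * P * P * (V * p) * P := by rw [cpV.eq, mul_assoc (P * V') P P, hP]
    _ = (P * V' * P) * (P * V * (p * P)) := by simp only [mul_assoc]
    _ = (P * V' * P) * ((P * V * P) * p) := by rw [← cPp.eq]; simp only [mul_assoc]
    _ = F * (P * F) * (P * p) := by rw [hv, hv']; simp only [mul_assoc]
    _ = F * F * (P * P) * p := by rw [cPF.eq]; simp only [mul_assoc]
    _ = _ := by rw [hP, mul_assoc, cPp.eq, pow_two, mul_assoc (F * F)]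

section Circuits

variable {a n : ℕ}

/-- The signal qubit of quantum signal processing. -/
abbrev sigWire : Wire 2 a n := Sum.inl (Sum.inl 0)

/-- The control qubit of the linear combination of unitaries. -/
abbrev lcuWire : Wire 2 a n := Sum.inl (Sum.inl 1)

/-- The output ancilla. -/
abbrev outWire : Wire 2 a n := Sum.inr (Sum.inl 0)

/-- The ancillae of the queried block encoding. -/
def encWires : Finset (Wire 2 a n) :=
  Finset.univ.map (Function.Embedding.inr.trans Function.Embedding.inl)

/-- The inclusion of the system qubits. -/
def sysEmb : Fin n ↪ Wire 2 a n := Function.Embedding.inr.trans Function.Embedding.inr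

lemma inl_inl_notMem_encWires (i : Fin 2) : (Sum.inl (Sum.inl i) : Wire 2 a n) ∉ encWires := by
  simp [encWires]

lemma outWire_notMem_encWires : (outWire : Wire 2 a n) ∉ encWires := by
  simp [encWires]

lemma sigWire_notMem_insert : (sigWire : Wire 2 a n) ∉ insert lcuWire encWires := by
  simp [encWires]

lemma sys_notMem_encWires (i : Fin n) : (sysEmb i : Wire 2 a n) ∉ encWires := by
  simp [encWires, sysEmb]

/-- The operator `M` on the system. -/
noncomputable def onSys (M : Op (Fin n)) : Op (Wire 2 a n) := embed sysEmb M

/-- The projection onto the zero state of the ancillae of the block encoding. -/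
noncomputable def encProj : Op (Wire 2 a n) := zeroProj encWires

lemma encProj_mul_oracle {V : Op (Fin a ⊕ Fin n)} {H : Op (Fin n)} (hV : corner V = H) :
    encProj * Gate.oracle V * encProj = onSys H * (encProj : Op (Wire 2 a n)) := by
  have h1 : ancProj (Fin a) (Fin n) * V * ancProj (Fin a) (Fin n) =
      embed Function.Embedding.inr H * ancProj (Fin a) (Fin n) := by
    have e : ancProj (Fin a) (Fin n) = zeroKet (Fin a) (Fin n) * (zeroKet (Fin a) (Fin n))ᴴ :=
      zeroKet_mul_adjoint.symm
    rw [e, ← Matrix.mul_assoc (embed Function.Embedding.inr H : Op (Fin a ⊕ Fin n)),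
      embed_inr_mul_zeroKet, ← hV, corner]
    simp only [Matrix.mul_assoc]
  have h2 : (embed Gate.actedEmb (ancProj (Fin a) (Fin n)) : Op (Wire 2 a n)) = encProj := by
    rw [ancProj, embed_zeroProj, Finset.map_map]
    rfl
  have h3 := congrArg (embed (Gate.actedEmb : Fin a ⊕ Fin n ↪ Wire 2 a n)) h1
  rw [map_mul, map_mul, map_mul, h2, embed_embed] at h3
  exact h3

/-- The walk operator of the block encoding `V`, with the inner reflection restricted to the state
`0` of the control qubit. -/
noncomputable def walkOp (V : Op (Fin a ⊕ Fin n)) : Op (Wire 2 a n) :=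
  (1 - 2 * encProj) * star (Gate.oracle V) * (1 - 2 * zeroProj (insert lcuWire encWires)) *
    Gate.oracle V

/-- One step of the walk, controlled by the signal qubit. It suffices to control the reflections,
since the two queries cancel without them. -/
noncomputable def walkCircuit (a n : ℕ) : Circuit 2 a n :=
  .query none false :: (Circuit.sign (insert lcuWire encWires) sigWire sigWire_notMem_insert ++
    .query none true :: Circuit.sign encWires sigWire (inl_inl_notMem_encWires 0))

lemma queries_walkCircuit : (walkCircuit a n).queries = 2 := rfl

lemma onWire_inl_commute_oracle (i : Fin 2) (M : Matrix (Fin 2) (Fin 2) ℂ)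
    (V : Op (Fin a ⊕ Fin n)) :
    Commute (onWire (Sum.inl (Sum.inl i) : Wire 2 a n) M) (Gate.oracle V) :=
  onWire_commute_embed (Gate.other_notMem_range_acted (Sum.inl i)) _ _

lemma star_oracle (V : Op (Fin a ⊕ Fin n)) :
    star (Gate.oracle V : Op (Wire 2 a n)) = Gate.oracle Vᴴ :=
  (map_star (embed Gate.actedEmb) V).symm

lemma onWire_sig_commute_walkOp (V : Op (Fin a ⊕ Fin n)) (M : Matrix (Fin 2) (Fin 2) ℂ) :
    Commute (onWire (sigWire : Wire 2 a n) M) (walkOp V) := by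
  have c1 := (zeroProj_commute_onWire (inl_inl_notMem_encWires (a := a) (n := n) 0) M).symm
  have c2 := (zeroProj_commute_onWire (sigWire_notMem_insert (a := a) (n := n)) M).symm
  have c : ∀ {Z : Op (Wire 2 a n)}, Commute (onWire sigWire M) Z →
      Commute (onWire sigWire M) (1 - 2 * Z) := fun h =>
    (Commute.one_right _).sub_right ((Commute.ofNat_right _ 2).mul_right h)
  rw [walkOp, star_oracle]
  exact (((c c1).mul_right (onWire_inl_commute_oracle 0 M _)).mul_right (c c2)).mul_right
    (onWire_inl_commute_oracle 0 M _)

lemma toOp_walkCircuit {V : Op (Fin a ⊕ Fin n)} (hV : V ∈ unitary (Op (Fin a ⊕ Fin n))) :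
    (walkCircuit a n).toOp V = matUnit sigWire 0 0 + matUnit sigWire 1 1 * walkOp V := by
  have hu := Unitary.star_mul_self_of_mem (Gate.oracle_mem_unitary (c := 2) hV)
  have c0 : Commute (matUnit (sigWire : Wire 2 a n) 1 1) (Gate.oracle V) :=
    onWire_inl_commute_oracle 0 _ V
  have c1 : Commute (matUnit (sigWire : Wire 2 a n) 1 1) (star (Gate.oracle V)) := by
    rw [star_oracle]
    exact onWire_inl_commute_oracle 0 _ _
  have c2 : Commute (matUnit (sigWire : Wire 2 a n) 1 1) encProj :=
    (zeroProj_commute_onWire (inl_inl_notMem_encWires (a := a) (n := n) 0) _).symm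
  have c3 : Commute (matUnit (sigWire : Wire 2 a n) 1 1) (zeroProj (insert lcuWire encWires)) :=
    (zeroProj_commute_onWire (sigWire_notMem_insert (a := a) (n := n)) _).symm
  have h0 : matUnit (sigWire : Wire 2 a n) 0 0 = 1 - matUnit sigWire 1 1 := by
    rw [← matUnit_add sigWire]; abel
  have hee : matUnit (sigWire : Wire 2 a n) 1 1 * matUnit sigWire 1 1 = matUnit sigWire 1 1 := by
    simp [matUnit_mul]
  have e2 : (Gate.oracle (if true then Vᴴ else V) : Op (Wire 2 a n)) = star (Gate.oracle V) :=
    (star_oracle V).symm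
  rw [walkCircuit, Circuit.toOp_cons, Circuit.toOp_append, Circuit.toOp_cons, Circuit.toOp_sign,
    Circuit.toOp_sign, Gate.toOp_query_none, Gate.toOp_query_none, e2, walkOp, h0,
    if_neg Bool.false_ne_true]
  change (1 - 2 * (encProj * _)) * _ * _ * _ = _
  generalize matUnit (sigWire : Wire 2 a n) 1 1 = e at *
  generalize star (Gate.oracle V : Op (Wire 2 a n)) = v' at *
  generalize (Gate.oracle V : Op (Wire 2 a n)) = v at *
  generalize (encProj : Op (Wire 2 a n)) = P at *
  generalize zeroProj (insert lcuWire encWires : Finset (Wire 2 a n)) = P' at *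
  calc (1 - 2 * (P * e)) * v' * (1 - 2 * (P' * e)) * v
      = v' * v - 2 • (P * (e * v') * v) - 2 • (v' * P' * (e * v)) +
          4 • (P * (e * v') * P' * (e * v)) := by noncomm_ring
    _ = v' * v - 2 • ((P * e) * (v' * v)) - 2 • (v' * (P' * e) * v) +
          4 • (P * (e * v' * P' * e) * v) := by
        simp only [mul_assoc]
    _ = 1 - 2 • (e * P) - 2 • (e * v' * P' * v) + 4 • (e * P * v' * P' * v) := by
        have t1 : v' * (P' * e) * v = e * v' * P' * v := by
          rw [← c3.eq, ← mul_assoc, ← c1.eq]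
        have t2 : P * (e * v' * P' * e) * v = e * P * v' * P' * v := by
          have c4 : Commute e (v' * P') := c1.mul_right c3
          calc P * (e * v' * P' * e) * v = P * (e * ((v' * P') * e)) * v := by
                simp only [mul_assoc]
            _ = P * (e * (v' * P')) * v := by rw [← c4.eq, ← mul_assoc e e, hee]
            _ = P * e * v' * P' * v := by simp only [mul_assoc]
            _ = _ := by rw [← c2.eq]
        rw [hu, t1, t2, mul_one, c2.eq]
    _ = 1 - e + e * (v' * v) - 2 • (e * P * (v' * v)) - 2 • (e * v' * P' * v) +
          4 • (e * P * v' * P' * v) := by rw [hu]; noncomm_ring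
    _ = 1 - e + e * ((1 - 2 * P) * v' * (1 - 2 * P') * v) := by noncomm_ring

/-- The circuit of quantum signal processing, with the sines `s`. -/
noncomputable def qspCircuit (a n : ℕ) (s : ℕ → ℝ) (hs : ∀ k, |s k| ≤ 1) : ℕ → Circuit 2 a n
  | 0 => []
  | k + 1 => qspCircuit a n s hs k ++
      .single sigWire ⟨rotation (s k), rotation_mem_unitary (hs k)⟩ :: walkCircuit a n

lemma queries_qspCircuit (s : ℕ → ℝ) (hs : ∀ k, |s k| ≤ 1) (k : ℕ) :
    (qspCircuit a n s hs k).queries = 2 * k := by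
  induction k with
  | zero => rfl
  | succ k ih =>
    rw [qspCircuit, Circuit.queries_append, ih]
    change 2 * k + (walkCircuit a n).queries = _
    rw [queries_walkCircuit]
    ring

lemma toOp_qspCircuit {V : Op (Fin a ⊕ Fin n)} (hV : V ∈ unitary (Op (Fin a ⊕ Fin n)))
    (s : ℕ → ℝ) (hs : ∀ k, |s k| ≤ 1) (k : ℕ) :
    (qspCircuit a n s hs k).toOp V = qspOp sigWire (walkOp V) s k := by
  induction k with
  | zero => rfl
  | succ k ih =>
    rw [qspCircuit, Circuit.toOp_append, Circuit.toOp_cons, ih, toOp_walkCircuit hV,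
      Gate.toOp_single, qspOp, mul_assoc]

/-- The `k`-fold repetition of a circuit. -/
def Circuit.replicate {c a n : ℕ} (Q : Circuit c a n) : ℕ → Circuit c a n
  | 0 => []
  | k + 1 => Q ++ Circuit.replicate Q k

lemma Circuit.queries_replicate {c a n : ℕ} (Q : Circuit c a n) (k : ℕ) :
    (Circuit.replicate Q k).queries = k * Q.queries := by
  induction k with
  | zero => simp [Circuit.replicate, Circuit.queries]
  | succ k ih => rw [Circuit.replicate, Circuit.queries_append, ih]; ring

lemma Circuit.toOp_replicate {c a n : ℕ} (V : Op (Fin a ⊕ Fin n)) (Q : Circuit c a n) (k : ℕ) :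
    (Circuit.replicate Q k).toOp V = Q.toOp V ^ k := by
  induction k with
  | zero => rfl
  | succ k ih => rw [Circuit.replicate, Circuit.toOp_append, ih, pow_succ]

/-- Quantum signal processing followed by a recentring by inverse walk steps. -/
noncomputable def signalCircuit (a n D : ℕ) (s : ℕ → ℝ) (hs : ∀ k, |s k| ≤ 1) : Circuit 2 a n :=
  qspCircuit a n s hs (2 * D + 1) ++ (Circuit.replicate (walkCircuit a n).adjoint (D + 1) ++
    [.single sigWire ⟨matX, matX_mem_unitary⟩])

lemma queries_signalCircuit (D : ℕ) (s : ℕ → ℝ) (hs : ∀ k, |s k| ≤ 1) :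
    (signalCircuit a n D s hs).queries = 6 * D + 4 := by
  rw [signalCircuit, Circuit.queries_append, Circuit.queries_append, queries_qspCircuit,
    Circuit.queries_replicate, Circuit.queries_adjoint, queries_walkCircuit]
  change _ + (_ + 0) = _
  ring

lemma walkOp_mem_unitary {V : Op (Fin a ⊕ Fin n)} (hV : V ∈ unitary (Op (Fin a ⊕ Fin n))) :
    walkOp V ∈ unitary (Op (Wire 2 a n)) := by
  have h : ∀ S : Finset (Wire 2 a n), 1 - 2 * zeroProj S ∈ unitary (Op (Wire 2 a n)) := by
    intro S
    have h1 : star (1 - 2 * zeroProj S : Op (Wire 2 a n)) = 1 - 2 * zeroProj S := by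
      rw [star_sub, star_one, star_mul, star_ofNat, zeroProj_star]
      noncomm_ring
    have h2 : (1 - 2 * zeroProj S : Op (Wire 2 a n)) * (1 - 2 * zeroProj S) = 1 := by
      calc _ = 1 - 4 • zeroProj S + 4 • (zeroProj S * zeroProj S) := by noncomm_ring
        _ = 1 := by rw [zeroProj_sq]; abel
    rw [Unitary.mem_iff, h1]
    exact ⟨h2, h2⟩
  have ho := Gate.oracle_mem_unitary (c := 2) hV
  exact mul_mem (mul_mem (mul_mem (h _) (Unitary.star_mem ho)) (h _)) ho

lemma onWire_sig_commute_star_walkOp (V : Op (Fin a ⊕ Fin n)) (M : Matrix (Fin 2) (Fin 2) ℂ) :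
    Commute (onWire (sigWire : Wire 2 a n) M) (star (walkOp V)) := by
  have := (onWire_sig_commute_walkOp V (star M)).star_star
  rwa [map_star, star_star] at this

lemma star_toOp_walkCircuit {V : Op (Fin a ⊕ Fin n)} (hV : V ∈ unitary (Op (Fin a ⊕ Fin n))) :
    star ((walkCircuit a n).toOp V) =
      matUnit sigWire 0 0 + matUnit sigWire 1 1 * star (walkOp V) := by
  have hst : ∀ i, star (matUnit (sigWire : Wire 2 a n) i i) = matUnit sigWire i i := by
    intro i
    rw [matUnit, ← map_star]
    simp [Matrix.star_eq_conjTranspose]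
  rw [toOp_walkCircuit hV, star_add, star_mul, hst, hst]
  congr 1
  exact (onWire_sig_commute_star_walkOp V _).eq.symm

lemma toOp_signalCircuit {V : Op (Fin a ⊕ Fin n)} (hV : V ∈ unitary (Op (Fin a ⊕ Fin n)))
    (D : ℕ) (s : ℕ → ℝ) (hs : ∀ k, |s k| ≤ 1) :
    (signalCircuit a n D s hs).toOp V = onWire sigWire matX *
      ((matUnit sigWire 0 0 + matUnit sigWire 1 1 * star (walkOp V)) ^ (D + 1) *
        qspOp sigWire (walkOp V) s (2 * D + 1)) := by
  rw [signalCircuit, Circuit.toOp_append, Circuit.toOp_append, Circuit.toOp_replicate,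
    Circuit.toOp_adjoint, toOp_qspCircuit hV, star_toOp_walkCircuit hV, Circuit.toOp_cons,
    Circuit.toOp_nil, one_mul, Gate.toOp_single, mul_assoc]

lemma insert_lcuWire : zeroProj (insert lcuWire encWires : Finset (Wire 2 a n)) =
    encProj * zeroProj {lcuWire} := by
  rw [encProj, zeroProj_mul, Finset.union_comm]
  rfl

lemma star_walkOp (V : Op (Fin a ⊕ Fin n)) :
    star (walkOp V : Op (Wire 2 a n)) = star (Gate.oracle V) *
      (1 - 2 * (encProj * zeroProj {lcuWire})) * Gate.oracle V * (1 - 2 * encProj) := by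
  have hr : ∀ S : Finset (Wire 2 a n), star (1 - 2 * zeroProj S : Op (Wire 2 a n)) =
      1 - 2 * zeroProj S := by
    intro S
    rw [star_sub, star_one, star_mul, star_ofNat, zeroProj_star]
    noncomm_ring
  rw [walkOp, star_mul, star_mul, star_mul, star_star, hr, encProj, hr, ← encProj, insert_lcuWire]
  simp only [mul_assoc]

lemma lcuProj_commute_oracle (V : Op (Fin a ⊕ Fin n)) :
    Commute (zeroProj {(lcuWire : Wire 2 a n)}) (Gate.oracle V) := by
  rw [zeroProj_singleton]
  exact onWire_inl_commute_oracle 1 _ V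

lemma encProj_commute_onSys (M : Op (Fin n)) :
    Commute (encProj : Op (Wire 2 a n)) (onSys M) :=
  zeroProj_commute_embed sys_notMem_encWires M

lemma lcuProj_commute_onSys (M : Op (Fin n)) :
    Commute (zeroProj {(lcuWire : Wire 2 a n)}) (onSys M) :=
  zeroProj_commute_embed (by simp [sysEmb]) M

lemma encProj_mul_star_oracle {V : Op (Fin a ⊕ Fin n)} {H : Op (Fin n)} (hH : IsSelfAdjoint H)
    (hV : corner V = H) :
    encProj * star (Gate.oracle V) * encProj = onSys H * (encProj : Op (Wire 2 a n)) := by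
  have h := congrArg star (encProj_mul_oracle hV)
  have hFs : star (onSys H : Op (Wire 2 a n)) = onSys H := by
    rw [onSys, ← map_star, hH.star_eq]
  have hPs : star (encProj : Op (Wire 2 a n)) = encProj := zeroProj_star _
  rw [star_mul, star_mul, star_mul, hPs, hFs, ← mul_assoc, (encProj_commute_onSys H).eq] at h
  exact h

lemma aeval_onSys (M : Op (Fin n)) (p : Polynomial ℝ) :
    Polynomial.aeval (onSys M : Op (Wire 2 a n)) p = onSys (Polynomial.aeval M p) :=
  Polynomial.aeval_algHom_apply
    ((embed (sysEmb (a := a) (n := n))).toAlgHom.restrictScalars ℝ) M p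

/-- The operator of `signalCircuit`, compressed to the zero state of the signal qubit and the
ancillae of the block encoding, applies `α * sqrtPoly D (H ^ 2)` if the control qubit is `0`
and the scalar `α` if it is `1`. -/
lemma signalCircuit_block {V : Op (Fin a ⊕ Fin n)} {H : Op (Fin n)}
    (hV : V ∈ unitary (Op (Fin a ⊕ Fin n))) (hH : IsSelfAdjoint H) (hc : corner V = H) {D : ℕ}
    {α : ℝ} {s : ℕ → ℝ} (hs : ∀ k, |s k| ≤ 1)
    (hq : (qspPair s (2 * D + 1)).2 = Polynomial.X * (Polynomial.C α * sqrtFourier D)) :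
    matUnit sigWire 0 0 * (signalCircuit a n D s hs).toOp V * (matUnit sigWire 0 0 * encProj) =
      α • (matUnit sigWire 0 0 * encProj * (zeroProj {lcuWire} *
        onSys (Polynomial.aeval (H ^ 2) (sqrtPoly D)) + (1 - zeroProj {lcuWire}))) := by
  have hwu := walkOp_mem_unitary hV
  have cPp : Commute (encProj : Op (Wire 2 a n)) (zeroProj {lcuWire}) := zeroProj_commute _ _
  have key := sqrtPoly_walk_mul_proj (P := (encProj : Op (Wire 2 a n))) (zeroProj_sq _)
    (zeroProj_sq {lcuWire})
    (Unitary.star_mul_self_of_mem (Gate.oracle_mem_unitary (c := 2) hV)) cPp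
    (lcuProj_commute_oracle V) (encProj_commute_onSys H) (lcuProj_commute_onSys H)
    (encProj_mul_oracle hc) (encProj_mul_star_oracle hH hc) D
  have hF : (onSys H : Op (Wire 2 a n)) ^ 2 = onSys (H ^ 2) := (map_pow (embed sysEmb) H 2).symm
  rw [← star_walkOp, ← insert_lcuWire, ← walkOp, hF, aeval_onSys] at key
  have c1 : Commute (encProj : Op (Wire 2 a n)) (zeroProj {lcuWire} *
      onSys (Polynomial.aeval (H ^ 2) (sqrtPoly D)) + (1 - zeroProj {lcuWire})) :=
    (cPp.mul_right (encProj_commute_onSys _)).add_right ((Commute.one_right _).sub_right cPp)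
  rw [toOp_signalCircuit hV, ← mul_assoc, matUnit_mul_signal (onWire_sig_commute_walkOp V)
    (onWire_sig_commute_star_walkOp V) (Unitary.mul_star_self_of_mem hwu)
    (Unitary.star_mul_self_of_mem hwu) hq, smul_mul_assoc, mul_assoc, key, ← c1.eq, mul_assoc]

end Circuits

end BlockEnc

/-! ### The circuits of the linear combination and the amplification -/

namespace BlockEnc

section LinearCombination

variable {a n : ℕ}

lemma outWire_notMem_lcu : (outWire : Wire 2 a n) ∉ ({lcuWire} : Finset (Wire 2 a n)) := by
  simp

/-- The linear combination, with equal weights, of `X` on the output ancilla times the circuit `S`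
and of `Z` on the output ancilla times a query. The latter two are applied in the branch `1` of the
control qubit; `Z` is applied always and undone in the branch `0`. -/
noncomputable def lcuCircuit (S : Circuit 2 a n) : Circuit 2 a n :=
  .single lcuWire ⟨matH, matH_mem_unitary⟩ :: (S ++
    (.cnot {lcuWire} outWire outWire_notMem_lcu :: .query (some (Sum.inl 1)) false ::
      (Circuit.sign {lcuWire} outWire outWire_notMem_lcu ++
        [.single outWire ⟨matZ, matZ_mem_unitary⟩, .single lcuWire ⟨matH, matH_mem_unitary⟩])))

lemma queries_lcuCircuit (S : Circuit 2 a n) : (lcuCircuit S).queries = S.queries + 1 := by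
  change Circuit.queries (S ++ _) = _
  rw [Circuit.queries_append]
  rfl

lemma controlledPauli_eq {A : Type*} [Ring A] {p x z v : A} (hp : p * p = p) (hz : z * z = 1)
    (cpz : Commute p z) (cpv : Commute p v) :
    z * (p * z + (1 - p)) * ((1 - p) * v + p) * (p * x + (1 - p)) =
      p * x + (1 - p) * (z * v) := by
  have hpq : p * (1 - p) = 0 := by rw [mul_sub, mul_one, hp, sub_self]
  have hqp : (1 - p) * p = 0 := by rw [sub_mul, one_mul, hp, sub_self]
  have hqq : (1 - p) * (1 - p) = 1 - p := by rw [mul_sub, hqp, mul_one, sub_zero]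
  have cqz : Commute (1 - p) z := (Commute.one_left z).sub_left cpz
  have cqv : Commute (1 - p) v := (Commute.one_left v).sub_left cpv
  generalize 1 - p = r at *
  have e0 : z * (p * z + r) = p + r * z := by
    rw [mul_add, ← mul_assoc, ← cpz.eq, mul_assoc, hz, mul_one, cqz.eq]
  have e1 : (p + r * z) * (r * v + p) = r * (z * v) + p := by
    rw [cqz.eq, add_mul, mul_add, mul_add, ← mul_assoc p, hpq, mul_assoc z, ← mul_assoc r, hqq,
      mul_assoc z, hqp, hp, ← mul_assoc z, ← cqz.eq]
    noncomm_ring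
  rw [e0, e1, (cqz.mul_right cqv).eq, add_mul, mul_add, mul_add, ← mul_assoc _ p, mul_assoc _ r p,
    hqp, mul_assoc _ r r, hqq, ← mul_assoc p, hp, hpq]
  noncomm_ring

lemma matUnit_lcu_one : matUnit (lcuWire : Wire 2 a n) 1 1 = 1 - zeroProj {lcuWire} := by
  rw [zeroProj_singleton, ← matUnit_add lcuWire, matUnit, matUnit]
  abel

lemma toOp_lcuCircuit (V : Op (Fin a ⊕ Fin n)) (S : Circuit 2 a n) :
    (lcuCircuit S).toOp V = onWire lcuWire matH * ((zeroProj {lcuWire} * onWire outWire matX +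
      (1 - zeroProj {lcuWire}) * (onWire outWire matZ * Gate.oracle V)) *
        (S.toOp V * onWire lcuWire matH)) := by
  have hzz : onWire (outWire : Wire 2 a n) matZ * onWire outWire matZ = 1 := by
    rw [← map_mul, matZ_mul_self, map_one]
  have hsign : (1 : Op (Wire 2 a n)) - 2 * (zeroProj {lcuWire} * matUnit outWire 1 1) =
      zeroProj {lcuWire} * onWire outWire matZ + (1 - zeroProj {lcuWire}) := by
    rw [Circuit.onWire_matZ]; noncomm_ring
  have hq : (Gate.query (some (Sum.inl 1)) false : Gate 2 a n).toOp V =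
      (1 - zeroProj {lcuWire}) * Gate.oracle V + zeroProj {lcuWire} := by
    rw [Gate.toOp_query_some, if_neg Bool.false_ne_true]
    change matUnit lcuWire 1 1 * _ + (1 - matUnit lcuWire 1 1) = _
    rw [matUnit_lcu_one, sub_sub_cancel]
  rw [← controlledPauli_eq (zeroProj_sq _) hzz (zeroProj_commute_onWire outWire_notMem_lcu _)
    (lcuProj_commute_oracle V), lcuCircuit, Circuit.toOp_cons, Circuit.toOp_append,
    Circuit.toOp_cons, Circuit.toOp_cons, Circuit.toOp_append, Circuit.toOp_cons,
    Circuit.toOp_cons, Circuit.toOp_nil, one_mul, Circuit.toOp_sign, Gate.toOp_single,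
    Gate.toOp_single, Gate.toOp_cnot, hq, hsign]
  simp only [mul_assoc]

lemma ancProj_eq : ancProj (Fin 2 ⊕ Fin a) (Fin 1 ⊕ Fin n) =
    zeroProj {lcuWire} * (matUnit sigWire 0 0 * encProj) := by
  rw [ancProj, encProj, matUnit, ← zeroProj_singleton, zeroProj_mul, zeroProj_mul]
  congr 1
  ext r
  rcases r with (r | r) | r
  · fin_cases r <;> simp [encWires]
  · simp [encWires]
  · simp [encWires]

lemma embed_inr_pauliComb (F G : Op (Fin n)) :
    (embed Function.Embedding.inr (pauliComb F G) : Op (Wire 2 a n)) =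
      onWire outWire matZ * onSys F + onWire outWire matX * onSys G := by
  rw [pauliComb, map_add, map_mul, map_mul, embed_onWire, embed_onWire, embed_embed, embed_embed]
  rfl

/-- If the circuit `S` has the block `α T` when the control qubit is `0`, and `α` when it is `1`,
then `lcuCircuit S` is a block encoding of `(α / 2) (Z ⊗ H + X ⊗ T)`. -/
lemma corner_lcuCircuit {V : Op (Fin a ⊕ Fin n)} {H T : Op (Fin n)} (hc : corner V = H)
    {S : Circuit 2 a n} {α : ℝ}
    (hS : matUnit sigWire 0 0 * S.toOp V * (matUnit sigWire 0 0 * encProj) =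
      α • (matUnit sigWire 0 0 * encProj *
        (zeroProj {lcuWire} * onSys T + (1 - zeroProj {lcuWire})))) :
    corner ((lcuCircuit S).toOp V) = (α / 2) • pauliComb H T := by
  have hone : ∀ (i : Fin 2), onWire (lcuWire : Wire 2 a n) (Matrix.single 0 0 1) *
      onWire lcuWire matH * onWire lcuWire (Matrix.single i i 1) * onWire lcuWire matH *
        onWire lcuWire (Matrix.single 0 0 1) =
          (1 / 2 : ℝ) • onWire lcuWire (Matrix.single 0 0 1) := by
    intro i
    simp only [← map_mul]
    rw [single_matH_single]
    exact map_smul (onWire lcuWire) ((1 / 2 : ℝ) : ℂ) _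
  have hp1 : onWire (lcuWire : Wire 2 a n) (Matrix.single 1 1 1) =
      1 - onWire lcuWire (Matrix.single 0 0 1) := by
    have := matUnit_add (lcuWire : Wire 2 a n)
    rw [← this, matUnit, matUnit]
    abel
  have h1 := hone 1
  rw [hp1] at h1
  have hsl : (sigWire : Wire 2 a n) ≠ lcuWire := by simp
  have hso : (sigWire : Wire 2 a n) ≠ outWire := by simp
  have hlo : (lcuWire : Wire 2 a n) ≠ outWire := by simp
  have csys : ∀ (q : Fin 2 ⊕ Fin a) M F,
      Commute (onWire (Sum.inl q : Wire 2 a n) M) (onSys F) := fun q M F =>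
    onWire_commute_embed (by rintro ⟨i, hi⟩; cases hi) _ _
  have cenc : ∀ {q : Wire 2 a n} (_ : q ∉ encWires) M, Commute encProj (onWire q M) := fun h M =>
    zeroProj_commute_onWire h M
  have key := linearCombination_corner (A := Op (Wire 2 a n)) (p := zeroProj {lcuWire})
    (h := onWire lcuWire matH) (x := onWire outWire matX) (z := onWire outWire matZ)
    (v := Gate.oracle V) (S := S.toOp V) (e := matUnit sigWire 0 0) (P := encProj) (T := onSys T)
    (F := onSys H) (α := α) (zeroProj_sq _)
    (by rw [zeroProj_singleton]; exact hone 0) (by rw [zeroProj_singleton]; exact h1)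
    (zeroProj_sq _) hS (encProj_mul_oracle hc)
    (zeroProj_commute_onWire outWire_notMem_lcu _) (zeroProj_commute_onWire outWire_notMem_lcu _)
    (lcuProj_commute_oracle V) (lcuProj_commute_onSys T) (lcuProj_commute_onSys H)
    (onWire_commute hlo _ _) (onWire_commute hlo _ _) (csys _ _ _) (csys _ _ _)
    (by rw [zeroProj_singleton]; exact onWire_commute hsl _ _)
    (onWire_commute hsl _ _) (onWire_commute hso _ _) (onWire_commute hso _ _)
    (onWire_inl_commute_oracle 0 _ V) (cenc (inl_inl_notMem_encWires 0) _).symm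
    (csys _ _ _) (csys _ _ _) (zeroProj_commute _ _) (cenc (inl_inl_notMem_encWires 1) _)
    (cenc outWire_notMem_encWires _) (cenc outWire_notMem_encWires _)
    (encProj_commute_onSys _) (encProj_commute_onSys _)
  refine corner_eq_of_ancProj ?_
  have hr : (embed Function.Embedding.inr ((α / 2) • pauliComb H T) : Op (Wire 2 a n)) =
      (α / 2) • (onWire outWire matX * onSys T + onWire outWire matZ * onSys H) := by
    rw [add_comm, ← embed_inr_pauliComb]
    exact map_smul (embed Function.Embedding.inr) ((α / 2 : ℝ) : ℂ) _
  rw [toOp_lcuCircuit, hr, mul_smul_comm, ancProj_eq]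
  exact key

end LinearCombination

section Amplification

variable {a n : ℕ}

/-- The reflection about the zero state of the ancillae. -/
noncomputable def reflectCircuit (a n : ℕ) : Circuit 2 a n :=
  .single sigWire ⟨matX, matX_mem_unitary⟩ ::
    (Circuit.sign (insert lcuWire encWires) sigWire sigWire_notMem_insert ++
      [.single sigWire ⟨matX, matX_mem_unitary⟩])

lemma toOp_reflectCircuit (V : Op (Fin a ⊕ Fin n)) :
    (reflectCircuit a n).toOp V = 1 - 2 * ancProj (Fin 2 ⊕ Fin a) (Fin 1 ⊕ Fin n) := by
  have hx : onWire (sigWire : Wire 2 a n) matX * onWire sigWire matX = 1 := by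
    rw [← map_mul, matX_mul_self, map_one]
  have hxe : onWire (sigWire : Wire 2 a n) matX * matUnit sigWire 1 1 * onWire sigWire matX =
      matUnit sigWire 0 0 := by
    rw [onWire_eq]
    simp [matX, add_mul, mul_add, matUnit_mul]
  have hc := (zeroProj_commute_onWire (sigWire_notMem_insert (a := a) (n := n)) matX).eq
  have hc2 : Commute (encProj : Op (Wire 2 a n)) (matUnit sigWire 0 0) :=
    zeroProj_commute_onWire (inl_inl_notMem_encWires 0) _
  have hc3 : Commute (zeroProj {(lcuWire : Wire 2 a n)}) encProj := zeroProj_commute _ _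
  rw [reflectCircuit, Circuit.toOp_cons, Circuit.toOp_append, Circuit.toOp_cons, Circuit.toOp_nil,
    one_mul, Circuit.toOp_sign, Gate.toOp_single, ancProj_eq, ← hc2.eq,
    ← mul_assoc (zeroProj _) encProj, hc3.eq, ← insert_lcuWire, ← hxe]
  generalize zeroProj (insert lcuWire encWires : Finset (Wire 2 a n)) = P at *
  generalize matUnit (sigWire : Wire 2 a n) 1 1 = e at *
  change onWire sigWire matX * _ * onWire sigWire matX = _
  generalize onWire (sigWire : Wire 2 a n) matX = x at *
  calc x * (1 - 2 * (P * e)) * x = x * x - 2 * ((x * P) * e * x) := by noncomm_ring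
    _ = 1 - 2 * (P * (x * e * x)) := by rw [hx, ← hc]; simp only [mul_assoc]

/-- One round of oblivious amplitude amplification. The gate `-1` fixes the global phase. -/
noncomputable def amplify (Q : Circuit 2 a n) : Circuit 2 a n :=
  Q ++ (reflectCircuit a n ++ (Q.adjoint ++ (reflectCircuit a n ++
    (Q ++ [.single sigWire (-1)]))))

lemma queries_amplify (Q : Circuit 2 a n) : (amplify Q).queries = 3 * Q.queries := by
  have h1 : (reflectCircuit a n).queries = 0 := rfl
  have h2 : Circuit.queries [(.single sigWire (-1) : Gate 2 a n)] = 0 := rfl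
  rw [amplify]
  simp only [Circuit.queries_append, Circuit.queries_adjoint, h1, h2]
  ring

lemma toOp_amplify (V : Op (Fin a ⊕ Fin n)) (Q : Circuit 2 a n) :
    (amplify Q).toOp V = -(Q.toOp V * (1 - 2 * ancProj (Fin 2 ⊕ Fin a) (Fin 1 ⊕ Fin n)) *
      star (Q.toOp V) * (1 - 2 * ancProj (Fin 2 ⊕ Fin a) (Fin 1 ⊕ Fin n)) * Q.toOp V) := by
  have h : onWire (sigWire : Wire 2 a n) ((-1 : Matrix.unitaryGroup (Fin 2) ℂ) : Matrix _ _ ℂ) =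
      -1 := by
    rw [Unitary.coe_neg, map_neg]
    exact congrArg Neg.neg (map_one _)
  rw [amplify]
  simp only [Circuit.toOp_append, Circuit.toOp_cons, Circuit.toOp_nil, toOp_reflectCircuit,
    Circuit.toOp_adjoint, Gate.toOp_single, one_mul, h, neg_mul, mul_assoc]

/-- Amplification multiplies the angle by three, as `sin 3θ = 3 sin θ - 4 sin³ θ`, and the error by
at most `15`. -/
lemma corner_iterate_amplify {V : Op (Fin a ⊕ Fin n)} (hV : V ∈ unitary (Op (Fin a ⊕ Fin n)))
    {U : Op (Fin 1 ⊕ Fin n)} (hU : U ∈ unitary (Op (Fin 1 ⊕ Fin n))) (k : ℕ) {Q : Circuit 2 a n}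
    {θ η : ℝ} (h : ‖corner (Q.toOp V) - Real.sin θ • U‖ ≤ η) :
    ‖corner ((amplify^[k] Q).toOp V) - Real.sin (3 ^ k * θ) • U‖ ≤ 15 ^ k * η := by
  induction k generalizing Q θ η with
  | zero => simpa using h
  | succ k ih =>
    have hQ := Circuit.toOp_mem_unitary Q hV
    have h1 : ‖corner ((amplify Q).toOp V) - Real.sin (3 * θ) • U‖ ≤ 15 * η := by
      rw [toOp_amplify, corner_amplify hQ, Real.sin_three_mul]
      exact norm_amplify_sub_le ((norm_corner_le _).trans (norm_unitary_le_one hQ)) hU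
        (Real.abs_sin_le_one θ) h
    have h2 := ih h1
    rw [Function.iterate_succ_apply, pow_succ, pow_succ, mul_assoc, mul_assoc]
    exact h2

lemma queries_iterate_amplify (k : ℕ) (Q : Circuit 2 a n) :
    (amplify^[k] Q).queries = 3 ^ k * Q.queries := by
  induction k with
  | zero => simp
  | succ k ih => rw [Function.iterate_succ_apply', queries_amplify, ih]; ring

end Amplification

section NoQuery

variable {a n : ℕ}

/-- The circuit without queries that block encodes `√(1 - s²) X` on the output ancilla. -/
noncomputable def dampedXCircuit (a n : ℕ) {s : ℝ} (hs : |s| ≤ 1) : Circuit 2 a n :=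
  [.single sigWire ⟨rotation s, rotation_mem_unitary hs⟩, .single outWire ⟨matX, matX_mem_unitary⟩]

lemma corner_dampedXCircuit {s : ℝ} (hs : |s| ≤ 1) (V : Op (Fin a ⊕ Fin n)) :
    corner ((dampedXCircuit a n hs).toOp V) = pauliComb 0 (√(1 - s ^ 2) • 1) := by
  refine corner_eq_of_ancProj ?_
  have hx : Commute (ancProj (Fin 2 ⊕ Fin a) (Fin 1 ⊕ Fin n)) (onWire outWire matX) :=
    zeroProj_commute_onWire (by simp) _
  have he : matUnit (sigWire : Wire 2 a n) 0 0 * onWire sigWire (rotation s) *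
      matUnit sigWire 0 0 = √(1 - s ^ 2) • matUnit sigWire 0 0 := by
    rw [onWire_eq]
    have hr : ∀ (r : ℝ) (x : Op (Wire 2 a n)), (r : ℂ) • x = r • x := fun r x => rfl
    simp only [mul_add, add_mul, mul_smul_comm, smul_mul_assoc, matUnit_mul]
    simp [rotation, hr, matUnit_mul]
  have hr : ancProj (Fin 2 ⊕ Fin a) (Fin 1 ⊕ Fin n) * onWire sigWire (rotation s) *
      ancProj (Fin 2 ⊕ Fin a) (Fin 1 ⊕ Fin n) =
        √(1 - s ^ 2) • ancProj (Fin 2 ⊕ Fin a) (Fin 1 ⊕ Fin n) := by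
    have c0 : Commute (encProj : Op (Wire 2 a n)) (matUnit sigWire 0 0) :=
      zeroProj_commute_onWire (inl_inl_notMem_encWires 0) _
    have c1 : Commute (encProj : Op (Wire 2 a n)) (onWire sigWire (rotation s)) :=
      zeroProj_commute_onWire (inl_inl_notMem_encWires 0) _
    have c2 : Commute (zeroProj {(lcuWire : Wire 2 a n)}) (onWire sigWire (rotation s)) :=
      zeroProj_commute_onWire (by simp) _
    have c3 : Commute (zeroProj {(lcuWire : Wire 2 a n)}) (matUnit sigWire 0 0) :=
      zeroProj_commute_onWire (by simp) _
    have c4 : zeroProj {(lcuWire : Wire 2 a n)} * encProj * (zeroProj {lcuWire} * encProj) =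
        zeroProj {lcuWire} * encProj := by
      rw [encProj, zeroProj_mul, zeroProj_sq]
    have e : ancProj (Fin 2 ⊕ Fin a) (Fin 1 ⊕ Fin n) =
        matUnit sigWire 0 0 * (zeroProj {lcuWire} * encProj) := by
      rw [ancProj_eq, ← mul_assoc, c3.eq, mul_assoc]
    have c5 : Commute (zeroProj {(lcuWire : Wire 2 a n)} * encProj)
        (onWire sigWire (rotation s) * matUnit sigWire 0 0) :=
      (c2.mul_right c3).mul_left (c1.mul_right c0)
    rw [e]
    generalize zeroProj {(lcuWire : Wire 2 a n)} * encProj = Z at *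
    calc matUnit sigWire 0 0 * Z * onWire sigWire (rotation s) * (matUnit sigWire 0 0 * Z)
        = matUnit sigWire 0 0 * (Z * (onWire sigWire (rotation s) * matUnit sigWire 0 0)) * Z := by
          simp only [mul_assoc]
      _ = matUnit sigWire 0 0 * onWire sigWire (rotation s) * matUnit sigWire 0 0 * (Z * Z) := by
          rw [c5.eq]; simp only [mul_assoc]
      _ = _ := by rw [he, c4, smul_mul_assoc]
  have h1 : (onSys (√(1 - s ^ 2) • (1 : Op (Fin n))) : Op (Wire 2 a n)) = √(1 - s ^ 2) • 1 := by
    have : onSys (√(1 - s ^ 2) • (1 : Op (Fin n))) =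
      ((√(1 - s ^ 2) : ℝ) : ℂ) • (onSys 1 : Op (Wire 2 a n)) :=
      map_smul (embed sysEmb) ((√(1 - s ^ 2) : ℝ) : ℂ) _
    rw [this, onSys, map_one]
    rfl
  have h0 : (onSys (0 : Op (Fin n)) : Op (Wire 2 a n)) = 0 := map_zero (embed sysEmb)
  rw [embed_inr_pauliComb, h1, h0, mul_zero, zero_add, mul_smul_comm, mul_one, mul_smul_comm,
    dampedXCircuit, Circuit.toOp_cons, Circuit.toOp_cons, Circuit.toOp_nil, one_mul,
    Gate.toOp_single, Gate.toOp_single]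
  change ancProj (Fin 2 ⊕ Fin a) (Fin 1 ⊕ Fin n) *
    (onWire outWire matX * onWire sigWire (rotation s)) *
      ancProj (Fin 2 ⊕ Fin a) (Fin 1 ⊕ Fin n) = _
  rw [← mul_assoc, hx.eq, mul_assoc, mul_assoc, ← mul_assoc (ancProj _ _), hr, mul_smul_comm]

end NoQuery

end BlockEnc

/-! ### Error bounds -/

namespace BlockEnc

section Final

variable {a n : ℕ}

lemma norm_pauliComb_sub_hermitianDilation_le {ι : Type} [Fintype ι] [DecidableEq ι] {H : Op ι}
    (hH : IsSelfAdjoint H) {f g : ℝ → ℝ} (hf : Continuous f) (hg : Continuous g) {B : ℝ}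
    (hB : 0 ≤ B) (h : ∀ x, |x| ≤ ‖H‖ → (f x - x) ^ 2 + (g x - √(1 - x ^ 2)) ^ 2 ≤ B ^ 2) :
    ‖pauliComb (cfc f H) (cfc g H) - hermitianDilation H‖ ≤ B := by
  rw [hermitianDilation_eq hH, pauliComb_sub, ← cfc_sub f (id : ℝ → ℝ) H,
    ← cfc_sub g (fun x : ℝ => √(1 - x ^ 2)) H]
  exact norm_pauliComb_cfc_le hH (hf.sub continuous_id) (hg.sub continuous_sqrt_one_sub_sq) hB h

lemma corner_eq_of_isBlockEncoding {κ ι : Type} [Fintype κ] [DecidableEq κ] [Fintype ι]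
    [DecidableEq ι] {V : Op (κ ⊕ ι)} {H : Op ι} (h : IsBlockEncoding 1 0 V H) : corner V = H := by
  have h2 := norm_le_zero_iff.1 h.2
  rw [Complex.ofReal_one, one_smul, sub_eq_zero] at h2
  exact h2.symm

/-- All the conclusions about the circuit `Q` follow from a bound on its block. -/
lemma conclusions_of_corner {V : Op (Fin a ⊕ Fin n)} {H : Op (Fin n)} (hH : IsSelfAdjoint H)
    (hn : ‖H‖ ≤ 1) (hV : IsBlockEncoding 1 0 V H) {Q : Circuit 2 a n} {ε η : ℝ}
    (h : ‖corner (Q.toOp V) - hermitianDilation H‖ ≤ ε)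
    (hclean : ImplementsClean η (Q.toOp V) (hermitianDilation H)) :
    IsBlockEncoding 1 0 (hermitianDilation H) H ∧
      IsBlockEncoding 1 ε (Q.toOp V) (hermitianDilation H) ∧
      ‖H - corner (corner (Q.toOp V))‖ ≤ ε ∧
      ImplementsClean η (Q.toOp V) (hermitianDilation H) := by
  have hc : corner (hermitianDilation H) = H := by
    rw [hermitianDilation, tensor_add_tensor_eq, corner_pauliComb]
  refine ⟨⟨hermitianDilation_mem_unitary hH hn, ?_⟩,
    ⟨Circuit.toOp_mem_unitary Q hV.1, ?_⟩, ?_, hclean⟩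
  · rw [hc, Complex.ofReal_one, one_smul, sub_self, norm_zero]
  · rwa [Complex.ofReal_one, one_smul, norm_sub_rev]
  · rw [norm_sub_rev]
    conv_lhs => rw [← hc, ← corner_sub]
    exact (norm_corner_le _).trans h

/-- For `η ≥ 2` there is nothing to prove, as both operators are contractions. -/
lemma implementsClean_two {κ ι : Type} [Fintype κ] [DecidableEq κ] [Fintype ι] [DecidableEq ι]
    {W : Op (κ ⊕ ι)} (hW : W ∈ unitary (Op (κ ⊕ ι))) {U : Op ι} (hU : U ∈ unitary (Op ι)) {η : ℝ}
    (hη : 2 ≤ η) : ImplementsClean η W U := by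
  refine (norm_sub_le _ _).trans ?_
  have h1 : ‖W * zeroKet κ ι‖ ≤ 1 * 1 := (Matrix.l2_opNorm_mul _ _).trans
    (mul_le_mul (norm_unitary_le_one hW) norm_zeroKet_le (norm_nonneg _) zero_le_one)
  have h2 : ‖zeroKet κ ι * U‖ ≤ 1 * 1 := (Matrix.l2_opNorm_mul _ _).trans
    (mul_le_mul norm_zeroKet_le (norm_unitary_le_one hU) (norm_nonneg _) zero_le_one)
  linarith

/-- If `ε ≥ 1 - δ`, then `√(1 - ε²) X ⊗ I` is a sufficient approximation. -/
lemma norm_dampedX_sub_le {H : Op (Fin n)} (hH : IsSelfAdjoint H) {ε : ℝ} (hε : 0 ≤ ε)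
    (hε1 : ε ≤ 1) (hn : ‖H‖ ≤ ε) :
    ‖pauliComb 0 (√(1 - ε ^ 2) • (1 : Op (Fin n))) - hermitianDilation H‖ ≤ ε := by
  have h := norm_pauliComb_sub_hermitianDilation_le hH (f := fun _ => 0)
    (g := fun _ => √(1 - ε ^ 2)) continuous_const continuous_const hε ?_
  · rwa [cfc_const (0 : ℝ) H, cfc_const (√(1 - ε ^ 2)) H, map_zero,
      Algebra.algebraMap_eq_smul_one] at h
  · intro x hx
    have hx2 : x ^ 2 ≤ ε ^ 2 := by
      rw [← sq_abs]
      exact pow_le_pow_left₀ (abs_nonneg x) (hx.trans hn) 2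
    have hε2 : ε ^ 2 ≤ 1 := pow_le_one₀ hε hε1
    have h1 := Real.sq_sqrt (show 0 ≤ 1 - ε ^ 2 by linarith)
    have h2 := Real.sq_sqrt (show 0 ≤ 1 - x ^ 2 by linarith)
    have h3 : √(1 - ε ^ 2) ≤ √(1 - x ^ 2) := Real.sqrt_le_sqrt (by linarith)
    have h4 := Real.sqrt_nonneg (1 - ε ^ 2)
    nlinarith

/-- The linear combination `(Z ⊗ H + X ⊗ I) / 2`, which takes a single query, is at distance at most
`1 / √2` from the dilation. -/
lemma norm_half_sub_le {H : Op (Fin n)} (hH : IsSelfAdjoint H) (hn : ‖H‖ ≤ 1) {ε : ℝ}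
    (hε : 0 ≤ ε) (hε2 : 1 / 2 ≤ ε ^ 2) :
    ‖(1 / 2 : ℝ) • pauliComb H 1 - hermitianDilation H‖ ≤ ε := by
  have h := norm_pauliComb_sub_hermitianDilation_le hH (f := fun x => (1 / 2 : ℝ) * x)
    (g := fun _ => (1 / 2 : ℝ)) (by fun_prop) continuous_const hε ?_
  · have hid : cfc (fun x : ℝ => (1 / 2 : ℝ) * x) H = (1 / 2 : ℝ) • H := by
      rw [cfc_const_mul (1 / 2 : ℝ) (fun x => x) H, cfc_id' ℝ H]
    rwa [hid, cfc_const (1 / 2 : ℝ) H, Algebra.algebraMap_eq_smul_one, ← pauliComb_smul] at h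
  · intro x hx
    have hx2 : x ^ 2 ≤ 1 := by
      rw [← sq_abs]
      exact pow_le_one₀ (abs_nonneg x) (hx.trans hn)
    have h2 := Real.sq_sqrt (show 0 ≤ 1 - x ^ 2 by linarith)
    have h3 := Real.sqrt_nonneg (1 - x ^ 2)
    have h4 := sqrt_one_sub_sq_le_one x
    nlinarith

lemma norm_sqrtPoly_sub_le {H : Op (Fin n)} (hH : IsSelfAdjoint H) {δ : ℝ} (hδ : 0 ≤ δ)
    (hδ1 : δ ≤ 1) (hn : ‖H‖ ≤ 1 - δ) (D : ℕ) :
    ‖pauliComb H (Polynomial.aeval (H ^ 2) (sqrtPoly D)) - hermitianDilation H‖ ≤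
      (1 - δ) ^ D := by
  have hT : Polynomial.aeval (H ^ 2) (sqrtPoly D) =
      cfc (fun x : ℝ => (sqrtPoly D).eval (x ^ 2)) H := by
    have h1 : (fun x : ℝ => (sqrtPoly D).eval (x ^ 2)) =
        fun x => ((sqrtPoly D).comp (Polynomial.X ^ 2)).eval x := by
      funext x; simp
    rw [h1, cfc_polynomial _ H, Polynomial.aeval_comp]
    simp
  have h := norm_pauliComb_sub_hermitianDilation_le hH (f := fun x => x)
    (g := fun x => (sqrtPoly D).eval (x ^ 2)) continuous_id (by fun_prop)
    (pow_nonneg (sub_nonneg.2 hδ1) D) ?_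
  · rwa [cfc_id' ℝ H, ← hT] at h
  · intro x hx
    have hxδ : |x| ≤ 1 - δ := hx.trans hn
    have hx1 : |x| ≤ 1 := by linarith
    have hx2 : x ^ 2 ≤ 1 - δ := by
      rw [← sq_abs]
      nlinarith [abs_nonneg x]
    have h1 := abs_sqrtPoly_eval_sub_le D (sq_nonneg x) (by linarith)
    have h2 : (x ^ 2) ^ (D + 1) ≤ (1 - δ) ^ D :=
      (pow_le_pow_left₀ (sq_nonneg x) hx2 _).trans
        (pow_le_pow_of_le_one (by linarith) (by linarith) (Nat.le_succ D))
    have h3 := pow_le_pow_left₀ (abs_nonneg _) (h1.trans h2) 2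
    rw [sq_abs] at h3
    simpa using h3

/-- The multiple of `sqrtFourier` by twice this sine has a coefficient norm of at most
`4 / 384 = 1 / 96`, as `exists_qspPair_eq` requires. -/
lemma sin_small : 0 ≤ Real.sin (Real.pi / 1458) ∧ Real.sin (Real.pi / 1458) ≤ 1 / 384 := by
  have hpi := Real.pi_pos
  have hpi2 := Real.pi_lt_d2
  refine ⟨Real.sin_nonneg_of_nonneg_of_le_pi (by positivity) (by linarith), ?_⟩
  exact (Real.sin_le (by positivity)).trans (by linarith)

/-- The sines of the signal processing circuit for the Taylor polynomial of degree `D`. -/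
lemma exists_sines (D : ℕ) : ∃ s : ℕ → ℝ, (∀ k, |s k| ≤ 1) ∧ (qspPair s (2 * D + 1)).2 =
    Polynomial.X * (Polynomial.C (2 * Real.sin (Real.pi / 1458)) * sqrtFourier D) := by
  obtain ⟨h0, h1⟩ := sin_small
  refine exists_qspPair_eq _ ?_ ?_
  · have h2 := sqrtFourier_natDegree_le D
    have h3 := Polynomial.natDegree_C_mul_le (2 * Real.sin (Real.pi / 1458)) (sqrtFourier D)
    omega
  · rw [coeffNorm_C_mul, abs_of_nonneg (by linarith)]
    have h2 := coeffNorm_sqrtFourier_le (2 * D + 1) D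
    have h3 := coeffNorm_nonneg (N := 2 * D + 1) (sqrtFourier D)
    nlinarith

/-- A circuit whose block is exponentially close in `D` to the dilation. Six rounds of amplification
take the amplitude `sin (π / (2 * 3 ^ 6))` to `1`. -/
lemma exists_circuit (a n D : ℕ) : ∃ Q : Circuit 2 a n, Q.queries = 3 ^ 6 * (6 * D + 5) ∧
    ∀ (H : Op (Fin n)) (V : Op (Fin a ⊕ Fin n)) (δ : ℝ), IsSelfAdjoint H → 0 ≤ δ → δ ≤ 1 →
      ‖H‖ ≤ 1 - δ → IsBlockEncoding 1 0 V H →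
        ‖corner (Q.toOp V) - hermitianDilation H‖ ≤ 15 ^ 6 * (1 - δ) ^ D := by
  obtain ⟨s, hs, hq⟩ := exists_sines D
  refine ⟨amplify^[6] (lcuCircuit (signalCircuit a n D s hs)), ?_, ?_⟩
  · rw [queries_iterate_amplify, queries_lcuCircuit, queries_signalCircuit]
  · intro H V δ hH hδ hδ1 hn hV
    have hc := corner_eq_of_isBlockEncoding hV
    obtain ⟨h0, h1⟩ := sin_small
    have hcorner := corner_lcuCircuit hc (signalCircuit_block hV.1 hH hc hs hq)
    rw [mul_div_cancel_left₀ _ two_ne_zero] at hcorner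
    have hU := hermitianDilation_mem_unitary hH (hn.trans (by linarith))
    have h2 : ‖corner ((lcuCircuit (signalCircuit a n D s hs)).toOp V) -
        Real.sin (Real.pi / 1458) • hermitianDilation H‖ ≤ (1 - δ) ^ D := by
      rw [hcorner, ← smul_sub, norm_smul, Real.norm_eq_abs]
      exact (mul_le_of_le_one_left (norm_nonneg _) (Real.abs_sin_le_one _)).trans
        (norm_sqrtPoly_sub_le hH hδ hδ1 hn D)
    have h3 := corner_iterate_amplify hV.1 hU 6 h2
    have h4 : Real.sin (3 ^ 6 * (Real.pi / 1458)) = 1 := by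
      rw [← Real.sin_pi_div_two]
      congr 1
      ring
    rwa [h4, one_smul] at h3

/-- The degree of the Taylor polynomial that is needed for precision `ε ^ 2`. -/
lemma exists_degree {δ ε : ℝ} (hδ : 0 < δ) (hδ1 : δ < 1) (hε : 0 < ε) (hε2 : ε ^ 2 < 1 / 2) :
    ∃ D : ℕ, 15 ^ 6 * (1 - δ) ^ D ≤ ε ^ 2 ∧
      (3 ^ 6 * (6 * D + 5) : ℝ) ≤ 2000000 * (1 / δ * Real.log (1 / ε)) := by
  have hlog : 1 / 4 ≤ Real.log (1 / ε) := by
    rw [one_div ε, Real.log_inv]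
    have := Real.log_le_sub_one_of_pos hε
    nlinarith
  have hlog15 : Real.log 15 ≤ 14 := (Real.log_le_sub_one_of_pos (by norm_num)).trans (by norm_num)
  set l := Real.log (1 / ε) with hl
  have hLg : Real.log (15 ^ 6 / ε ^ 2) = 6 * Real.log 15 + 2 * l := by
    rw [hl, Real.log_div (by norm_num) (by positivity), Real.log_pow, Real.log_pow, one_div,
      Real.log_inv]
    push_cast
    ring
  have hm : l ≤ 1 / δ * l := le_mul_of_one_le_left (by linarith) (by rw [le_div_iff₀ hδ]; linarith)
  refine ⟨⌈Real.log (15 ^ 6 / ε ^ 2) / δ⌉₊, ?_, ?_⟩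
  · set D := ⌈Real.log (15 ^ 6 / ε ^ 2) / δ⌉₊
    have hD : Real.log (15 ^ 6 / ε ^ 2) ≤ δ * D := by
      have := Nat.le_ceil (Real.log (15 ^ 6 / ε ^ 2) / δ)
      rwa [div_le_iff₀ hδ, mul_comm] at this
    have h1 : (1 - δ) ^ D ≤ Real.exp (-(δ * D)) := by
      have := pow_le_pow_left₀ (by linarith) (Real.one_sub_le_exp_neg δ) D
      rwa [← Real.exp_nat_mul, mul_comm, neg_mul] at this
    have h2 : Real.exp (-(δ * D)) ≤ (15 ^ 6 / ε ^ 2)⁻¹ := by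
      rw [← Real.exp_log (show (0 : ℝ) < 15 ^ 6 / ε ^ 2 by positivity), ← Real.exp_neg,
        Real.exp_le_exp]
      linarith
    calc 15 ^ 6 * (1 - δ) ^ D ≤ 15 ^ 6 * (15 ^ 6 / ε ^ 2)⁻¹ := by
          exact mul_le_mul_of_nonneg_left (h1.trans h2) (by positivity)
      _ = ε ^ 2 := by rw [inv_div]; field_simp
  · have h0 : 0 ≤ Real.log (15 ^ 6 / ε ^ 2) / δ := by
      rw [hLg]
      have := Real.log_nonneg (show (1 : ℝ) ≤ 15 by norm_num)
      positivity
    have h1 := (Nat.ceil_lt_add_one h0).le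
    -- `6 * log 15 ≤ 84 ≤ 336 * l`, since `1 / 4 ≤ l`.
    have h2 : Real.log (15 ^ 6 / ε ^ 2) / δ ≤ 338 * (1 / δ * l) := by
      rw [hLg, div_eq_mul_one_div, mul_comm, mul_left_comm]
      exact mul_le_mul_of_nonneg_left (by linarith) (by positivity)
    norm_num
    norm_num at h1 h2 hm
    linarith

end Final

end BlockEnc

theorem theorem1 :
    ∃ (c : ℕ) (C K : ℝ), ∀ (n a : ℕ) (δ ε : ℝ), 0 < δ → δ < 1 → 0 < ε → ε < 1 →
      ∃ Q : BlockEnc.Circuit c a n,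
        (Q.queries : ℝ) ≤ C * (1 / δ * Real.log (1 / ε)) ∧
        ∀ (H : BlockEnc.Op (Fin n)) (V : BlockEnc.Op (Fin a ⊕ Fin n)),
          H.IsHermitian → ‖H‖ ≤ 1 - δ → BlockEnc.IsBlockEncoding 1 0 V H →
            BlockEnc.IsBlockEncoding 1 0 (BlockEnc.hermitianDilation H) H ∧
            BlockEnc.IsBlockEncoding 1 ε (Q.toOp V) (BlockEnc.hermitianDilation H) ∧
            ‖H - BlockEnc.corner (BlockEnc.corner (Q.toOp V))‖ ≤ ε ∧
            BlockEnc.ImplementsClean (K * ε) (Q.toOp V) (BlockEnc.hermitianDilation H) := by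
  refine ⟨2, 2000000, 4, fun n a δ ε hδ hδ1 hε hε1 => ?_⟩
  have hlogε := Real.log_le_sub_one_of_pos hε
  rcases lt_or_ge (ε ^ 2) (1 / 2) with hε2 | hε2
  · obtain ⟨D, hD, hQ⟩ := BlockEnc.exists_degree hδ hδ1 hε hε2
    obtain ⟨Q, hq, h⟩ := BlockEnc.exists_circuit a n D
    -- The block has the error `ε ^ 2`, which leaves an error of order `ε` in the ancillae.
    refine ⟨Q, by rw [hq]; exact_mod_cast hQ, fun H V hH hn hV => ?_⟩
    have hn1 : ‖H‖ ≤ 1 := by linarith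
    have hc := (h H V δ hH hδ.le hδ1.le hn hV).trans hD
    refine BlockEnc.conclusions_of_corner hH hn1 hV (hc.trans (by nlinarith)) ?_
    have := BlockEnc.implementsClean_of_corner (BlockEnc.Circuit.toOp_mem_unitary Q hV.1)
      (BlockEnc.hermitianDilation_mem_unitary hH hn1) hε.le hc
    exact le_trans this (by linarith)
  · -- Now `ε` is bounded below, so only the bounds on the block matter.
    have hK : 2 ≤ 4 * ε := by nlinarith
    rcases le_or_gt (1 - δ) ε with hδε | hδε
    · -- For `ε` close to `1` the query bound tends to zero, so the circuit must not query at all.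
      refine ⟨BlockEnc.dampedXCircuit a n (abs_le.2 ⟨by linarith, hε1.le⟩), ?_,
        fun H V hH hn hV => ?_⟩
      · have h0 : 0 ≤ Real.log (1 / ε) := Real.log_nonneg (by rw [le_div_iff₀ hε]; linarith)
        change ((0 : ℕ) : ℝ) ≤ _
        rw [Nat.cast_zero]
        positivity
      · have hn1 : ‖H‖ ≤ 1 := by linarith
        refine BlockEnc.conclusions_of_corner hH hn1 hV ?_ (BlockEnc.implementsClean_two
          (BlockEnc.Circuit.toOp_mem_unitary _ hV.1)
          (BlockEnc.hermitianDilation_mem_unitary hH hn1) hK)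
        rw [BlockEnc.corner_dampedXCircuit]
        exact BlockEnc.norm_dampedX_sub_le hH hε.le hε1.le (hn.trans hδε)
    · -- Here `δ < 1 - ε ≤ log (1 / ε)`, so one query is allowed.
      refine ⟨BlockEnc.lcuCircuit [], ?_, fun H V hH hn hV => ?_⟩
      · have h1 : 1 ≤ 1 / δ * Real.log (1 / ε) := by
          rw [one_div ε, Real.log_inv, one_div, ← div_eq_inv_mul, le_div_iff₀ hδ]
          linarith
        change ((1 : ℕ) : ℝ) ≤ _
        rw [Nat.cast_one]
        linarith
      · have hn1 : ‖H‖ ≤ 1 := by linarith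
        refine BlockEnc.conclusions_of_corner hH hn1 hV ?_ (BlockEnc.implementsClean_two
          (BlockEnc.Circuit.toOp_mem_unitary _ hV.1)
          (BlockEnc.hermitianDilation_mem_unitary hH hn1) hK)
        have hS : BlockEnc.matUnit BlockEnc.sigWire 0 0 *
            BlockEnc.Circuit.toOp V ([] : BlockEnc.Circuit 2 a n) *
              (BlockEnc.matUnit BlockEnc.sigWire 0 0 * BlockEnc.encProj) =
            (1 : ℝ) • (BlockEnc.matUnit BlockEnc.sigWire 0 0 * BlockEnc.encProj *
              (BlockEnc.zeroProj {BlockEnc.lcuWire} * BlockEnc.onSys 1 +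
                (1 - BlockEnc.zeroProj {BlockEnc.lcuWire}))) := by
          rw [BlockEnc.Circuit.toOp_nil, BlockEnc.onSys, map_one, one_smul, mul_one, mul_one,
            ← mul_assoc, BlockEnc.matUnit_mul, if_pos rfl, add_sub_cancel, mul_one]
        rw [BlockEnc.corner_lcuCircuit (BlockEnc.corner_eq_of_isBlockEncoding hV) hS]
        exact BlockEnc.norm_half_sub_le hH hn1 hε.le hε2
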